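/- For $N\in\mathbb{N}=\{1,2,3,\dots\}$ let $$\widehat S_N=\begin{pmatrix}0&0&0&0&1\\0&0&0&1&0\\0&0&-2N&0&0\\0&1&0&0&0\\1&0&0&0&0\end{pmatrix},$$ let $SO(\widehat S_N;\mathbb{R})=\{M\in SL_5(\mathbb{R}) : M'\widehat S_N M=\widehat S_N\}$ (where $M'$ is the transpose), and let $SO_0(\widehat S_N;\mathbb{R})$ be its connected component of the identity. Let $\widehat\Gamma_N=SO_0(\widehat S_N;\mathbb{Z})$ and $\widehat{\mathcal G}_N=SO_0(\widehat S_N;\mathbb{Q})$ be the groups of integral, respectively rational, matrices in $SO_0(\widehat S_N;\mathbb{R})$, and for a prime $p$ let $\widehat{\mathcal G}_{N,p}$ be the subgroup of all matrices in $\widehat{\mathcal G}_N$ of the form $p^{-r}M$ with $M$ integral and $r\ge 0$. For a Hecke pair $(U,G)$ (that is, $U$ is a subgroup of the group $G$ and each double coset $UgU$, $g\in G$, is a finite union of right cosets $Uh$) let $\mathcal H(U,G)$ be the Hecke algebra over $\mathbb{Z}$: the $U$-invariant elements (under right multiplication) of the free $\mathbb{Z}$-module on the right cosets $Uh$, with the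 product $\sum_i a_i\,Ug_i\cdot\sum_j b_j\,Uh_j=\sum_{i,j}a_ib_j\,Ug_ih_j$; a double coset is identified with the sum of the right cosets contained in it. The pairs $(\widehat\Gamma_N,\widehat{\mathcal G}_N)$ and $(\widehat\Gamma_N,\widehat{\mathcal G}_{N,p})$ are Hecke pairs. Put $$T_{N,1}(p)=\widehat\Gamma_N\,\tfrac1p\,\mathrm{diag}(1,p,p,p,p^2)\,\widehat\Gamma_N,\qquad T_{N,2}(p)=\widehat\Gamma_N\,\tfrac1p\,\mathrm{diag}(1,1,p,p^2,p^2)\,\widehat\Gamma_N.$$ **Theorem 3.** Let $N\in\mathbb{N}$ be squarefree. (i) For every prime $p$ the primary component $\mathcal H(\widehat\Gamma_N,\widehat{\mathcal G}_{N,p})$ is the ring of all polynomials over $\mathbb{Z}$ in $T_{N,1}(p)$ and $T_{N,2}(p)$, and these two elements are algebraically independent; that is, there is a ring isomorphism $\mathbb{Z}[X_1,X_2]\to\mathcal H(\widehat\Gamma_N,\widehat{\mathcal G}_{N,p})$ with $X_1\mapsto T_{N,1}(p)$ and $X_2\mapsto T_{N,2}(p)$. (ii) The Hecke algebra $\mathcal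 H(\widehat\Gamma_N,\widehat{\mathcal G}_N)$ has no zero-divisors. -/

import Mathlib

/-! ### The Hecke algebra over `ℤ` of a pair `(U, G)` -/

namespace HeckeSO

section Abstract

variable {G : Type*} [Group G]

/-- The set `U \ G` of right cosets `U h`, `h ∈ G`. -/
abbrev RightCosets (U : Subgroup G) : Type _ := Quotient (QuotientGroup.rightRel U)

/-- The right coset `U g`. -/
def coset (U : Subgroup G) (g : G) : RightCosets U := Quotient.mk (QuotientGroup.rightRel U) g

/-- The set of right cosets contained in the double coset `U g U`. -/
def cosetsIn (U : Subgroup G) (g : G) : Set (RightCosets U) :=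
  {c | ∃ x ∈ DoubleCoset.doubleCoset g (U : Set G) (U : Set G), coset U x = c}

/-- `(U, G)` is a Hecke pair: each double coset `U g U` consists of finitely many right cosets. -/
def IsHeckePair (U : Subgroup G) : Prop := ∀ g : G, (cosetsIn U g).Finite

theorem coset_eq_iff {U : Subgroup G} {g h : G} : coset U g = coset U h ↔ h * g⁻¹ ∈ U := by
  unfold coset
  rw [Quotient.eq]
  exact QuotientGroup.rightRel_apply

theorem coset_mul_left {U : Subgroup G} {u : G} (hu : u ∈ U) (g : G) :
    coset U (u * g) = coset U g := by
  rw [coset_eq_iff]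
  simpa using hu

/-- The right translation `U x ↦ U x g` on right cosets. -/
def translate (U : Subgroup G) (g : G) : RightCosets U → RightCosets U :=
  Quotient.map (fun x => x * g) (by
    intro a b hab
    have h : b * a⁻¹ ∈ U := QuotientGroup.rightRel_apply.1 hab
    refine QuotientGroup.rightRel_apply.2 ?_
    simpa [mul_assoc] using h)

theorem translate_coset (U : Subgroup G) (g x : G) :
    translate U g (coset U x) = coset U (x * g) := rfl

theorem translate_translate (U : Subgroup G) (g h : G) (c : RightCosets U) :
    translate U h (translate U g c) = translate U (g * h) c := by
  induction c using Quotient.inductionOn with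
  | h x => exact congrArg (coset U) (mul_assoc x g h)

theorem translate_one (U : Subgroup G) (c : RightCosets U) : translate U 1 c = c := by
  induction c using Quotient.inductionOn with
  | h x => exact congrArg (coset U) (mul_one x)

/-- Right translation by `g` on the free `ℤ`-module over the right cosets. -/
noncomputable def chainTranslate (U : Subgroup G) (g : G) :
    (RightCosets U →₀ ℤ) →ₗ[ℤ] (RightCosets U →₀ ℤ) :=
  Finsupp.lmapDomain ℤ ℤ (translate U g)

theorem chainTranslate_single (U : Subgroup G) (g : G) (c : RightCosets U) (a : ℤ) :
    chainTranslate U g (Finsupp.single c a) = Finsupp.single (translate U g c) a := by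
  simp [chainTranslate, Finsupp.mapDomain_single]

theorem chainTranslate_mul (U : Subgroup G) (g h : G) (x : RightCosets U →₀ ℤ) :
    chainTranslate U (g * h) x = chainTranslate U h (chainTranslate U g x) := by
  induction x using Finsupp.induction_linear with
  | zero => simp
  | add x y hx hy => simp only [map_add, hx, hy]
  | single c a => simp only [chainTranslate_single, translate_translate]

theorem chainTranslate_one (U : Subgroup G) (x : RightCosets U →₀ ℤ) :
    chainTranslate U 1 x = x := by
  induction x using Finsupp.induction_linear with
  | zero => simp
  | add x y hx hy => simp only [map_add, hx, hy]
  | single c a => simp only [chainTranslate_single, translate_one]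

/-- The elements of the free `ℤ`-module over the right cosets `U h` that are invariant under right
multiplication by `U`. -/
def invariants (U : Subgroup G) : AddSubgroup (RightCosets U →₀ ℤ) where
  carrier := {x | ∀ u ∈ U, chainTranslate U u x = x}
  zero_mem' := by intro u _; simp
  add_mem' := by
    intro x y hx hy u hu
    rw [map_add, hx u hu, hy u hu]
  neg_mem' := by
    intro x hx u hu
    rw [map_neg, hx u hu]

/-- The product `(∑ aᵢ U gᵢ) (∑ bⱼ U hⱼ) = ∑ aᵢ bⱼ U gᵢ hⱼ`. The representative `hⱼ = d.out` of the
right coset `d` is arbitrary: its choice does not matter when the left factor is invariant. -/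
noncomputable def chainMul (U : Subgroup G) (x y : RightCosets U →₀ ℤ) : RightCosets U →₀ ℤ :=
  x.sum fun c a => y.sum fun d b => Finsupp.single (translate U d.out c) (a * b)

/-- Left multiplication by `x` as a linear map. -/
noncomputable def chainMulLin (U : Subgroup G) (x : RightCosets U →₀ ℤ) :
    (RightCosets U →₀ ℤ) →ₗ[ℤ] (RightCosets U →₀ ℤ) :=
  Finsupp.linearCombination ℤ fun d => chainTranslate U d.out x

theorem chainMul_eq (U : Subgroup G) (x y : RightCosets U →₀ ℤ) :
    chainMul U x y = chainMulLin U x y := by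
  unfold chainMul chainMulLin
  rw [Finsupp.sum_comm, Finsupp.linearCombination_apply]
  refine Finsupp.sum_congr fun d _ => ?_
  rw [chainTranslate, Finsupp.lmapDomain_apply, Finsupp.mapDomain, Finsupp.smul_sum]
  refine Finsupp.sum_congr fun c _ => ?_
  rw [Finsupp.smul_single, smul_eq_mul, mul_comm]

theorem chainMulLin_add (U : Subgroup G) (x x' y : RightCosets U →₀ ℤ) :
    chainMulLin U (x + x') y = chainMulLin U x y + chainMulLin U x' y := by
  induction y using Finsupp.induction_linear with
  | zero => simp
  | add y z hy hz => rw [map_add, map_add, map_add, hy, hz]; abel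
  | single c a => simp [chainMulLin, Finsupp.linearCombination_single]

theorem chainMulLin_single {U : Subgroup G} {x : RightCosets U →₀ ℤ} (hx : x ∈ invariants U)
    (h : G) (b : ℤ) :
    chainMulLin U x (Finsupp.single (coset U h) b) = b • chainTranslate U h x := by
  have h1 : coset U (coset U h).out = coset U h := Quotient.out_eq _
  have h2 : (coset U h).out * h⁻¹ ∈ U := coset_eq_iff.1 h1.symm
  have h3 : (coset U h).out = ((coset U h).out * h⁻¹) * h := by simp
  rw [chainMulLin, Finsupp.linearCombination_single, h3, chainTranslate_mul, hx _ h2]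

theorem chainMulLin_translate {U : Subgroup G} {x : RightCosets U →₀ ℤ} (hx : x ∈ invariants U)
    (g : G) (y : RightCosets U →₀ ℤ) :
    chainMulLin U x (chainTranslate U g y) = chainTranslate U g (chainMulLin U x y) := by
  induction y using Finsupp.induction_linear with
  | zero => simp
  | add y z hy hz => simp only [map_add, hy, hz]
  | single c a =>
    induction c using Quotient.inductionOn with
    | h k =>
      change chainMulLin U x (chainTranslate U g (Finsupp.single (coset U k) a)) =
        chainTranslate U g (chainMulLin U x (Finsupp.single (coset U k) a))
      rw [chainTranslate_single, translate_coset, chainMulLin_single hx, chainMulLin_single hx,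
        map_smul, chainTranslate_mul]

theorem chainMulLin_mem {U : Subgroup G} {x y : RightCosets U →₀ ℤ} (hx : x ∈ invariants U)
    (hy : y ∈ invariants U) : chainMulLin U x y ∈ invariants U := by
  intro u hu
  rw [← chainMulLin_translate hx, hy u hu]

theorem chainMulLin_assoc {U : Subgroup G} {x y : RightCosets U →₀ ℤ} (hx : x ∈ invariants U)
    (hy : y ∈ invariants U) (z : RightCosets U →₀ ℤ) :
    chainMulLin U (chainMulLin U x y) z = chainMulLin U x (chainMulLin U y z) := by
  induction z using Finsupp.induction_linear with
  | zero => simp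
  | add z w hz hw => simp only [map_add, hz, hw]
  | single c a =>
    induction c using Quotient.inductionOn with
    | h k =>
      change chainMulLin U (chainMulLin U x y) (Finsupp.single (coset U k) a) =
        chainMulLin U x (chainMulLin U y (Finsupp.single (coset U k) a))
      rw [chainMulLin_single (chainMulLin_mem hx hy), chainMulLin_single hy, map_smul,
        chainMulLin_translate hx]

theorem one_mem_invariants (U : Subgroup G) :
    Finsupp.single (coset U 1) (1 : ℤ) ∈ invariants U := by
  intro u hu
  rw [chainTranslate_single, translate_coset, one_mul]
  congr 1
  simpa using coset_mul_left hu (1 : G)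

theorem chainMulLin_one {U : Subgroup G} {x : RightCosets U →₀ ℤ} (hx : x ∈ invariants U) :
    chainMulLin U x (Finsupp.single (coset U 1) 1) = x := by
  rw [chainMulLin_single hx, one_smul, chainTranslate_one]

theorem one_chainMulLin (U : Subgroup G) (y : RightCosets U →₀ ℤ) :
    chainMulLin U (Finsupp.single (coset U 1) 1) y = y := by
  induction y using Finsupp.induction_linear with
  | zero => simp
  | add z w hz hw => simp only [map_add, hz, hw]
  | single c a =>
    induction c using Quotient.inductionOn with
    | h k =>
      change chainMulLin U _ (Finsupp.single (coset U k) a) = Finsupp.single (coset U k) a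
      rw [chainMulLin_single (one_mem_invariants U), chainTranslate_single, translate_coset]
      simp

/-- The Hecke algebra `H(U, G)` over `ℤ`, for `U` a subgroup of the group `G`. For a Hecke pair,
a double coset `U g U` is identified with the sum of the right cosets it consists of, and these
sums form a `ℤ`-basis of the `U`-invariant chains of right cosets. -/
def HeckeAlgebra (U : Subgroup G) : Type _ := invariants U

noncomputable instance (U : Subgroup G) : AddCommGroup (HeckeAlgebra U) :=
  inferInstanceAs (AddCommGroup (invariants U))

noncomputable instance (U : Subgroup G) : Mul (HeckeAlgebra U) :=
  ⟨fun x y => ⟨chainMul U x.1 y.1, by rw [chainMul_eq]; exact chainMulLin_mem x.2 y.2⟩⟩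

noncomputable instance (U : Subgroup G) : One (HeckeAlgebra U) :=
  ⟨⟨Finsupp.single (coset U 1) 1, one_mem_invariants U⟩⟩

theorem val_mul {U : Subgroup G} (x y : HeckeAlgebra U) :
    (x * y).1 = chainMulLin U x.1 y.1 := chainMul_eq U x.1 y.1

theorem val_add {U : Subgroup G} (x y : HeckeAlgebra U) : (x + y).1 = x.1 + y.1 := rfl

theorem val_zero {U : Subgroup G} : (0 : HeckeAlgebra U).1 = 0 := rfl

theorem val_one {U : Subgroup G} :
    (1 : HeckeAlgebra U).1 = Finsupp.single (coset U 1) 1 := rfl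

noncomputable instance (U : Subgroup G) : Ring (HeckeAlgebra U) :=
  { (inferInstance : AddCommGroup (HeckeAlgebra U)) with
    mul := (· * ·)
    one := 1
    left_distrib := fun x y z => Subtype.ext (by simp only [val_mul, val_add, map_add])
    right_distrib := fun x y z => Subtype.ext (by
      simp only [val_mul, val_add, chainMulLin_add])
    zero_mul := fun x => Subtype.ext (by
      have h := chainMulLin_add U 0 0 x.1
      rw [val_mul, val_zero]
      simpa using h)
    mul_zero := fun x => Subtype.ext (by rw [val_mul, val_zero, map_zero])
    mul_assoc := fun x y z => Subtype.ext (by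
      simp only [val_mul]
      exact chainMulLin_assoc x.2 y.2 z.1)
    one_mul := fun x => Subtype.ext (by rw [val_mul, val_one, one_chainMulLin])
    mul_one := fun x => Subtype.ext (by rw [val_mul, val_one, chainMulLin_one x.2]) }

theorem translate_mem_cosetsIn {U : Subgroup G} {g u : G} (hu : u ∈ U) (c : RightCosets U) :
    translate U u c ∈ cosetsIn U g ↔ c ∈ cosetsIn U g := by
  have key : ∀ u ∈ U, ∀ c ∈ cosetsIn U g, translate U u c ∈ cosetsIn U g := by
    rintro u hu c ⟨x, hx, rfl⟩
    obtain ⟨a, ha, b, hb, rfl⟩ := DoubleCoset.mem_doubleCoset.1 hx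
    exact ⟨a * g * b * u, DoubleCoset.mem_doubleCoset.2
      ⟨a, ha, b * u, U.mul_mem hb hu, by group⟩, rfl⟩
  refine ⟨fun h => ?_, key u hu c⟩
  have h' := key u⁻¹ (U.inv_mem hu) _ h
  rwa [translate_translate, mul_inv_cancel, translate_one] at h'

/-- The double coset `U g U` as an element of the Hecke algebra: the sum of the right cosets
contained in it. -/
noncomputable def doubleCosetElement {U : Subgroup G} (hU : IsHeckePair U) (g : G) :
    HeckeAlgebra U :=
  ⟨Finsupp.indicator (hU g).toFinset fun _ _ => 1, by
    intro u hu
    have hinj : Function.Injective (translate U u) := by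
      intro c d hcd
      have := congrArg (translate U u⁻¹) hcd
      simpa [translate_translate, translate_one] using this
    ext c
    obtain ⟨d, rfl⟩ : ∃ d, translate U u d = c :=
      ⟨translate U u⁻¹ c, by simp [translate_translate, translate_one]⟩
    rw [chainTranslate, Finsupp.lmapDomain_apply, Finsupp.mapDomain_apply hinj]
    classical
    simp only [Finsupp.indicator_apply, Set.Finite.mem_toFinset, translate_mem_cosetsIn hu]⟩

end Abstract

/-! ### The orthogonal groups -/

section Orthogonal

open Matrix

/-- The symmetric matrix `Ŝ_N` of signature `(2, 3)`. -/
def Shat (N : ℕ) : Matrix (Fin 5) (Fin 5) ℝ :=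
  !![0, 0, 0, 0, 1;
     0, 0, 0, 1, 0;
     0, 0, -2 * (N : ℝ), 0, 0;
     0, 1, 0, 0, 0;
     1, 0, 0, 0, 0]

/-- `SO(Ŝ_N; ℝ)`, the matrices `M ∈ SL₅(ℝ)` with `Mᵀ Ŝ_N M = Ŝ_N`. -/
def SOReal (N : ℕ) : Subgroup (Matrix.SpecialLinearGroup (Fin 5) ℝ) where
  carrier := {M | (M : Matrix (Fin 5) (Fin 5) ℝ)ᵀ * Shat N * (M : Matrix (Fin 5) (Fin 5) ℝ)
    = Shat N}
  one_mem' := by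
    change (1 : Matrix (Fin 5) (Fin 5) ℝ)ᵀ * Shat N * 1 = Shat N
    simp
  mul_mem' := by
    intro A B hA hB
    change A.1ᵀ * Shat N * A.1 = Shat N at hA
    change B.1ᵀ * Shat N * B.1 = Shat N at hB
    change (A.1 * B.1)ᵀ * Shat N * (A.1 * B.1) = Shat N
    calc (A.1 * B.1)ᵀ * Shat N * (A.1 * B.1)
        = B.1ᵀ * (A.1ᵀ * Shat N * A.1) * B.1 := by
          rw [transpose_mul]; simp only [Matrix.mul_assoc]
      _ = Shat N := by rw [hA, hB]
  inv_mem' := by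
    intro A hA
    change A.1ᵀ * Shat N * A.1 = Shat N at hA
    change (A⁻¹).1ᵀ * Shat N * (A⁻¹).1 = Shat N
    have h1 : A.1 * (A⁻¹).1 = 1 := congrArg Subtype.val (mul_inv_cancel A)
    have h2 : (A⁻¹).1ᵀ * A.1ᵀ = 1 := by rw [← transpose_mul, h1, transpose_one]
    calc (A⁻¹).1ᵀ * Shat N * (A⁻¹).1
        = (A⁻¹).1ᵀ * (A.1ᵀ * Shat N * A.1) * (A⁻¹).1 := by rw [hA]
      _ = ((A⁻¹).1ᵀ * A.1ᵀ) * Shat N * (A.1 * (A⁻¹).1) := by simp only [Matrix.mul_assoc]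
      _ = Shat N := by rw [h1, h2, Matrix.one_mul, Matrix.mul_one]

/-- `SO₀(Ŝ_N; ℝ)`, the connected component of the identity in `SO(Ŝ_N; ℝ)`. -/
def SO0Real (N : ℕ) : Subgroup (Matrix.SpecialLinearGroup (Fin 5) ℝ) :=
  (Subgroup.connectedComponentOfOne (SOReal N)).map (SOReal N).subtype

/-- `Ĝ_N = SO₀(Ŝ_N; ℚ)`, the rational matrices in `SO₀(Ŝ_N; ℝ)`. -/
noncomputable def GHat (N : ℕ) : Subgroup (Matrix.SpecialLinearGroup (Fin 5) ℚ) :=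
  (SO0Real N).comap (Matrix.SpecialLinearGroup.map (algebraMap ℚ ℝ))

/-- `Γ̂_N = SO₀(Ŝ_N; ℤ)`, the integral matrices in `SO₀(Ŝ_N; ℝ)`, inside `Ĝ_N`. -/
noncomputable def GammaHat (N : ℕ) : Subgroup (Matrix.SpecialLinearGroup (Fin 5) ℚ) :=
  GHat N ⊓ (Matrix.SpecialLinearGroup.map (n := Fin 5) (Int.castRingHom ℚ)).range

/-- `Ĝ_{N,p}`, the matrices `p⁻ʳ M` in `Ĝ_N` with `M` integral and `r ≥ 0`. -/
noncomputable def GHatPrimary (N p : ℕ) : Subgroup (Matrix.SpecialLinearGroup (Fin 5) ℚ) where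
  carrier := {g | g ∈ GHat N ∧ ∃ (r : ℕ) (M : Matrix (Fin 5) (Fin 5) ℤ),
    (g : Matrix (Fin 5) (Fin 5) ℚ) = ((p : ℚ) ^ r)⁻¹ • M.map (Int.cast : ℤ → ℚ)}
  one_mem' := ⟨(GHat N).one_mem, 0, 1, by simp⟩
  mul_mem' := by
    rintro a b ⟨ha, r, A, hA⟩ ⟨hb, s, B, hB⟩
    refine ⟨(GHat N).mul_mem ha hb, r + s, A * B, ?_⟩
    have h : (A * B).map (Int.cast : ℤ → ℚ) = A.map (Int.cast : ℤ → ℚ) * B.map Int.cast :=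
      Matrix.map_mul (f := Int.castRingHom ℚ)
    change a.1 * b.1 = _
    rw [hA, hB, h, smul_mul_smul_comm, pow_add, mul_inv]
  inv_mem' := by
    rintro a ⟨ha, r, A, hA⟩
    refine ⟨(GHat N).inv_mem ha, r * 4, A.adjugate, ?_⟩
    have h : A.adjugate.map (Int.cast : ℤ → ℚ) = (A.map (Int.cast : ℤ → ℚ)).adjugate :=
      RingHom.map_adjugate (Int.castRingHom ℚ) A
    change a.1.adjugate = _
    rw [hA, h, Matrix.adjugate_smul, pow_mul]
    simp

theorem GHatPrimary_le (N p : ℕ) : GHatPrimary N p ≤ GHat N := fun _ h => h.1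

/-- The Hecke algebra `H(Γ̂_N, Ĝ_N)`. -/
abbrev HeckeFull (N : ℕ) : Type := HeckeAlgebra ((GammaHat N).subgroupOf (GHat N))

/-- The primary component `H(Γ̂_N, Ĝ_{N,p})`. -/
abbrev HeckePrimary (N p : ℕ) : Type := HeckeAlgebra ((GammaHat N).subgroupOf (GHatPrimary N p))

theorem exists_common_denominator (A : Matrix (Fin 5) (Fin 5) ℚ) :
    ∃ (m : ℕ) (B : Matrix (Fin 5) (Fin 5) ℤ), m ≠ 0 ∧
      (m : ℚ) • A = B.map (Int.cast : ℤ → ℚ) := by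
  refine ⟨∏ i, ∏ j, (A i j).den, fun i j => ((∏ i, ∏ j, (A i j).den : ℕ) * A i j).num, ?_, ?_⟩
  · exact Finset.prod_ne_zero_iff.2 fun i _ => Finset.prod_ne_zero_iff.2 fun j _ => (A i j).den_ne_zero
  · ext i j
    have hd : (A i j).den ∣ ∏ i, ∏ j, (A i j).den :=
      (Finset.dvd_prod_of_mem (fun j => (A i j).den) (Finset.mem_univ j)).trans
        (Finset.dvd_prod_of_mem (fun i => ∏ j, (A i j).den) (Finset.mem_univ i))
    obtain ⟨k, hk⟩ := hd
    have h1 : ((∏ i, ∏ j, (A i j).den : ℕ) : ℚ) * A i j = ((k * (A i j).num : ℤ) : ℚ) := by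
      rw [hk]
      have := Rat.mul_den_eq_num (A i j)
      push_cast
      linear_combination (k : ℚ) * this
    change ((∏ i, ∏ j, (A i j).den : ℕ) : ℚ) * A i j =
      ((((∏ i, ∏ j, (A i j).den : ℕ) : ℚ) * A i j).num : ℚ)
    rw [h1, Rat.num_intCast]

theorem conj_integral {N : ℕ} {g a b : Matrix.SpecialLinearGroup (Fin 5) ℚ} (hg : g ∈ GHat N)
    {m k : ℕ} {B C : Matrix (Fin 5) (Fin 5) ℤ}
    (hB : (m : ℚ) • (g : Matrix (Fin 5) (Fin 5) ℚ) = B.map (Int.cast : ℤ → ℚ))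
    (hC : (k : ℚ) • ((g⁻¹ : Matrix.SpecialLinearGroup (Fin 5) ℚ) : Matrix (Fin 5) (Fin 5) ℚ)
      = C.map (Int.cast : ℤ → ℚ))
    (ha : a ∈ GHat N) (hb : b ∈ GHat N) {x y : Matrix.SpecialLinearGroup (Fin 5) ℤ}
    (hx : Matrix.SpecialLinearGroup.map (Int.castRingHom ℚ) x = a)
    (hy : Matrix.SpecialLinearGroup.map (Int.castRingHom ℚ) y = b)
    (hxy : (x : Matrix (Fin 5) (Fin 5) ℤ).map (Int.cast : ℤ → ZMod (m * k)) =
      (y : Matrix (Fin 5) (Fin 5) ℤ).map (Int.cast : ℤ → ZMod (m * k))) :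
    (g * a) * (g * b)⁻¹ ∈ GammaHat N := by
  have hdvd : ∃ D : Matrix (Fin 5) (Fin 5) ℤ,
      (x : Matrix (Fin 5) (Fin 5) ℤ) - y = ((m * k : ℕ) : ℤ) • D := by
    have : ∀ i j, ∃ d : ℤ, (x : Matrix (Fin 5) (Fin 5) ℤ) i j - (y : Matrix (Fin 5) (Fin 5) ℤ) i j
        = ((m * k : ℕ) : ℤ) * d := by
      intro i j
      have h := congrFun (congrFun hxy i) j
      simp only [Matrix.map_apply] at h
      exact (ZMod.intCast_eq_intCast_iff_dvd_sub _ _ _).1 h.symm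
    choose D hD using this
    exact ⟨Matrix.of D, by ext i j; exact hD i j⟩
  obtain ⟨D, hD⟩ := hdvd
  have mapmul : ∀ P Q : Matrix (Fin 5) (Fin 5) ℤ, (P * Q).map (Int.cast : ℤ → ℚ) =
      P.map (Int.cast : ℤ → ℚ) * Q.map Int.cast := fun P Q =>
    Matrix.map_mul (f := Int.castRingHom ℚ)
  have hbinv : ((b⁻¹ : Matrix.SpecialLinearGroup (Fin 5) ℚ) : Matrix (Fin 5) (Fin 5) ℚ) =
      ((y⁻¹ : Matrix.SpecialLinearGroup (Fin 5) ℤ) : Matrix (Fin 5) (Fin 5) ℤ).map (Int.cast : ℤ → ℚ) := by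
    rw [← hy, ← map_inv]; rfl
  have haM : (a : Matrix (Fin 5) (Fin 5) ℚ) =
      (x : Matrix (Fin 5) (Fin 5) ℤ).map (Int.cast : ℤ → ℚ) := by
    rw [← hx]; rfl
  have hbM : (b : Matrix (Fin 5) (Fin 5) ℚ) =
      (y : Matrix (Fin 5) (Fin 5) ℤ).map (Int.cast : ℤ → ℚ) := by
    rw [← hy]; rfl
  set E : Matrix (Fin 5) (Fin 5) ℤ := B * D *
    ((y⁻¹ : Matrix.SpecialLinearGroup (Fin 5) ℤ) : Matrix (Fin 5) (Fin 5) ℤ) * C with hE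
  have hsub : (a : Matrix (Fin 5) (Fin 5) ℚ) = b + ((m : ℚ) * k) • D.map (Int.cast : ℤ → ℚ) := by
    rw [haM, hbM]
    ext i j
    have := congrFun (congrFun hD i) j
    simp only [Matrix.sub_apply, Matrix.smul_apply, smul_eq_mul] at this
    have h2 : ((x : Matrix (Fin 5) (Fin 5) ℤ) i j : ℚ) =
        (y : Matrix (Fin 5) (Fin 5) ℤ) i j + m * k * D i j := by
      have h3 := congrArg (Int.cast : ℤ → ℚ) this
      push_cast at h3
      linarith
    simpa using h2
  have hconj : (((g * a) * (g * b)⁻¹ : Matrix.SpecialLinearGroup (Fin 5) ℚ) :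
      Matrix (Fin 5) (Fin 5) ℚ) = (1 + E).map (Int.cast : ℤ → ℚ) := by
    have e1 : ((g * a) * (g * b)⁻¹ : Matrix.SpecialLinearGroup (Fin 5) ℚ) = g * a * b⁻¹ * g⁻¹ := by group
    have hgg : (g : Matrix (Fin 5) (Fin 5) ℚ) * (b : Matrix (Fin 5) (Fin 5) ℚ) *
        ((b⁻¹ : Matrix.SpecialLinearGroup (Fin 5) ℚ) : Matrix (Fin 5) (Fin 5) ℚ) *
        ((g⁻¹ : Matrix.SpecialLinearGroup (Fin 5) ℚ) : Matrix (Fin 5) (Fin 5) ℚ) = 1 := by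
      simp only [← Matrix.SpecialLinearGroup.coe_mul]
      rw [show g * b * b⁻¹ * g⁻¹ = 1 by group, Matrix.SpecialLinearGroup.coe_one]
    have e2 : (1 + E).map (Int.cast : ℤ → ℚ) = 1 + E.map (Int.cast : ℤ → ℚ) := by
      rw [Matrix.map_add _ (by intros; push_cast; rfl)]
      congr 1
      exact Matrix.map_one _ (by simp) (by simp)
    rw [e1, e2, hE, mapmul, mapmul, mapmul, ← hB, ← hC, ← hbinv, Matrix.SpecialLinearGroup.coe_mul,
      Matrix.SpecialLinearGroup.coe_mul, Matrix.SpecialLinearGroup.coe_mul, hsub, Matrix.mul_add,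
      Matrix.add_mul, Matrix.add_mul, hgg]
    congr 1
    simp only [Matrix.mul_smul, Matrix.smul_mul, smul_smul]
    congr 1
    ring
  clear_value E
  refine ⟨(GHat N).mul_mem ((GHat N).mul_mem hg ha) ((GHat N).inv_mem ((GHat N).mul_mem hg hb)),
    ⟨1 + E, ?_⟩, ?_⟩
  · have h1 : ((1 + E).map (Int.cast : ℤ → ℚ)).det = 1 := by
      rw [← hconj]; exact Matrix.SpecialLinearGroup.det_coe _
    have h2 : (((1 + E).det : ℤ) : ℚ) = ((1 + E).map (Int.cast : ℤ → ℚ)).det :=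
      RingHom.map_det (Int.castRingHom ℚ) (1 + E)
    rw [h1] at h2
    exact Int.cast_injective (h2.trans Int.cast_one.symm)
  · apply Subtype.ext
    exact hconj.symm

/-- `(Γ̂_N, G)` is a Hecke pair for every group `G ≤ Ĝ_N`. -/
theorem isHeckePair_of_le {N : ℕ} {H : Subgroup (Matrix.SpecialLinearGroup (Fin 5) ℚ)}
    (hH : H ≤ GHat N) : IsHeckePair ((GammaHat N).subgroupOf H) := by
  intro g
  obtain ⟨m, B, hm, hB⟩ := exists_common_denominator (g : Matrix.SpecialLinearGroup (Fin 5) ℚ)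
  obtain ⟨k, C, hk, hC⟩ := exists_common_denominator
    ((g : Matrix.SpecialLinearGroup (Fin 5) ℚ)⁻¹ : Matrix.SpecialLinearGroup (Fin 5) ℚ)
  have : NeZero (m * k) := ⟨Nat.mul_ne_zero hm hk⟩
  set U := (GammaHat N).subgroupOf H
  have hlift : ∀ u : U, ∃ x : Matrix.SpecialLinearGroup (Fin 5) ℤ,
      Matrix.SpecialLinearGroup.map (Int.castRingHom ℚ) x = (u : H).1 := fun u => u.2.2
  choose ι hι using hlift
  let f : U → Matrix (Fin 5) (Fin 5) (ZMod (m * k)) := fun u =>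
    (ι u : Matrix (Fin 5) (Fin 5) ℤ).map (Int.cast : ℤ → ZMod (m * k))
  have hf : ∀ u v : U, f u = f v → coset U (g * (u : H)) = coset U (g * (v : H)) := by
    intro u v huv
    rw [coset_eq_iff, Subgroup.mem_subgroupOf]
    exact conj_integral (hH g.2) hB hC (hH v.1.2) (hH u.1.2) (hι v) (hι u) huv.symm
  have hrange : cosetsIn U g ⊆ Set.range fun u : U => coset U (g * (u : H)) := by
    rintro c ⟨x, hx, rfl⟩
    obtain ⟨a, ha, b, hb, rfl⟩ := DoubleCoset.mem_doubleCoset.1 hx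
    exact ⟨⟨b, hb⟩, by rw [mul_assoc, coset_mul_left ha]⟩
  refine Set.Finite.subset ?_ hrange
  have hfin : (Set.range f).Finite := Set.toFinite _
  have : Set.range (fun u : U => coset U (g * (u : H))) ⊆
      (fun y : Matrix (Fin 5) (Fin 5) (ZMod (m * k)) =>
        coset U (g * ((Function.invFun f y : U) : H))) '' Set.range f := by
    rintro _ ⟨u, rfl⟩
    exact ⟨f u, ⟨u, rfl⟩, hf _ _ (Function.invFun_eq ⟨u, rfl⟩)⟩
  exact (hfin.image _).subset this

/-- The path-connected torus `diag(eˢ, eᵗ, 1, e⁻ᵗ, e⁻ˢ)` in `SO(Ŝ_N; ℝ)`. -/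
noncomputable def torus (N : ℕ) (x : ℝ × ℝ) : SOReal N :=
  ⟨⟨diagonal ![Real.exp x.1, Real.exp x.2, 1, Real.exp (-x.2), Real.exp (-x.1)], by
    rw [det_diagonal]
    simp [Fin.prod_univ_succ, Real.exp_neg]⟩, by
    change (diagonal _)ᵀ * Shat N * diagonal _ = Shat N
    ext i j
    rw [diagonal_transpose, mul_diagonal, diagonal_mul]
    fin_cases i <;> fin_cases j <;> simp [Shat, Real.exp_neg]⟩

theorem torus_mem (N : ℕ) (x : ℝ × ℝ) : ((torus N x : SOReal N) :
    Matrix.SpecialLinearGroup (Fin 5) ℝ) ∈ SO0Real N := by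
  have hc : Continuous (torus N) := by
    refine Continuous.subtype_mk (Continuous.subtype_mk ?_ _) _
    refine Continuous.matrix_diagonal (continuous_pi fun i => ?_)
    fin_cases i
    all_goals
      simp
      fun_prop
  have h0 : torus N 0 = 1 := by
    refine Subtype.ext (Subtype.ext ?_)
    change diagonal _ = (1 : Matrix (Fin 5) (Fin 5) ℝ)
    rw [← diagonal_one]
    congr 1
    funext i
    fin_cases i <;> simp
  refine ⟨torus N x, ?_, rfl⟩
  exact (isPreconnected_range hc).subset_connectedComponent ⟨0, h0⟩ ⟨x, rfl⟩

theorem diag_mem (N : ℕ) {s t : ℝ} (hs : 0 < s) (ht : 0 < t) (g : Matrix.SpecialLinearGroup (Fin 5) ℚ)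
    (hg : (g : Matrix (Fin 5) (Fin 5) ℚ).map (algebraMap ℚ ℝ) = diagonal ![s, t, 1, t⁻¹, s⁻¹]) :
    g ∈ GHat N := by
  have h := torus_mem N (Real.log s, Real.log t)
  have e : Matrix.SpecialLinearGroup.map (algebraMap ℚ ℝ) g = (torus N (Real.log s, Real.log t)).1 := by
    refine Subtype.ext ?_
    change (g : Matrix (Fin 5) (Fin 5) ℚ).map (algebraMap ℚ ℝ) = diagonal _
    rw [hg]
    simp [Real.exp_neg, Real.exp_log hs, Real.exp_log ht]
  change Matrix.SpecialLinearGroup.map (algebraMap ℚ ℝ) g ∈ SO0Real N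
  rw [e]
  exact h

/-- The matrix `p⁻¹ diag(1, p, p, p, p²)` as an element of `Ĝ_{N,p}`. -/
noncomputable def d1 (N p : ℕ) (hp : p.Prime) : GHatPrimary N p :=
  have hp0 : (p : ℚ) ≠ 0 := Nat.cast_ne_zero.2 hp.ne_zero
  ⟨⟨(p : ℚ)⁻¹ • diagonal ![1, (p : ℚ), p, p, (p : ℚ) ^ 2], by
    rw [det_smul, det_diagonal]
    simp [Fin.prod_univ_succ]
    field_simp⟩, by
    have hpR : (0 : ℝ) < p := Nat.cast_pos.2 hp.pos
    refine ⟨diag_mem N (s := (p : ℝ)⁻¹) (t := 1) (by positivity) one_pos _ ?_, 1,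
      diagonal ![1, (p : ℤ), p, p, (p : ℤ) ^ 2], ?_⟩
    · ext i j
      fin_cases i <;> fin_cases j <;> simp [hpR.ne'] <;> field_simp
    · ext i j
      fin_cases i <;> fin_cases j <;> simp⟩

/-- The matrix `p⁻¹ diag(1, 1, p, p², p²)` as an element of `Ĝ_{N,p}`. -/
noncomputable def d2 (N p : ℕ) (hp : p.Prime) : GHatPrimary N p :=
  have hp0 : (p : ℚ) ≠ 0 := Nat.cast_ne_zero.2 hp.ne_zero
  ⟨⟨(p : ℚ)⁻¹ • diagonal ![1, 1, (p : ℚ), (p : ℚ) ^ 2, (p : ℚ) ^ 2], by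
    rw [det_smul, det_diagonal]
    simp [Fin.prod_univ_succ]
    field_simp⟩, by
    have hpR : (0 : ℝ) < p := Nat.cast_pos.2 hp.pos
    refine ⟨diag_mem N (s := (p : ℝ)⁻¹) (t := (p : ℝ)⁻¹) (by positivity) (by positivity) _ ?_, 1,
      diagonal ![1, 1, (p : ℤ), (p : ℤ) ^ 2, (p : ℤ) ^ 2], ?_⟩
    · ext i j
      fin_cases i <;> fin_cases j <;> simp [hpR.ne'] <;> field_simp
    · ext i j
      fin_cases i <;> fin_cases j <;> simp⟩

/-- `T_{N,1}(p) = Γ̂_N p⁻¹ diag(1, p, p, p, p²) Γ̂_N`. -/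
noncomputable def T1 (N p : ℕ) (hp : p.Prime) : HeckePrimary N p :=
  doubleCosetElement (isHeckePair_of_le (GHatPrimary_le N p)) (d1 N p hp)

/-- `T_{N,2}(p) = Γ̂_N p⁻¹ diag(1, 1, p, p², p²) Γ̂_N`. -/
noncomputable def T2 (N p : ℕ) (hp : p.Prime) : HeckePrimary N p :=
  doubleCosetElement (isHeckePair_of_le (GHatPrimary_le N p)) (d2 N p hp)

end Orthogonal

end HeckeSO

/-! The two statements follow from a degree on the rational group under which elements of the Hecke
algebra have leading coefficients that multiply. The degree of a matrix is the pair consisting of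
the least common denominator of its entries and that of its 2 × 2 minors. Both are submultiplicative
(for minors by Cauchy–Binet) and equal to 1 on integral matrices, and pairs are ordered
lexicographically.

Two facts make this work (`isDegree_matDeg`). The degree separates double cosets: every rational
element is equivalent to some diag(1/a, 1/b, 1, b, a) with b ∣ a, and its degree (a, ab) recovers a
and b (`exists_normal_form`). The product of two double cosets also has a leading double coset of
multiplicity one: if t and t' are in normal form and t t' = g h with g and h of the degrees of t and
t', then h lies in the right coset of t' (`mul_inv_mem_GammaHat`). Leading coefficients are then
multiplicative, so there are no zero-divisors. On the primary component inversion preserves double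
cosets, which gives commutativity. The degrees there are freely generated by (p, p) and (p, p²), the
degrees of the two generators, so leading terms can be removed one after another
(`IsDegree.exists_mvPolynomial_ringEquiv`).

Squarefreeness of N enters through one principle: if N q² is an integer, then so is the rational
number q (`mem_intSubring_of_mul_sq`). It makes primitive isotropic vectors a single orbit
(`orbitRel_basis`), by a Euclidean algorithm with unipotent and Weyl elements, and it parametrizes
the primitive solutions of x y = N z² by Atkin–Lehner matrices (`exists_parametrization`). The
normal form comes from moving a primitive isotropic vector with primitive image to the first basis
vector on both sides, splitting off a hyperbolic plane, and repeating this for the ternary form x₁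
x₃ - N x₂². A sign remains; it is excluded because elements of the identity component preserve the
orientation of a positive definite plane (`planeDet_pos`). -/

namespace HeckeSO

/-! ### Hecke algebras with a degree: leading terms, commutativity, polynomial structure -/

section Graded

variable {G : Type*} [Group G] {U : Subgroup G}

theorem coset_surjective (U : Subgroup G) : Function.Surjective (coset U) :=
  Quotient.mk_surjective

theorem coset_out (d : RightCosets U) : coset U d.out = d := Quotient.out_eq _

/-- The coefficient of `U g` in an element of the Hecke algebra. -/
def coeffAt (x : HeckeAlgebra U) (g : G) : ℤ := x.1 (coset U g)

theorem coeffAt_ext {x y : HeckeAlgebra U} (h : ∀ g, coeffAt x g = coeffAt y g) : x = y :=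
  Subtype.ext (Finsupp.ext fun c => by
    obtain ⟨g, rfl⟩ := coset_surjective U c
    exact h g)

theorem coeffAt_mul_left (x : HeckeAlgebra U) {u : G} (hu : u ∈ U) (g : G) :
    coeffAt x (u * g) = coeffAt x g := by
  rw [coeffAt, coset_mul_left hu, coeffAt]

/-- Right translation by `g` as a permutation of the right cosets. -/
def translateEquiv (U : Subgroup G) (g : G) : RightCosets U ≃ RightCosets U where
  toFun := translate U g
  invFun := translate U g⁻¹
  left_inv c := by rw [translate_translate, mul_inv_cancel, translate_one]
  right_inv c := by rw [translate_translate, inv_mul_cancel, translate_one]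

theorem chainTranslate_apply (g h : G) (x : RightCosets U →₀ ℤ) :
    chainTranslate U g x (coset U h) = x (coset U (h * g⁻¹)) := by
  have e : coset U h = translateEquiv U g (coset U (h * g⁻¹)) := by
    change _ = coset U _
    simp
  rw [e, chainTranslate, Finsupp.lmapDomain_apply]
  exact Finsupp.mapDomain_apply (translateEquiv U g).injective _ _

theorem coeffAt_mul_right (x : HeckeAlgebra U) {u : G} (hu : u ∈ U) (g : G) :
    coeffAt x (g * u) = coeffAt x g := by
  have h := congrArg (fun y => y (coset U (g * u))) (x.2 u hu)
  simp only [chainTranslate_apply] at h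
  simpa [coeffAt] using h.symm

theorem coeffAt_doubleCoset (x : HeckeAlgebra U) {g h : G}
    (hg : h ∈ DoubleCoset.doubleCoset g (U : Set G) (U : Set G)) : coeffAt x h = coeffAt x g := by
  obtain ⟨a, ha, b, hb, rfl⟩ := DoubleCoset.mem_doubleCoset.1 hg
  rw [coeffAt_mul_right x hb, coeffAt_mul_left x ha]

/-- The product is a convolution: U g arises from the factorizations g = (g d⁻¹) d, one for each
right coset of d. -/
theorem coeffAt_mul_eq_sum (x y : HeckeAlgebra U) (g : G) :
    coeffAt (x * y) g = ∑ d ∈ y.1.support, y.1 d * coeffAt x (g * d.out⁻¹) := by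
  rw [coeffAt, val_mul, chainMulLin, Finsupp.linearCombination_apply, Finsupp.sum,
    Finsupp.finsetSum_apply]
  refine Finset.sum_congr rfl fun d _ => ?_
  rw [Finsupp.smul_apply, chainTranslate_apply, smul_eq_mul, coeffAt]

theorem coeffAt_mul_eq_finsum (x y : HeckeAlgebra U) (g : G) :
    coeffAt (x * y) g = ∑ᶠ d : RightCosets U, y.1 d * coeffAt x (g * d.out⁻¹) := by
  rw [coeffAt_mul_eq_sum]
  refine (finsum_eq_sum_of_support_subset _ fun d hd => ?_).symm
  rw [Finset.mem_coe, Finsupp.mem_support_iff]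
  exact left_ne_zero_of_mul hd

/-- Evaluation of coefficients as an additive homomorphism. -/
def coeffAtHom (g : G) : HeckeAlgebra U →+ ℤ where
  toFun x := coeffAt x g
  map_zero' := rfl
  map_add' _ _ := rfl

theorem coeffAt_one (g : G) : coeffAt (1 : HeckeAlgebra U) g ≠ 0 ↔ g ∈ U := by
  classical
  rw [coeffAt, val_one, Finsupp.single_apply]
  by_cases h : coset U 1 = coset U g
  · rw [if_pos h]
    simpa using coset_eq_iff.1 h
  · rw [if_neg h]
    rw [coset_eq_iff] at h
    simpa using h

theorem coeffAt_one_of_mem {g : G} (hg : g ∈ U) : coeffAt (1 : HeckeAlgebra U) g = 1 := by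
  classical
  rw [coeffAt, val_one, Finsupp.single_apply, if_pos]
  rw [coset_eq_iff]
  simpa using hg

theorem mem_cosetsIn {g h : G} :
    coset U h ∈ cosetsIn U g ↔ h ∈ DoubleCoset.doubleCoset g (U : Set G) (U : Set G) := by
  constructor
  · rintro ⟨x, hx, hxh⟩
    obtain ⟨a, ha, b, hb, rfl⟩ := DoubleCoset.mem_doubleCoset.1 hx
    have := coset_eq_iff.1 hxh
    refine DoubleCoset.mem_doubleCoset.2 ⟨h * (a * g * b)⁻¹ * a, U.mul_mem this ha, b, hb, ?_⟩
    group
  · intro hh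
    exact ⟨h, hh, rfl⟩

theorem coeffAt_doubleCosetElement_of_mem (hU : IsHeckePair U) {g h : G}
    (hh : h ∈ DoubleCoset.doubleCoset g (U : Set G) (U : Set G)) :
    coeffAt (doubleCosetElement hU g) h = 1 := by
  classical
  have : coset U h ∈ (hU g).toFinset := by rwa [Set.Finite.mem_toFinset, mem_cosetsIn]
  simp [coeffAt, doubleCosetElement, Finsupp.indicator_apply, this]

theorem mem_of_coeffAt_doubleCosetElement_ne_zero (hU : IsHeckePair U) {g h : G}
    (hh : coeffAt (doubleCosetElement hU g) h ≠ 0) :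
    h ∈ DoubleCoset.doubleCoset g (U : Set G) (U : Set G) := by
  classical
  by_contra hn
  apply hh
  have : coset U h ∉ (hU g).toFinset := by rwa [Set.Finite.mem_toFinset, mem_cosetsIn]
  simp [coeffAt, doubleCosetElement, Finsupp.indicator_apply, this]

/-- If every double coset is stable under inversion, the Hecke algebra is commutative. -/
theorem heckeAlgebra_mul_comm
    (hinv : ∀ g : G, g⁻¹ ∈ DoubleCoset.doubleCoset g (U : Set G) (U : Set G))
    (x y : HeckeAlgebra U) : x * y = y * x := by
  have inv_eq : ∀ (z : HeckeAlgebra U) (g : G), coeffAt z g⁻¹ = coeffAt z g := fun z g =>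
    coeffAt_doubleCoset z (hinv g)
  refine coeffAt_ext fun g => ?_
  -- Substituting d = k g in the convolution for `x * y` at g gives terms y(kg) x(k⁻¹). Since
  -- coefficients are invariant under inversion, these are the terms of `y * x` at g⁻¹.
  rw [← inv_eq (y * x), coeffAt_mul_eq_finsum, coeffAt_mul_eq_finsum,
    ← finsum_comp_equiv (translateEquiv U g)]
  refine finsum_congr fun d => ?_
  obtain ⟨k, rfl⟩ := coset_surjective U d
  change coeffAt y (k * g) * coeffAt x (g * (coset U (k * g)).out⁻¹) =
    coeffAt x k * coeffAt y (g⁻¹ * (coset U k).out⁻¹)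
  have out_mem : ∀ h : G, ∃ u ∈ U, (coset U h).out = u * h := fun h =>
    ⟨(coset U h).out * h⁻¹, coset_eq_iff.1 (coset_out (coset U h)).symm, by simp⟩
  obtain ⟨u, hu, hu'⟩ := out_mem (k * g)
  obtain ⟨v, hv, hv'⟩ := out_mem k
  rw [hu', hv', show g * (u * (k * g))⁻¹ = k⁻¹ * u⁻¹ by group,
    coeffAt_mul_right x (U.inv_mem hu), inv_eq,
    show g⁻¹ * (v * k)⁻¹ = (k * g)⁻¹ * v⁻¹ by group, coeffAt_mul_right y (U.inv_mem hv), inv_eq,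
    mul_comm]

/-- A degree function on `G` that separates the double cosets of `U` and for which the product of
two double cosets has a unique leading double coset, occurring with multiplicity one. -/
structure IsDegree {M : Type*} [CommMonoid M] [LinearOrder M] (U : Subgroup G) (deg : G → M) :
    Prop where
  deg_of_mem : ∀ u ∈ U, deg u = 1
  deg_mul_le : ∀ g h, deg (g * h) ≤ deg g * deg h
  mem_doubleCoset : ∀ g h, deg h = deg g → h ∈ DoubleCoset.doubleCoset g (U : Set G) (U : Set G)
  exists_leading : ∀ g h, ∃ k d₀, deg k = deg g * deg h ∧ deg d₀ = deg h ∧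
    deg (k * d₀⁻¹) = deg g ∧
    ∀ d, deg d = deg h → deg (k * d⁻¹) = deg g → coset U d = coset U d₀

variable {M : Type*} [CommMonoid M] [LinearOrder M] {deg : G → M}

/-- `x` has leading coefficient `c` in degree `m`. -/
def HasLeading (deg : G → M) (x : HeckeAlgebra U) (m : M) (c : ℤ) : Prop :=
  (∀ g, coeffAt x g ≠ 0 → deg g ≤ m) ∧ ∀ g, deg g = m → coeffAt x g = c

namespace IsDegree

theorem deg_mul_left (h : IsDegree U deg) {u : G} (hu : u ∈ U) (g : G) : deg (u * g) = deg g := by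
  refine le_antisymm ?_ ?_
  · simpa [h.deg_of_mem u hu] using h.deg_mul_le u g
  · simpa [h.deg_of_mem _ (U.inv_mem hu)] using h.deg_mul_le u⁻¹ (u * g)

theorem deg_mul_right (h : IsDegree U deg) {u : G} (hu : u ∈ U) (g : G) : deg (g * u) = deg g := by
  refine le_antisymm ?_ ?_
  · simpa [h.deg_of_mem u hu] using h.deg_mul_le g u
  · simpa [h.deg_of_mem _ (U.inv_mem hu)] using h.deg_mul_le (g * u) u⁻¹

theorem deg_eq_of_mem (h : IsDegree U deg) {g k : G}
    (hk : k ∈ DoubleCoset.doubleCoset g (U : Set G) (U : Set G)) : deg k = deg g := by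
  obtain ⟨a, ha, b, hb, rfl⟩ := DoubleCoset.mem_doubleCoset.1 hk
  rw [h.deg_mul_right hb, h.deg_mul_left ha]

theorem coeffAt_congr (h : IsDegree U deg) (x : HeckeAlgebra U) {g k : G} (hk : deg k = deg g) :
    coeffAt x k = coeffAt x g := coeffAt_doubleCoset x (h.mem_doubleCoset g k hk)

theorem hasLeading_one (h : IsDegree U deg) : HasLeading deg (1 : HeckeAlgebra U) 1 1 := by
  refine ⟨fun g hg => (h.deg_of_mem g ((coeffAt_one g).1 hg)).le, fun g hg => ?_⟩
  rw [h.coeffAt_congr 1 (hg.trans (h.deg_of_mem 1 U.one_mem).symm)]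
  exact coeffAt_one_of_mem U.one_mem

theorem hasLeading_doubleCosetElement (h : IsDegree U deg) (hU : IsHeckePair U) (g : G) :
    HasLeading deg (doubleCosetElement hU g) (deg g) 1 :=
  ⟨fun _ hk => (h.deg_eq_of_mem (mem_of_coeffAt_doubleCosetElement_ne_zero hU hk)).le,
    fun k hk => coeffAt_doubleCosetElement_of_mem hU (h.mem_doubleCoset g k hk)⟩

/-- The support is finite, so some coset in it has maximal degree; the coefficient is constant on
that degree because equal degrees mean equal double cosets. -/
theorem exists_hasLeading (h : IsDegree U deg) {x : HeckeAlgebra U} (hx : x ≠ 0) :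
    ∃ g, coeffAt x g ≠ 0 ∧ HasLeading deg x (deg g) (coeffAt x g) := by
  have hne : x.1.support.Nonempty := by
    rw [Finsupp.support_nonempty_iff]
    exact fun h0 => hx (Subtype.ext h0)
  obtain ⟨c, hc, hmax⟩ := Finset.exists_max_image x.1.support (fun c => deg c.out) hne
  refine ⟨c.out, ?_, fun g hg => ?_, fun g hg => h.coeffAt_congr x hg⟩
  · rw [coeffAt, coset_out]
    exact Finsupp.mem_support_iff.1 hc
  · have := hmax (coset U g) (Finsupp.mem_support_iff.2 hg)
    refine le_trans (le_of_eq ?_) this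
    have h1 : (coset U g).out * g⁻¹ ∈ U := coset_eq_iff.1 (coset_out (coset U g)).symm
    rw [← h.deg_mul_left h1 g]
    simp

variable [IsOrderedCancelMonoid M]

/-- In the convolution at l, every nonzero term comes from a factorization of l into factors of
degree at most `deg g` and `deg k`. If l has the full product degree, cancellation in M forces
equality in both bounds, and `exists_leading` leaves a single coset. -/
theorem hasLeading_mul (h : IsDegree U deg) {x y : HeckeAlgebra U} {g k : G} {a b : ℤ}
    (hx : HasLeading deg x (deg g) a) (hy : HasLeading deg y (deg k) b) :
    HasLeading deg (x * y) (deg g * deg k) (a * b) := by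
  have key : ∀ l, ∀ d : RightCosets U, y.1 d * coeffAt x (l * d.out⁻¹) ≠ 0 →
      deg d.out ≤ deg k ∧ deg (l * d.out⁻¹) ≤ deg g ∧ deg l ≤ deg (l * d.out⁻¹) * deg d.out := by
    intro l d hd
    have h1 : coeffAt y d.out ≠ 0 := by
      rw [coeffAt, coset_out]
      exact left_ne_zero_of_mul hd
    refine ⟨hy.1 _ h1, hx.1 _ (right_ne_zero_of_mul hd), ?_⟩
    simpa using h.deg_mul_le (l * d.out⁻¹) d.out
  constructor
  · intro l hl
    rw [coeffAt_mul_eq_sum] at hl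
    obtain ⟨d, _, hd⟩ := Finset.exists_ne_zero_of_sum_ne_zero hl
    obtain ⟨h1, h2, h3⟩ := key l d hd
    exact h3.trans (mul_le_mul' h2 h1)
  · intro l hl
    obtain ⟨l', d₀, h1, h2, h3, h4⟩ := h.exists_leading g k
    -- The element l may be replaced by the distinguished l' of the same degree, since both lie in
    -- one double coset.
    rw [h.coeffAt_congr _ (hl.trans h1.symm), coeffAt_mul_eq_finsum,
      finsum_eq_single _ (coset U d₀)]
    · obtain ⟨u, hu, hu'⟩ : ∃ u ∈ U, (coset U d₀).out = u * d₀ :=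
        ⟨(coset U d₀).out * d₀⁻¹, coset_eq_iff.1 (coset_out (coset U d₀)).symm, by simp⟩
      rw [hu', mul_inv_rev, ← mul_assoc, coeffAt_mul_right x (U.inv_mem hu), hx.2 _ h3, mul_comm]
      congr 1
      exact hy.2 _ h2
    · intro d hd
      by_contra hne
      obtain ⟨e1, e2, e3⟩ := key l' d hne
      rw [h1] at e3
      obtain ⟨e4, e5⟩ := (mul_le_mul_iff_of_ge e2 e1).1 e3
      apply hd
      rw [← coset_out d]
      exact h4 _ e5 e4

theorem noZeroDivisors (h : IsDegree U deg) : NoZeroDivisors (HeckeAlgebra U) where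
  eq_zero_or_eq_zero_of_mul_eq_zero := by
    intro x y hxy
    by_contra! hne
    obtain ⟨g, hg, hg'⟩ := h.exists_hasLeading hne.1
    obtain ⟨k, hk, hk'⟩ := h.exists_hasLeading hne.2
    obtain ⟨l, -, hl, -⟩ := h.exists_leading g k
    have := (h.hasLeading_mul hg' hk').2 l hl
    rw [hxy] at this
    exact mul_ne_zero hg hk this.symm

/-- The second half records that the degree of the monomial is attained in G; `hasLeading_mul` and
every evaluation of a leading coefficient depend on this. -/
theorem hasLeading_monomial (h : IsDegree U deg) {T : Fin 2 → HeckeAlgebra U} {t : Fin 2 → G}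
    (hT : ∀ i, HasLeading deg (T i) (deg (t i)) 1) (i j : ℕ) :
    HasLeading deg (T 0 ^ i * T 1 ^ j) (deg (t 0) ^ i * deg (t 1) ^ j) 1 ∧
      ∃ g, deg g = deg (t 0) ^ i * deg (t 1) ^ j := by
  have pow : ∀ (k : Fin 2) (n : ℕ), HasLeading deg (T k ^ n) (deg (t k) ^ n) 1 ∧
      ∃ g, deg g = deg (t k) ^ n := by
    intro k n
    induction n with
    | zero => exact ⟨by simpa using h.hasLeading_one, 1, by simpa using h.deg_of_mem 1 U.one_mem⟩
    | succ n ih =>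
      obtain ⟨ih, g, hg⟩ := ih
      rw [← hg] at ih
      obtain ⟨l, -, hl, -⟩ := h.exists_leading g (t k)
      refine ⟨?_, l, by rw [hl, hg, pow_succ]⟩
      rw [pow_succ, pow_succ, ← hg]
      simpa using h.hasLeading_mul ih (hT k)
  obtain ⟨h1, g, hg⟩ := pow 0 i
  obtain ⟨h2, k, hk⟩ := pow 1 j
  rw [← hg] at h1
  rw [← hk] at h2
  obtain ⟨l, -, hl, -⟩ := h.exists_leading g k
  rw [← hg, ← hk]
  exact ⟨by simpa using h.hasLeading_mul h1 h2, l, hl⟩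

/-- If the degrees are freely generated by the degrees of `T 0` and `T 1`, which have leading
coefficient `1`, then a commutative Hecke algebra is the polynomial ring in `T 0` and `T 1`. -/
theorem exists_mvPolynomial_ringEquiv [WellFoundedLT M] (h : IsDegree U deg)
    (hcomm : ∀ x y : HeckeAlgebra U, x * y = y * x) {T : Fin 2 → HeckeAlgebra U} {t : Fin 2 → G}
    (hT : ∀ i, HasLeading deg (T i) (deg (t i)) 1)
    (hgen : ∀ g, ∃ i j : ℕ, deg g = deg (t 0) ^ i * deg (t 1) ^ j)
    (hinj : ∀ i j i' j' : ℕ, deg (t 0) ^ i * deg (t 1) ^ j = deg (t 0) ^ i' * deg (t 1) ^ j' →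
      i = i' ∧ j = j') :
    ∃ φ : MvPolynomial (Fin 2) ℤ ≃+* HeckeAlgebra U,
      φ (MvPolynomial.X 0) = T 0 ∧ φ (MvPolynomial.X 1) = T 1 := by
  let _ : CommRing (HeckeAlgebra U) :=
    { (inferInstance : Ring (HeckeAlgebra U)) with mul_comm := hcomm }
  let φ : MvPolynomial (Fin 2) ℤ →+* HeckeAlgebra U :=
    MvPolynomial.eval₂Hom (Int.castRingHom _) T
  have hφ : ∀ P : MvPolynomial (Fin 2) ℤ, φ P =
      ∑ e ∈ P.support, P.coeff e • (T 0 ^ e 0 * T 1 ^ e 1) := by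
    intro P
    change MvPolynomial.eval₂ _ _ _ = _
    rw [MvPolynomial.eval₂_eq']
    refine Finset.sum_congr rfl fun e _ => ?_
    rw [Fin.prod_univ_two, zsmul_eq_mul]
    rfl
  have hcoeff : ∀ (P : MvPolynomial (Fin 2) ℤ) (g : G), coeffAt (φ P) g =
      ∑ e ∈ P.support, P.coeff e * coeffAt (T 0 ^ e 0 * T 1 ^ e 1) g := by
    intro P g
    rw [hφ]
    change coeffAtHom g _ = _
    rw [map_sum]
    refine Finset.sum_congr rfl fun e _ => ?_
    rw [map_zsmul, smul_eq_mul]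
    rfl
  have hlead := h.hasLeading_monomial hT
  -- By `hinj` distinct monomials have distinct degrees. At an element of the highest degree
  -- occurring, only one monomial contributes, and it contributes its coefficient.
  have hinjective : Function.Injective φ := by
    rw [injective_iff_map_eq_zero]
    intro P hP
    by_contra hne
    obtain ⟨e, he, hmax⟩ := Finset.exists_max_image P.support
      (fun e => deg (t 0) ^ e 0 * deg (t 1) ^ e 1) (MvPolynomial.support_nonempty.2 hne)
    obtain ⟨he1, g, hg⟩ := hlead (e 0) (e 1)
    have hsum := hcoeff P g
    rw [hP, Finset.sum_eq_single_of_mem e he, he1.2 g hg, mul_one] at hsum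
    · exact MvPolynomial.mem_support_iff.1 he hsum.symm
    · intro e' he' hee
      by_contra hc
      have h1 := (hlead (e' 0) (e' 1)).1.1 g (right_ne_zero_of_mul hc)
      have h2 := hinj _ _ _ _ (le_antisymm (hg ▸ h1) (hmax e' he'))
      refine hee (Finsupp.ext fun i => ?_)
      fin_cases i
      · exact h2.1.symm
      · exact h2.2.symm
  -- Well-founded induction on a bound for the degree: subtracting the leading coefficient times the
  -- monomial of the same degree strictly lowers the degree.
  have hsurj : ∀ (m : M) (x : HeckeAlgebra U), (∀ g, coeffAt x g ≠ 0 → deg g ≤ m) →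
      ∃ P, φ P = x := by
    intro m
    induction m using WellFoundedLT.induction with
    | ind m ih =>
      intro x hx
      by_cases hx0 : x = 0
      · exact ⟨0, by rw [hx0, map_zero]⟩
      obtain ⟨g, hg, hg'⟩ := h.exists_hasLeading hx0
      obtain ⟨i, j, hij⟩ := hgen g
      set y : HeckeAlgebra U := coeffAt x g • (T 0 ^ i * T 1 ^ j) with hy
      have hycoeff : ∀ k, coeffAt y k = coeffAt x g * coeffAt (T 0 ^ i * T 1 ^ j) k := by
        intro k
        change coeffAtHom k y = _
        rw [hy, map_zsmul, smul_eq_mul]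
        rfl
      have hsub : ∀ k, coeffAt (x - y) k = coeffAt x k - coeffAt y k := fun k =>
        map_sub (coeffAtHom k) x y
      have hlt : ∀ k, coeffAt (x - y) k ≠ 0 → deg k < deg g := by
        intro k hk
        rw [hsub] at hk
        refine lt_of_le_of_ne ?_ fun heq => hk ?_
        · by_cases hxk : coeffAt x k = 0
          · rw [hxk, hycoeff] at hk
            rw [hij]
            refine (hlead i j).1.1 k fun h0 => hk ?_
            rw [h0]; simp
          · exact hg'.1 k hxk
        · rw [hycoeff, (hlead i j).1.2 k (heq.trans hij), hg'.2 k heq]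
          simp
      have hyP : φ (MvPolynomial.C (coeffAt x g) * (MvPolynomial.X 0 ^ i * MvPolynomial.X 1 ^ j)) =
          y := by
        have hC : φ (MvPolynomial.C (coeffAt x g)) = (coeffAt x g : HeckeAlgebra U) :=
          MvPolynomial.eval₂_C _ _ _
        have hX : ∀ k, φ (MvPolynomial.X k) = T k := fun k => MvPolynomial.eval₂_X _ _ _
        rw [map_mul, map_mul, map_pow, map_pow, hC, hX, hX, hy, zsmul_eq_mul]
      by_cases hxy : x - y = 0
      · exact ⟨_, hyP.trans (sub_eq_zero.1 hxy).symm⟩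
      obtain ⟨k, hk, hk'⟩ := h.exists_hasLeading hxy
      obtain ⟨P, hP⟩ := ih (deg k) ((hlt k hk).trans_le (hx g hg)) (x - y) hk'.1
      refine ⟨P + MvPolynomial.C (coeffAt x g) * (MvPolynomial.X 0 ^ i * MvPolynomial.X 1 ^ j), ?_⟩
      rw [map_add, hP, hyP, sub_add_cancel]
  have hbij : Function.Bijective φ := by
    refine ⟨hinjective, fun x => ?_⟩
    by_cases hx0 : x = 0
    · exact ⟨0, by rw [hx0, map_zero]⟩
    obtain ⟨g, -, hg⟩ := h.exists_hasLeading hx0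
    exact hsurj _ x hg.1
  refine ⟨RingEquiv.ofBijective φ hbij, ?_, ?_⟩
  · change φ _ = _
    simp [φ]
  · change φ _ = _
    simp [φ]

end IsDegree

end Graded

open Matrix

/-! ### Denominators of rational matrices and of their minors -/

section Denominators

/-- The integers inside `ℚ`. -/
abbrev intSubring : Subring ℚ := (Int.castRingHom ℚ).range

theorem mem_intSubring {q : ℚ} : q ∈ intSubring ↔ ∃ z : ℤ, (z : ℚ) = q := Iff.rfl

theorem intCast_mem_intSubring (z : ℤ) : (z : ℚ) ∈ intSubring := ⟨z, rfl⟩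

theorem natCast_mul_mem_intSubring {q : ℚ} {k : ℕ} : (k : ℚ) * q ∈ intSubring ↔ q.den ∣ k := by
  constructor
  · rintro ⟨z, hz⟩
    have hz' : (z : ℚ) = k * q := hz
    have h1 : (z : ℤ) * q.den = k * q.num := by
      have h2 : (z : ℚ) * q.den = k * q.num := by
        rw [hz', mul_assoc, Rat.mul_den_eq_num]
      exact_mod_cast h2
    have h3 : (q.den : ℤ) ∣ k * q.num := ⟨z, by rw [← h1, mul_comm]⟩
    have h4 : IsCoprime (q.den : ℤ) q.num := by
      rw [Int.isCoprime_iff_gcd_eq_one, Int.gcd_comm]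
      exact q.reduced
    exact Int.natCast_dvd_natCast.1 (h4.dvd_of_dvd_mul_right h3)
  · rintro ⟨c, rfl⟩
    refine ⟨c * q.num, ?_⟩
    have := Rat.mul_den_eq_num q
    push_cast
    change ((c * q.num : ℤ) : ℚ) = _
    push_cast
    linear_combination (-(c : ℚ)) * this

/-- In lowest terms the square of the denominator of q must divide n, so the denominator is a unit.
All later uses of squarefreeness for integrality go back to this. -/
theorem mem_intSubring_of_mul_sq {n : ℤ} (hn : Squarefree n) {q : ℚ}
    (h : (n : ℚ) * q ^ 2 ∈ intSubring) : q ∈ intSubring := by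
  obtain ⟨z, hz⟩ := h
  have hz' : (z : ℚ) = n * q ^ 2 := hz
  have h1 : (z : ℤ) * q.den ^ 2 = n * q.num ^ 2 := by
    have h2 : (z : ℚ) * q.den ^ 2 = n * q.num ^ 2 := by
      rw [hz', ← Rat.mul_den_eq_num q]; ring
    exact_mod_cast h2
  have h4 : IsCoprime (q.den : ℤ) q.num := by
    rw [Int.isCoprime_iff_gcd_eq_one, Int.gcd_comm]
    exact q.reduced
  have h5 : (q.den : ℤ) * q.den ∣ n := by
    rw [← pow_two]
    exact (h4.pow (m := 2) (n := 2)).dvd_of_dvd_mul_right ⟨z, by rw [← h1, mul_comm]⟩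
  have h6 := hn _ h5
  have h7 : q.den = 1 := by
    have := Int.isUnit_iff_natAbs_eq.1 h6
    simpa using this
  exact ⟨q.num, by simpa using Rat.coe_int_num_of_den_eq_one h7⟩

variable {ι κ μ : Type*} [Fintype ι] [Fintype κ] [Fintype μ]

/-- The least common denominator of the entries of a rational matrix. -/
def matDen (M : Matrix ι κ ℚ) : ℕ := Finset.univ.lcm fun x : ι × κ => (M x.1 x.2).den

theorem matDen_dvd_iff {M : Matrix ι κ ℚ} {k : ℕ} :
    matDen M ∣ k ↔ ∀ i j, (k : ℚ) * M i j ∈ intSubring := by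
  simp only [matDen, Finset.lcm_dvd_iff, natCast_mul_mem_intSubring, Finset.mem_univ, true_imp_iff,
    Prod.forall]

theorem matDen_mul_mem (M : Matrix ι κ ℚ) (i : ι) (j : κ) :
    (matDen M : ℚ) * M i j ∈ intSubring := matDen_dvd_iff.1 dvd_rfl i j

theorem matDen_pos (M : Matrix ι κ ℚ) : 0 < matDen M := by
  refine Nat.pos_of_ne_zero fun h => ?_
  rw [matDen, Finset.lcm_eq_zero_iff] at h
  obtain ⟨x, -, hx⟩ := h
  exact (M x.1 x.2).den_ne_zero hx

theorem matDen_mul_dvd (A : Matrix ι κ ℚ) (B : Matrix κ μ ℚ) :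
    matDen (A * B) ∣ matDen A * matDen B := by
  rw [matDen_dvd_iff]
  intro i j
  rw [Matrix.mul_apply, Finset.mul_sum]
  refine Subring.sum_mem _ fun k _ => ?_
  have : ((matDen A * matDen B : ℕ) : ℚ) * (A i k * B k j) =
      (matDen A * A i k) * (matDen B * B k j) := by push_cast; ring
  rw [this]
  exact Subring.mul_mem _ (matDen_mul_mem _ _ _) (matDen_mul_mem _ _ _)

/-- The `2 × 2` minors of a matrix, indexed by pairs of rows and pairs of columns. -/
def minors {R : Type*} [CommRing R] (M : Matrix (Fin 5) (Fin 5) R) :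
    Matrix (Fin 5 × Fin 5) (Fin 5 × Fin 5) R :=
  Matrix.of fun i j => M i.1 j.1 * M i.2 j.2 - M i.1 j.2 * M i.2 j.1

theorem minors_apply {R : Type*} [CommRing R] (M : Matrix (Fin 5) (Fin 5) R) (i j k l : Fin 5) :
    minors M (i, j) (k, l) = M i k * M j l - M i l * M j k := rfl

/-- The Cauchy–Binet formula for `2 × 2` minors. -/
theorem minors_mul {R : Type*} [CommRing R] (A B : Matrix (Fin 5) (Fin 5) R)
    (i j : Fin 5 × Fin 5) : minors (A * B) i j =
      ∑ k : Fin 5 × Fin 5 with k.1 < k.2, minors A i k * minors B k j := by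
  obtain ⟨i, i'⟩ := i
  obtain ⟨j, j'⟩ := j
  rw [Finset.sum_filter, Fintype.sum_prod_type]
  simp only [minors_apply, Matrix.mul_apply, Fin.sum_univ_five]
  simp +decide only [if_true, if_false]
  ring

theorem matDen_minors_mul_dvd (A B : Matrix (Fin 5) (Fin 5) ℚ) :
    matDen (minors (A * B)) ∣ matDen (minors A) * matDen (minors B) := by
  rw [matDen_dvd_iff]
  intro i j
  rw [minors_mul, Finset.mul_sum]
  refine Subring.sum_mem _ fun k _ => ?_
  have : ((matDen (minors A) * matDen (minors B) : ℕ) : ℚ) * (minors A i k * minors B k j) =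
      (matDen (minors A) * minors A i k) * (matDen (minors B) * minors B k j) := by
    push_cast; ring
  rw [this]
  exact Subring.mul_mem _ (matDen_mul_mem _ _ _) (matDen_mul_mem _ _ _)

/-- The degree of a matrix: the denominators of its entries and of its `2 × 2` minors. -/
def matDeg (M : Matrix (Fin 5) (Fin 5) ℚ) : ℕ+ ×ₗ ℕ+ :=
  toLex (⟨matDen M, matDen_pos M⟩, ⟨matDen (minors M), matDen_pos _⟩)

theorem matDeg_eq_iff {A B : Matrix (Fin 5) (Fin 5) ℚ} : matDeg A = matDeg B ↔
    matDen A = matDen B ∧ matDen (minors A) = matDen (minors B) := by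
  simp [matDeg, Prod.ext_iff]
  exact and_congr Subtype.mk_eq_mk Subtype.mk_eq_mk

theorem matDeg_eq_mul_iff {A B C : Matrix (Fin 5) (Fin 5) ℚ} : matDeg A = matDeg B * matDeg C ↔
    matDen A = matDen B * matDen C ∧
      matDen (minors A) = matDen (minors B) * matDen (minors C) := by
  simp [matDeg, ← toLex_mul, Prod.ext_iff]
  exact and_congr Subtype.mk_eq_mk Subtype.mk_eq_mk

/-- Both components are submultiplicative even for divisibility. The lexicographic order merely
refines the componentwise one to a well-founded linear order compatible with multiplication. -/
theorem matDeg_mul_le (A B : Matrix (Fin 5) (Fin 5) ℚ) :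
    matDeg (A * B) ≤ matDeg A * matDeg B := by
  refine Prod.Lex.toLex_mono (Prod.mk_le_mk.2 ⟨?_, ?_⟩)
  · exact PNat.coe_le_coe _ _ |>.1 (Nat.le_of_dvd (Nat.mul_pos (matDen_pos A) (matDen_pos B))
      (matDen_mul_dvd A B))
  · exact PNat.coe_le_coe _ _ |>.1 (Nat.le_of_dvd
      (Nat.mul_pos (matDen_pos (minors A)) (matDen_pos (minors B)))
      (matDen_minors_mul_dvd A B))

theorem matDen_eq_one {M : Matrix ι κ ℚ} (h : ∀ i j, M i j ∈ intSubring) : matDen M = 1 := by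
  rw [← Nat.dvd_one, matDen_dvd_iff]
  simpa using h

theorem matDen_minors_eq_one {M : Matrix (Fin 5) (Fin 5) ℚ} (h : ∀ i j, M i j ∈ intSubring) :
    matDen (minors M) = 1 :=
  matDen_eq_one fun _ _ => Subring.sub_mem _ (Subring.mul_mem _ (h _ _) (h _ _))
    (Subring.mul_mem _ (h _ _) (h _ _))

theorem matDeg_eq_one {M : Matrix (Fin 5) (Fin 5) ℚ} (h : ∀ i j, M i j ∈ intSubring) :
    matDeg M = 1 := by
  have h1 := matDen_eq_one h
  have h2 := matDen_minors_eq_one h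
  simp only [matDeg, h1, h2]
  rfl

/-- The diagonal matrix `diag(1/a, 1/b, 1, b, a)`. -/
def diagMat (a b : ℚ) : Matrix (Fin 5) (Fin 5) ℚ := diagonal ![a⁻¹, b⁻¹, 1, b, a]

/-- The entry 1/a has the largest denominator, and b ∣ a makes a clear 1/b as well. -/
theorem matDen_diagMat {a b : ℕ} (ha : 0 < a) (hab : b ∣ a) : matDen (diagMat a b) = a := by
  have hb : 0 < b := Nat.pos_of_dvd_of_pos hab ha
  refine Nat.dvd_antisymm ?_ ?_
  · rw [matDen_dvd_iff]
    obtain ⟨c, rfl⟩ := hab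
    have hb' : (b : ℚ) ≠ 0 := by positivity
    have hc' : (c : ℚ) ≠ 0 := by
      rintro h
      simp [Nat.cast_eq_zero.1 h] at ha
    intro i j
    by_cases hij : i = j
    · subst hij
      rw [diagMat, diagonal_apply_eq]
      fin_cases i
      · exact ⟨1, by simp; field_simp⟩
      · exact ⟨c, by simp; field_simp⟩
      · exact ⟨b * c, by simp⟩
      · exact ⟨b * c * b, by simp⟩
      · exact ⟨b * c * (b * c), by simp⟩
    · rw [diagMat, diagonal_apply_ne _ hij, mul_zero]
      exact Subring.zero_mem _
  · have h := matDen_mul_mem (diagMat a b) 0 0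
    rw [natCast_mul_mem_intSubring] at h
    have : diagMat a b 0 0 = (a : ℚ)⁻¹ := rfl
    rw [this, Rat.inv_natCast_den_of_pos ha] at h
    exact h

/-- The minor in the first two rows and columns is 1/(ab). Every other nonzero minor is, up to sign,
a product of two distinct diagonal entries, and ab clears it. -/
theorem matDen_minors_diagMat {a b : ℕ} (ha : 0 < a) (hab : b ∣ a) :
    matDen (minors (diagMat a b)) = a * b := by
  have hb : 0 < b := Nat.pos_of_dvd_of_pos hab ha
  refine Nat.dvd_antisymm ?_ ?_
  · rw [matDen_dvd_iff]
    obtain ⟨c, rfl⟩ := hab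
    have hb' : (b : ℚ) ≠ 0 := by positivity
    have hc' : (c : ℚ) ≠ 0 := by
      rintro h
      simp [Nat.cast_eq_zero.1 h] at ha
    have key : ∀ i j : Fin 5, i ≠ j → ((b * c * b : ℕ) : ℚ) *
        ((![((b * c : ℕ) : ℚ)⁻¹, (b : ℚ)⁻¹, 1, b, (b * c : ℕ)] : Fin 5 → ℚ) i *
        (![((b * c : ℕ) : ℚ)⁻¹, (b : ℚ)⁻¹, 1, b, (b * c : ℕ)] : Fin 5 → ℚ) j) ∈ intSubring := by
      intro i j hij
      rw [mem_intSubring]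
      fin_cases i <;> fin_cases j
      -- With a = bc, the witnesses run through ab = b²c times the possible products of two distinct
      -- diagonal entries.
      all_goals first
        | exact absurd rfl hij
        | (refine ⟨1, ?_⟩; simp <;> field_simp; done)
        | (refine ⟨b, ?_⟩; simp <;> field_simp; done)
        | (refine ⟨b * c, ?_⟩; simp <;> field_simp; done)
        | (refine ⟨b * b, ?_⟩; simp <;> field_simp; done)
        | (refine ⟨b * b * c, ?_⟩; simp <;> field_simp; done)
        | (refine ⟨b * b * b * c, ?_⟩; simp <;> field_simp; done)
        | (refine ⟨b * b * c * c, ?_⟩; simp <;> field_simp; done)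
        | (refine ⟨b * b * b * c * c, ?_⟩; simp <;> field_simp; done)
        | (refine ⟨b * b * b * b * c * c, ?_⟩; simp <;> field_simp; done)
    rintro ⟨i, i'⟩ ⟨j, j'⟩
    rw [minors_apply, mul_sub]
    by_cases hii : i = i'
    · subst hii
      rw [mul_comm (diagMat _ _ i j), sub_self]
      exact Subring.zero_mem _
    refine Subring.sub_mem _ ?_ ?_
    · by_cases h1 : i = j
      · by_cases h2 : i' = j'
        · subst h1 h2
          rw [diagMat, diagonal_apply_eq, diagonal_apply_eq]
          exact key _ _ hii
        · rw [diagMat, diagonal_apply_ne _ h2, mul_zero, mul_zero]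
          exact Subring.zero_mem _
      · rw [diagMat, diagonal_apply_ne _ h1, zero_mul, mul_zero]
        exact Subring.zero_mem _
    · by_cases h1 : i = j'
      · by_cases h2 : i' = j
        · subst h1 h2
          rw [diagMat, diagonal_apply_eq, diagonal_apply_eq]
          exact key _ _ hii
        · rw [diagMat, diagonal_apply_ne _ h2, mul_zero, mul_zero]
          exact Subring.zero_mem _
      · rw [diagMat, diagonal_apply_ne _ h1, zero_mul, mul_zero]
        exact Subring.zero_mem _
  · have h := matDen_mul_mem (minors (diagMat a b)) (0, 1) (0, 1)
    rw [natCast_mul_mem_intSubring] at h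
    have : minors (diagMat a b) (0, 1) (0, 1) = ((a * b : ℕ) : ℚ)⁻¹ := by
      rw [minors_apply]
      simp [diagMat, mul_comm]
    rw [this, Rat.inv_natCast_den_of_pos (Nat.mul_pos ha hb)] at h
    exact h

end Denominators

/-! ### Explicit unipotent and Atkin–Lehner isometries -/

section Generators

variable {R : Type*} [CommRing R]

/-- The Gram matrix `Ŝ` over a commutative ring. -/
def gram (n : R) : Matrix (Fin 5) (Fin 5) R :=
  !![0, 0, 0, 0, 1;
     0, 0, 0, 1, 0;
     0, 0, -2 * n, 0, 0;
     0, 1, 0, 0, 0;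
     1, 0, 0, 0, 0]

/-- The row operation `x₀ += t x₁`, `x₃ -= t x₄`. -/
def unipA (t : R) : Matrix (Fin 5) (Fin 5) R :=
  !![1, t, 0, 0, 0;
     0, 1, 0, 0, 0;
     0, 0, 1, 0, 0;
     0, 0, 0, 1, -t;
     0, 0, 0, 0, 1]

/-- The row operation `x₁ += t x₀`, `x₄ -= t x₃`. -/
def unipA' (t : R) : Matrix (Fin 5) (Fin 5) R :=
  !![1, 0, 0, 0, 0;
     t, 1, 0, 0, 0;
     0, 0, 1, 0, 0;
     0, 0, 0, 1, 0;
     0, 0, 0, -t, 1]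

/-- The row operation `x₀ += t x₃`, `x₁ -= t x₄`. -/
def unipB (t : R) : Matrix (Fin 5) (Fin 5) R :=
  !![1, 0, 0, t, 0;
     0, 1, 0, 0, -t;
     0, 0, 1, 0, 0;
     0, 0, 0, 1, 0;
     0, 0, 0, 0, 1]

/-- The row operation `x₃ += t x₀`, `x₄ -= t x₁`. -/
def unipB' (t : R) : Matrix (Fin 5) (Fin 5) R :=
  !![1, 0, 0, 0, 0;
     0, 1, 0, 0, 0;
     0, 0, 1, 0, 0;
     t, 0, 0, 1, 0;
     0, -t, 0, 0, 1]

/-- The row operation `x₂ += t x₄`, `x₀ += 2 n t x₂ + n t² x₄`. -/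
def unipC (n t : R) : Matrix (Fin 5) (Fin 5) R :=
  !![1, 0, 2 * n * t, 0, n * t ^ 2;
     0, 1, 0, 0, 0;
     0, 0, 1, 0, t;
     0, 0, 0, 1, 0;
     0, 0, 0, 0, 1]

/-- The row operation `x₂ += t x₀`, `x₄ += 2 n t x₂ + n t² x₀`. -/
def unipC' (n t : R) : Matrix (Fin 5) (Fin 5) R :=
  !![1, 0, 0, 0, 0;
     0, 1, 0, 0, 0;
     t, 0, 1, 0, 0;
     0, 0, 0, 1, 0;
     n * t ^ 2, 0, 2 * n * t, 0, 1]

/-- The action of a matrix `[[d α, β], [d d' γ, d δ]]` of Atkin–Lehner type on the ternary form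
`x₁ x₃ - d d' x₂²`. -/
def atkinLehner (d d' α β γ δ : R) : Matrix (Fin 5) (Fin 5) R :=
  !![1, 0, 0, 0, 0;
     0, d * α ^ 2, 2 * d * d' * α * β, d' * β ^ 2, 0;
     0, α * γ, d * α * δ + d' * β * γ, β * δ, 0;
     0, d' * γ ^ 2, 2 * d * d' * γ * δ, d * δ ^ 2, 0;
     0, 0, 0, 0, 1]

theorem det_unipA (t : R) : (unipA t).det = 1 := by
  simp [unipA, det_succ_row_zero, Fin.sum_univ_succ, Fin.succAbove, submatrix]

theorem det_unipA' (t : R) : (unipA' t).det = 1 := by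
  simp [unipA', det_succ_row_zero, Fin.sum_univ_succ, Fin.succAbove, submatrix]

theorem det_unipB (t : R) : (unipB t).det = 1 := by
  simp [unipB, det_succ_row_zero, Fin.sum_univ_succ, Fin.succAbove, submatrix]

theorem det_unipB' (t : R) : (unipB' t).det = 1 := by
  simp [unipB', det_succ_row_zero, Fin.sum_univ_succ, Fin.succAbove, submatrix]

theorem det_unipC (n t : R) : (unipC n t).det = 1 := by
  simp [unipC, det_succ_row_zero, Fin.sum_univ_succ, Fin.succAbove, submatrix]

theorem det_unipC' (n t : R) : (unipC' n t).det = 1 := by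
  simp [unipC', det_succ_row_zero, Fin.sum_univ_succ, Fin.succAbove, submatrix]

/-- Up to conjugation by a diagonal matrix, the middle block is the symmetric square of [[√d α, √d'
β], [√d' γ, √d δ]]. Its determinant is therefore the cube of that 2 × 2 determinant. -/
theorem det_atkinLehner (d d' α β γ δ : R) (h : d * α * δ - d' * β * γ = 1) :
    (atkinLehner d d' α β γ δ).det = 1 := by
  have : (atkinLehner d d' α β γ δ).det = (d * α * δ - d' * β * γ) ^ 3 := by
    simp [atkinLehner, det_succ_row_zero, Fin.sum_univ_succ, Fin.succAbove, submatrix]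
    ring
  rw [this, h, one_pow]

theorem gram_unipA (n t : R) : (unipA t)ᵀ * gram n * unipA t = gram n := by
  ext i j
  fin_cases i <;> fin_cases j <;> simp [unipA, gram, Matrix.mul_apply, Fin.sum_univ_succ]

theorem gram_unipA' (n t : R) : (unipA' t)ᵀ * gram n * unipA' t = gram n := by
  ext i j
  fin_cases i <;> fin_cases j <;> simp [unipA', gram, Matrix.mul_apply, Fin.sum_univ_succ]

theorem gram_unipB (n t : R) : (unipB t)ᵀ * gram n * unipB t = gram n := by
  ext i j
  fin_cases i <;> fin_cases j <;> simp [unipB, gram, Matrix.mul_apply, Fin.sum_univ_succ]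

theorem gram_unipB' (n t : R) : (unipB' t)ᵀ * gram n * unipB' t = gram n := by
  ext i j
  fin_cases i <;> fin_cases j <;> simp [unipB', gram, Matrix.mul_apply, Fin.sum_univ_succ]

theorem gram_unipC (n t : R) : (unipC n t)ᵀ * gram n * unipC n t = gram n := by
  ext i j
  fin_cases i <;> fin_cases j <;> simp [unipC, gram, Matrix.mul_apply, Fin.sum_univ_succ] <;> ring

theorem gram_unipC' (n t : R) : (unipC' n t)ᵀ * gram n * unipC' n t = gram n := by
  ext i j
  fin_cases i <;> fin_cases j <;> simp [unipC', gram, Matrix.mul_apply, Fin.sum_univ_succ] <;> ring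

/-- A symmetric square multiplies the discriminant form by the square of the 2 × 2 determinant; this
is why only `h2` is needed. -/
theorem gram_atkinLehner (d d' α β γ δ : R) (h : d * α * δ - d' * β * γ = 1) :
    (atkinLehner d d' α β γ δ)ᵀ * gram (d * d') * atkinLehner d d' α β γ δ = gram (d * d') := by
  have h2 : (d * α * δ - d' * β * γ) ^ 2 = 1 := by rw [h, one_pow]
  ext i j
  fin_cases i <;> fin_cases j <;>
    simp [atkinLehner, gram, Matrix.mul_apply, Fin.sum_univ_succ]
  all_goals first | ring1 | linear_combination h2 | linear_combination (-(2 * d * d')) * h2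

end Generators

/-! ### The generators lie in the identity component -/

section Connected

variable {N : ℕ}

/-- The range of a path through the identity is preconnected, hence contained in the component of
the identity. -/
theorem mem_SO0Real_of_path {f : ℝ → Matrix (Fin 5) (Fin 5) ℝ} (hc : Continuous f) (h0 : f 0 = 1)
    (hS : ∀ t, (f t)ᵀ * gram (N : ℝ) * f t = gram (N : ℝ)) (hdet : ∀ t, (f t).det = 1) (t : ℝ)
    {g : SpecialLinearGroup (Fin 5) ℝ} (hg : g.1 = f t) : g ∈ SO0Real N := by
  let F : ℝ → SOReal N := fun t => ⟨⟨f t, hdet t⟩, hS t⟩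
  have hF : Continuous F := Continuous.subtype_mk (Continuous.subtype_mk hc _) _
  have h1 : F 0 = 1 := Subtype.ext (Subtype.ext h0)
  refine ⟨F t, ?_, Subtype.ext hg.symm⟩
  exact (isPreconnected_range hF).subset_connectedComponent ⟨0, h1⟩ ⟨t, rfl⟩

theorem unipA_mem {g : SpecialLinearGroup (Fin 5) ℝ} {t : ℝ} (hg : g.1 = unipA t) :
    g ∈ SO0Real N := by
  refine mem_SO0Real_of_path (f := unipA) ?_ ?_ (gram_unipA _) det_unipA t hg
  · refine continuous_matrix fun i j => ?_
    fin_cases i <;> fin_cases j <;> simp [unipA] <;> fun_prop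
  · ext i j
    fin_cases i <;> fin_cases j <;> simp [unipA]

theorem unipA'_mem {g : SpecialLinearGroup (Fin 5) ℝ} {t : ℝ} (hg : g.1 = unipA' t) :
    g ∈ SO0Real N := by
  refine mem_SO0Real_of_path (f := unipA') ?_ ?_ (gram_unipA' _) det_unipA' t hg
  · refine continuous_matrix fun i j => ?_
    fin_cases i <;> fin_cases j <;> simp [unipA'] <;> fun_prop
  · ext i j
    fin_cases i <;> fin_cases j <;> simp [unipA']

theorem unipB_mem {g : SpecialLinearGroup (Fin 5) ℝ} {t : ℝ} (hg : g.1 = unipB t) :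
    g ∈ SO0Real N := by
  refine mem_SO0Real_of_path (f := unipB) ?_ ?_ (gram_unipB _) det_unipB t hg
  · refine continuous_matrix fun i j => ?_
    fin_cases i <;> fin_cases j <;> simp [unipB] <;> fun_prop
  · ext i j
    fin_cases i <;> fin_cases j <;> simp [unipB]

theorem unipB'_mem {g : SpecialLinearGroup (Fin 5) ℝ} {t : ℝ} (hg : g.1 = unipB' t) :
    g ∈ SO0Real N := by
  refine mem_SO0Real_of_path (f := unipB') ?_ ?_ (gram_unipB' _) det_unipB' t hg
  · refine continuous_matrix fun i j => ?_
    fin_cases i <;> fin_cases j <;> simp [unipB'] <;> fun_prop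
  · ext i j
    fin_cases i <;> fin_cases j <;> simp [unipB']

theorem unipC_mem {g : SpecialLinearGroup (Fin 5) ℝ} {t : ℝ} (hg : g.1 = unipC (N : ℝ) t) :
    g ∈ SO0Real N := by
  refine mem_SO0Real_of_path (f := unipC (N : ℝ)) ?_ ?_ (gram_unipC _) (det_unipC _) t hg
  · refine continuous_matrix fun i j => ?_
    fin_cases i <;> fin_cases j <;> simp [unipC] <;> fun_prop
  · ext i j
    fin_cases i <;> fin_cases j <;> simp [unipC]

theorem unipC'_mem {g : SpecialLinearGroup (Fin 5) ℝ} {t : ℝ} (hg : g.1 = unipC' (N : ℝ) t) :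
    g ∈ SO0Real N := by
  refine mem_SO0Real_of_path (f := unipC' (N : ℝ)) ?_ ?_ (gram_unipC' _) (det_unipC' _) t hg
  · refine continuous_matrix fun i j => ?_
    fin_cases i <;> fin_cases j <;> simp [unipC'] <;> fun_prop
  · ext i j
    fin_cases i <;> fin_cases j <;> simp [unipC']

theorem atkinLehner_upper_mem {g : SpecialLinearGroup (Fin 5) ℝ} {t : ℝ}
    (hg : g.1 = atkinLehner 1 (N : ℝ) 1 t 0 1) : g ∈ SO0Real N := by
  refine mem_SO0Real_of_path (f := fun t => atkinLehner 1 (N : ℝ) 1 t 0 1) ?_ ?_ (fun t => ?_)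
    (fun t => det_atkinLehner _ _ _ _ _ _ (by ring)) t hg
  · refine continuous_matrix fun i j => ?_
    fin_cases i <;> fin_cases j <;> simp [atkinLehner] <;> fun_prop
  · ext i j
    fin_cases i <;> fin_cases j <;> simp [atkinLehner]
  · simpa using gram_atkinLehner 1 (N : ℝ) 1 t 0 1 (by ring)

theorem atkinLehner_lower_mem {g : SpecialLinearGroup (Fin 5) ℝ} {t : ℝ}
    (hg : g.1 = atkinLehner 1 (N : ℝ) 1 0 t 1) : g ∈ SO0Real N := by
  refine mem_SO0Real_of_path (f := fun t => atkinLehner 1 (N : ℝ) 1 0 t 1) ?_ ?_ (fun t => ?_)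
    (fun t => det_atkinLehner _ _ _ _ _ _ (by ring)) t hg
  · refine continuous_matrix fun i j => ?_
    fin_cases i <;> fin_cases j <;> simp [atkinLehner] <;> fun_prop
  · ext i j
    fin_cases i <;> fin_cases j <;> simp [atkinLehner]
  · simpa using gram_atkinLehner 1 (N : ℝ) 1 0 t 1 (by ring)

/-- For d = 1 the construction is the homomorphism induced by the 2 × 2 matrices [[α, β], [n γ, δ]].
-/
theorem atkinLehner_mul {R : Type*} [CommRing R] (n α β γ δ α' β' γ' δ' : R) :
    atkinLehner 1 n α β γ δ * atkinLehner 1 n α' β' γ' δ' =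
      atkinLehner 1 n (α * α' + n * β * γ') (α * β' + β * δ') (γ * α' + δ * γ')
        (n * γ * β' + δ * δ') := by
  ext i j
  fin_cases i <;> fin_cases j <;>
    simp [atkinLehner, Matrix.mul_apply, Fin.sum_univ_succ] <;> ring

theorem atkinLehner_diag_mem {g : SpecialLinearGroup (Fin 5) ℝ} {t : ℝ} (ht : t ≠ 0)
    (hg : g.1 = atkinLehner 1 (N : ℝ) t 0 0 t⁻¹) : g ∈ SO0Real N := by
  -- Only t² occurs in the matrix, so a negative t causes no trouble.
  have h := torus_mem N (0, Real.log (t ^ 2))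
  convert h
  refine Subtype.ext ?_
  rw [hg]
  change _ = diagonal _
  have h2 : (0 : ℝ) < t ^ 2 := by positivity
  ext i j
  fin_cases i <;> fin_cases j <;>
    simp [atkinLehner, -Real.log_pow, Real.exp_neg, Real.exp_log h2, ht]

/-- If α ≠ 0, the 2 × 2 matrix factors as lower unipotent times diagonal times upper unipotent, and
each factor is joined to the identity by a path. -/
theorem atkinLehner_one_mem {g : SpecialLinearGroup (Fin 5) ℝ} {α β γ δ : ℝ}
    (h : α * δ - N * β * γ = 1) (hg : g.1 = atkinLehner 1 (N : ℝ) α β γ δ) : g ∈ SO0Real N := by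
  have key : ∀ {g : SpecialLinearGroup (Fin 5) ℝ} {α β γ δ : ℝ},
      α * δ - N * β * γ = 1 → α ≠ 0 → g.1 = atkinLehner 1 (N : ℝ) α β γ δ → g ∈ SO0Real N := by
    intro g α β γ δ h hα hg
    let l : SpecialLinearGroup (Fin 5) ℝ :=
      ⟨atkinLehner 1 (N : ℝ) 1 0 (γ / α) 1, det_atkinLehner _ _ _ _ _ _ (by ring)⟩
    let t : SpecialLinearGroup (Fin 5) ℝ :=
      ⟨atkinLehner 1 (N : ℝ) α 0 0 α⁻¹, det_atkinLehner _ _ _ _ _ _ (by field_simp; ring)⟩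
    let u : SpecialLinearGroup (Fin 5) ℝ :=
      ⟨atkinLehner 1 (N : ℝ) 1 (β / α) 0 1, det_atkinLehner _ _ _ _ _ _ (by ring)⟩
    have e : g = l * t * u := by
      refine Subtype.ext ?_
      change g.1 = atkinLehner _ _ _ _ _ _ * atkinLehner _ _ _ _ _ _ * atkinLehner _ _ _ _ _ _
      rw [hg, atkinLehner_mul, atkinLehner_mul]
      have hδ : δ = (1 + N * β * γ) / α := by
        rw [eq_div_iff hα]; linarith
      rw [hδ]
      congr 1 <;> field_simp <;> ring
    rw [e]
    exact (SO0Real N).mul_mem ((SO0Real N).mul_mem (atkinLehner_lower_mem rfl)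
      (atkinLehner_diag_mem hα rfl)) (atkinLehner_upper_mem rfl)
  by_cases hα : α = 0
  -- If α = 0, the determinant condition gives N γ ≠ 0, so an upper unipotent factor on the left
  -- makes the corner entry -N γ nonzero.
  · let u : SpecialLinearGroup (Fin 5) ℝ :=
      ⟨atkinLehner 1 (N : ℝ) 1 (-1) 0 1, det_atkinLehner _ _ _ _ _ _ (by ring)⟩
    have hu : u ∈ SO0Real N := atkinLehner_upper_mem rfl
    rw [← Subgroup.mul_mem_cancel_left _ hu]
    refine key (α := α - N * γ) (β := β - δ) (γ := γ) (δ := δ) ?_ ?_ ?_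
    · linear_combination h
    · rintro h0
      rw [hα] at h h0
      have : (N : ℝ) * γ = 0 := by linarith
      apply zero_ne_one (α := ℝ)
      linear_combination h + β * this
    · change atkinLehner _ _ _ _ _ _ * g.1 = _
      rw [hg, atkinLehner_mul]
      congr 1 <;> ring
  · exact key h hα hg

/-- Over ℝ the factor √d can be distributed over the entries, which reduces to d = 1; positivity of
d is essential here. -/
theorem atkinLehner_mem {g : SpecialLinearGroup (Fin 5) ℝ} {d d' α β γ δ : ℝ} (hd : 0 < d)
    (hN : d * d' = N) (h : d * α * δ - d' * β * γ = 1) (hg : g.1 = atkinLehner d d' α β γ δ) :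
    g ∈ SO0Real N := by
  set s := Real.sqrt d
  have hs : s ^ 2 = d := Real.sq_sqrt hd.le
  have hs0 : s ≠ 0 := (Real.sqrt_pos.2 hd).ne'
  refine atkinLehner_one_mem (α := s * α) (β := β / s) (γ := γ / s) (δ := s * δ) ?_ ?_
  · rw [← hN, ← h, ← hs]
    field_simp
  · rw [hg, ← hN, ← hs]
    ext i j
    fin_cases i <;> fin_cases j <;> simp [atkinLehner] <;> field_simp

end Connected

/-! ### Orbits of primitive isotropic vectors -/

section Transitivity

/-- `SO₀(Ŝ_N; ℤ)` as a group of integral matrices. -/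
def GammaInt (N : ℕ) : Subgroup (SpecialLinearGroup (Fin 5) ℤ) :=
  (SO0Real N).comap (SpecialLinearGroup.map (Int.castRingHom ℝ))

/-- The integral matrices lying in `SO₀(Ŝ_N; ℤ)`. -/
def IsGamma (N : ℕ) (A : Matrix (Fin 5) (Fin 5) ℤ) : Prop := ∃ γ ∈ GammaInt N, γ.1 = A

variable {N : ℕ}

theorem IsGamma.one : IsGamma N 1 := ⟨1, (GammaInt N).one_mem, rfl⟩

theorem IsGamma.mul {A B : Matrix (Fin 5) (Fin 5) ℤ} (hA : IsGamma N A) (hB : IsGamma N B) :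
    IsGamma N (A * B) := by
  obtain ⟨a, ha, rfl⟩ := hA
  obtain ⟨b, hb, rfl⟩ := hB
  exact ⟨a * b, (GammaInt N).mul_mem ha hb, rfl⟩

theorem IsGamma.exists_inv {A : Matrix (Fin 5) (Fin 5) ℤ} (hA : IsGamma N A) :
    ∃ B, IsGamma N B ∧ A * B = 1 ∧ B * A = 1 := by
  obtain ⟨a, ha, rfl⟩ := hA
  refine ⟨(a⁻¹).1, ⟨a⁻¹, (GammaInt N).inv_mem ha, rfl⟩, ?_, ?_⟩
  · exact congrArg Subtype.val (mul_inv_cancel a)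
  · exact congrArg Subtype.val (inv_mul_cancel a)

theorem gram_eq_of_mem_SO0Real {g : SpecialLinearGroup (Fin 5) ℝ} (hg : g ∈ SO0Real N) :
    g.1ᵀ * gram (N : ℝ) * g.1 = gram (N : ℝ) := by
  obtain ⟨h, -, rfl⟩ := hg
  exact h.2

theorem gram_map {R S : Type*} [CommRing R] [CommRing S] (f : R →+* S) (n : R) :
    (gram n).map f = gram (f n) := by
  ext i j
  fin_cases i <;> fin_cases j <;> simp [gram, map_ofNat]

theorem IsGamma.gram_eq {A : Matrix (Fin 5) (Fin 5) ℤ} (hA : IsGamma N A) :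
    Aᵀ * gram (N : ℤ) * A = gram (N : ℤ) := by
  obtain ⟨a, ha, rfl⟩ := hA
  have h := gram_eq_of_mem_SO0Real (g := SpecialLinearGroup.map (Int.castRingHom ℝ) a) ha
  have e : (gram (N : ℝ)) = (gram (N : ℤ)).map (Int.castRingHom ℝ) := by
    rw [gram_map]; simp
  generalize ha' : a.1 = A
  have h' : (A.map (Int.castRingHom ℝ))ᵀ * gram (N : ℝ) * A.map (Int.castRingHom ℝ) =
      gram (N : ℝ) := by
    rw [← ha']; exact h
  rw [e, ← transpose_map, ← Matrix.map_mul, ← Matrix.map_mul] at h'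
  exact Matrix.map_injective (Int.castRingHom ℝ).injective_int h'

/-- `w` lies in the `SO₀(Ŝ_N; ℤ)`-orbit of `v`. -/
def OrbitRel (N : ℕ) (v w : Fin 5 → ℤ) : Prop := ∃ A, IsGamma N A ∧ A *ᵥ v = w

theorem OrbitRel.refl (v : Fin 5 → ℤ) : OrbitRel N v v := ⟨1, IsGamma.one, one_mulVec v⟩

theorem OrbitRel.trans {u v w : Fin 5 → ℤ} (h : OrbitRel N u v) (h' : OrbitRel N v w) :
    OrbitRel N u w := by
  obtain ⟨A, hA, rfl⟩ := h
  obtain ⟨B, hB, rfl⟩ := h'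
  exact ⟨B * A, hB.mul hA, by rw [mulVec_mulVec]⟩

theorem OrbitRel.symm {v w : Fin 5 → ℤ} (h : OrbitRel N v w) : OrbitRel N w v := by
  obtain ⟨A, hA, rfl⟩ := h
  obtain ⟨B, hB, -, hBA⟩ := hA.exists_inv
  exact ⟨B, hB, by rw [mulVec_mulVec, hBA, one_mulVec]⟩

/-- The quadratic form `x₀ x₄ + x₁ x₃ - n x₂²`. -/
def quad {R : Type*} [CommRing R] (n : R) (v : Fin 5 → R) : R :=
  v 0 * v 4 + v 1 * v 3 - n * v 2 ^ 2

theorem two_mul_quad {R : Type*} [CommRing R] (n : R) (v : Fin 5 → R) :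
    2 * quad n v = v ⬝ᵥ gram n *ᵥ v := by
  simp [quad, gram, dotProduct, mulVec, Fin.sum_univ_succ]
  ring

theorem two_mul_quad_mulVec {R : Type*} [CommRing R] {n c : R} {A : Matrix (Fin 5) (Fin 5) R}
    (h : Aᵀ * gram n * A = c • gram n) (v : Fin 5 → R) :
    2 * quad n (A *ᵥ v) = c * (2 * quad n v) := by
  rw [two_mul_quad, two_mul_quad]
  have : A *ᵥ v ⬝ᵥ gram n *ᵥ A *ᵥ v = v ⬝ᵥ (Aᵀ * gram n * A) *ᵥ v := by
    rw [← mulVec_mulVec, ← mulVec_mulVec, dotProduct_mulVec v, vecMul_transpose]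
  rw [this, h, smul_mulVec, dotProduct_smul, smul_eq_mul]

theorem OrbitRel.quad_eq {v w : Fin 5 → ℤ} (h : OrbitRel N v w) :
    quad (N : ℤ) w = quad (N : ℤ) v := by
  obtain ⟨A, hA, rfl⟩ := h
  have := two_mul_quad_mulVec (c := 1) (by rw [one_smul]; exact hA.gram_eq) v
  linarith

/-- A primitive integral vector. -/
def Primitive (v : Fin 5 → ℤ) : Prop := ∀ k : ℤ, (∀ i, k ∣ v i) → IsUnit k

theorem dvd_mulVec {k : ℤ} {v : Fin 5 → ℤ} (h : ∀ i, k ∣ v i) (A : Matrix (Fin 5) (Fin 5) ℤ)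
    (i : Fin 5) : k ∣ (A *ᵥ v) i := by
  rw [mulVec, dotProduct]
  exact Finset.dvd_sum fun j _ => (h j).mul_left _

theorem OrbitRel.primitive {v w : Fin 5 → ℤ} (h : OrbitRel N v w) (hv : Primitive v) :
    Primitive w := by
  obtain ⟨B, -, rfl⟩ := h.symm
  exact fun k hk => hv k (dvd_mulVec hk B)

theorem mem_GammaInt_of_map {A : Matrix (Fin 5) (Fin 5) ℤ} (hdet : A.det = 1)
    (h : ∀ g : SpecialLinearGroup (Fin 5) ℝ, g.1 = A.map (Int.cast : ℤ → ℝ) → g ∈ SO0Real N) :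
    IsGamma N A :=
  ⟨⟨A, hdet⟩, h _ rfl, rfl⟩

theorem isGamma_unipA (t : ℤ) : IsGamma N (unipA t) :=
  mem_GammaInt_of_map (det_unipA t) fun g hg => unipA_mem (t := t) (hg.trans (by
    ext i j; fin_cases i <;> fin_cases j <;> simp [unipA]))

theorem isGamma_unipA' (t : ℤ) : IsGamma N (unipA' t) :=
  mem_GammaInt_of_map (det_unipA' t) fun g hg => unipA'_mem (t := t) (hg.trans (by
    ext i j; fin_cases i <;> fin_cases j <;> simp [unipA']))

theorem isGamma_unipB (t : ℤ) : IsGamma N (unipB t) :=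
  mem_GammaInt_of_map (det_unipB t) fun g hg => unipB_mem (t := t) (hg.trans (by
    ext i j; fin_cases i <;> fin_cases j <;> simp [unipB]))

theorem isGamma_unipB' (t : ℤ) : IsGamma N (unipB' t) :=
  mem_GammaInt_of_map (det_unipB' t) fun g hg => unipB'_mem (t := t) (hg.trans (by
    ext i j; fin_cases i <;> fin_cases j <;> simp [unipB']))

theorem isGamma_unipC (t : ℤ) : IsGamma N (unipC (N : ℤ) t) :=
  mem_GammaInt_of_map (det_unipC _ t) fun g hg => unipC_mem (t := t) (hg.trans (by
    ext i j; fin_cases i <;> fin_cases j <;> simp [unipC]))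

theorem isGamma_unipC' (t : ℤ) : IsGamma N (unipC' (N : ℤ) t) :=
  mem_GammaInt_of_map (det_unipC' _ t) fun g hg => unipC'_mem (t := t) (hg.trans (by
    ext i j; fin_cases i <;> fin_cases j <;> simp [unipC']))

theorem isGamma_atkinLehner {d d' α β γ δ : ℤ} (hd : 0 < d) (hN : d * d' = N)
    (h : d * α * δ - d' * β * γ = 1) : IsGamma N (atkinLehner d d' α β γ δ) :=
  mem_GammaInt_of_map (det_atkinLehner _ _ _ _ _ _ h) fun g hg =>
    atkinLehner_mem (d := d) (d' := d') (α := α) (β := β) (γ := γ) (δ := δ)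
      (Int.cast_pos.2 hd) (by exact_mod_cast hN) (by exact_mod_cast h) (hg.trans (by
    ext i j; fin_cases i <;> fin_cases j <;> simp [atkinLehner]))

theorem orbitRel_unipA (t x₀ x₁ x₂ x₃ x₄ : ℤ) :
    OrbitRel N ![x₀, x₁, x₂, x₃, x₄] ![x₀ + t * x₁, x₁, x₂, x₃ - t * x₄, x₄] :=
  ⟨_, isGamma_unipA t, by
    ext i; fin_cases i <;> simp [unipA, mulVec, dotProduct, Fin.sum_univ_succ]; ring⟩

theorem orbitRel_unipA' (t x₀ x₁ x₂ x₃ x₄ : ℤ) :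
    OrbitRel N ![x₀, x₁, x₂, x₃, x₄] ![x₀, x₁ + t * x₀, x₂, x₃, x₄ - t * x₃] :=
  ⟨_, isGamma_unipA' t, by
    ext i; fin_cases i <;> simp [unipA', mulVec, dotProduct, Fin.sum_univ_succ] <;> ring⟩

theorem orbitRel_unipB (t x₀ x₁ x₂ x₃ x₄ : ℤ) :
    OrbitRel N ![x₀, x₁, x₂, x₃, x₄] ![x₀ + t * x₃, x₁ - t * x₄, x₂, x₃, x₄] :=
  ⟨_, isGamma_unipB t, by
    ext i; fin_cases i <;> simp [unipB, mulVec, dotProduct, Fin.sum_univ_succ]; ring⟩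

theorem orbitRel_unipB' (t x₀ x₁ x₂ x₃ x₄ : ℤ) :
    OrbitRel N ![x₀, x₁, x₂, x₃, x₄] ![x₀, x₁, x₂, x₃ + t * x₀, x₄ - t * x₁] :=
  ⟨_, isGamma_unipB' t, by
    ext i; fin_cases i <;> simp [unipB', mulVec, dotProduct, Fin.sum_univ_succ] <;> ring⟩

theorem orbitRel_unipC' (t x₀ x₁ x₂ x₃ x₄ : ℤ) :
    OrbitRel N ![x₀, x₁, x₂, x₃, x₄]
      ![x₀, x₁, x₂ + t * x₀, x₃, x₄ + 2 * N * t * x₂ + N * t ^ 2 * x₀] :=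
  ⟨_, isGamma_unipC' t, by
    ext i; fin_cases i <;> simp [unipC', mulVec, dotProduct, Fin.sum_univ_succ] <;> ring⟩

theorem orbitRel_weylA (x₀ x₁ x₂ x₃ x₄ : ℤ) :
    OrbitRel N ![x₀, x₁, x₂, x₃, x₄] ![x₁, -x₀, x₂, -x₄, x₃] := by
  have h := ((orbitRel_unipA (N := N) 1 x₀ x₁ x₂ x₃ x₄).trans
    (orbitRel_unipA' (-1) _ _ _ _ _)).trans (orbitRel_unipA 1 _ _ _ _ _)
  convert h using 1
  ext i; fin_cases i <;> simp

theorem orbitRel_weylB (x₀ x₁ x₂ x₃ x₄ : ℤ) :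
    OrbitRel N ![x₀, x₁, x₂, x₃, x₄] ![x₃, -x₄, x₂, -x₀, x₁] := by
  have h := ((orbitRel_unipB (N := N) 1 x₀ x₁ x₂ x₃ x₄).trans
    (orbitRel_unipB' (-1) _ _ _ _ _)).trans (orbitRel_unipB 1 _ _ _ _ _)
  convert h using 1
  ext i; fin_cases i <;> simp

theorem dvd_of_sq_dvd_mul_sq {n d s : ℤ} (hn : Squarefree n) (h : d ^ 2 ∣ n * s ^ 2) : d ∣ s := by
  by_cases hd : d = 0
  · subst hd
    rw [zero_pow two_ne_zero, zero_dvd_iff] at h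
    rcases mul_eq_zero.1 h with h0 | h0
    · exact absurd h0 hn.ne_zero
    · rw [pow_eq_zero_iff two_ne_zero] at h0
      rw [h0]
  · have hd' : (d : ℚ) ≠ 0 := Int.cast_ne_zero.2 hd
    obtain ⟨c, hc⟩ := h
    obtain ⟨z, hz⟩ := mem_intSubring_of_mul_sq hn (q := (s : ℚ) / d) ⟨c, by
      have : (n : ℚ) * s ^ 2 = d ^ 2 * c := by exact_mod_cast hc
      change (c : ℚ) = _
      field_simp
      linarith⟩
    have hz' : (z : ℚ) = s / d := hz
    refine ⟨z, ?_⟩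
    have : (s : ℚ) = d * z := by rw [hz']; field_simp
    exact_mod_cast this

/-- A Euclidean step: reduce x₁ modulo x₀ by a unipotent element, then bring the nonzero remainder
to the front by a Weyl element. -/
theorem exists_smaller_of_not_dvd_one {x₀ x₁ x₂ x₃ x₄ : ℤ} (h0 : x₀ ≠ 0) (h : ¬ x₀ ∣ x₁) :
    ∃ w : Fin 5 → ℤ, OrbitRel N ![x₀, x₁, x₂, x₃, x₄] w ∧ w 0 ≠ 0 ∧ (w 0).natAbs < x₀.natAbs := by
  refine ⟨_, (orbitRel_unipA' (-(x₁ / x₀)) _ _ _ _ _).trans (orbitRel_weylA _ _ _ _ _), ?_, ?_⟩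
  · change x₁ + -(x₁ / x₀) * x₀ ≠ 0
    intro h1
    exact h ⟨x₁ / x₀, by linarith⟩
  · change (x₁ + -(x₁ / x₀) * x₀).natAbs < _
    have e : x₁ + -(x₁ / x₀) * x₀ = x₁ % x₀ := by
      have := Int.emod_add_mul_ediv x₁ x₀; linarith
    rw [e]
    have h1 := Int.emod_nonneg x₁ h0
    have h2 := Int.emod_lt_abs x₁ h0
    rw [Int.abs_eq_natAbs] at h2
    omega

theorem exists_smaller_of_not_dvd_three {x₀ x₁ x₂ x₃ x₄ : ℤ} (h0 : x₀ ≠ 0) (h : ¬ x₀ ∣ x₃) :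
    ∃ w : Fin 5 → ℤ, OrbitRel N ![x₀, x₁, x₂, x₃, x₄] w ∧ w 0 ≠ 0 ∧ (w 0).natAbs < x₀.natAbs := by
  refine ⟨_, (orbitRel_unipB' (-(x₃ / x₀)) _ _ _ _ _).trans (orbitRel_weylB _ _ _ _ _), ?_, ?_⟩
  · change x₃ + -(x₃ / x₀) * x₀ ≠ 0
    intro h1
    exact h ⟨x₃ / x₀, by linarith⟩
  · change (x₃ + -(x₃ / x₀) * x₀).natAbs < _
    have e : x₃ + -(x₃ / x₀) * x₀ = x₃ % x₀ := by
      have := Int.emod_add_mul_ediv x₃ x₀; linarith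
    rw [e]
    have h1 := Int.emod_nonneg x₃ h0
    have h2 := Int.emod_lt_abs x₃ h0
    rw [Int.abs_eq_natAbs] at h2
    omega

/-- When x₀ divides x₁ and x₃, these can be cleared at the cost of changing x₄ by a multiple of x₀.
The new x₄ is then copied into position 1, where the earlier Euclidean step applies. -/
theorem exists_smaller_of_not_dvd_four {x₀ x₁ x₂ x₃ x₄ : ℤ} (h0 : x₀ ≠ 0) (h1 : x₀ ∣ x₁)
    (h3 : x₀ ∣ x₃) (h : ¬ x₀ ∣ x₄) :
    ∃ w : Fin 5 → ℤ, OrbitRel N ![x₀, x₁, x₂, x₃, x₄] w ∧ w 0 ≠ 0 ∧ (w 0).natAbs < x₀.natAbs := by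
  obtain ⟨k, rfl⟩ := h1
  obtain ⟨l, rfl⟩ := h3
  have hmove : OrbitRel N ![x₀, x₀ * k, x₂, x₀ * l, x₄]
      ![x₀, x₄ + k * (x₀ * l), x₂, 0, x₄ + k * (x₀ * l)] := by
    have h := ((orbitRel_unipA' (N := N) (-k) x₀ (x₀ * k) x₂ (x₀ * l) x₄).trans
      (orbitRel_unipB' (-l) _ _ _ _ _)).trans (orbitRel_unipB (-1) _ _ _ _ _)
    convert h using 1
    ext i; fin_cases i <;> simp
    all_goals first
      | ring1
      | exact Or.inr (by ring1)
  obtain ⟨w, hw, hw'⟩ := exists_smaller_of_not_dvd_one (N := N) (x₁ := x₄ + k * (x₀ * l))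
    (x₂ := x₂) (x₃ := 0) (x₄ := x₄ + k * (x₀ * l)) h0
    (fun hd => h ((dvd_add_left ⟨k * l, by ring⟩).1 hd))
  exact ⟨w, hmove.trans hw, hw'⟩

/-- A leading 1 clears the coordinates x₁, x₂, x₃; what is then left in the last place is the value
of the quadratic form, which is 0. -/
theorem orbitRel_basis_of_one {x₁ x₂ x₃ x₄ : ℤ} (hq : quad (N : ℤ) ![1, x₁, x₂, x₃, x₄] = 0) :
    OrbitRel N ![1, x₁, x₂, x₃, x₄] ![1, 0, 0, 0, 0] := by
  have h := ((orbitRel_unipA' (N := N) (-x₁) 1 x₁ x₂ x₃ x₄).trans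
      (orbitRel_unipB' (-x₃) _ _ _ _ _)).trans (orbitRel_unipC' (-x₂) _ _ _ _ _)
  convert h using 1
  have hq' : x₄ + x₁ * x₃ - N * x₂ ^ 2 = 0 := by simpa [quad] using hq
  ext i; fin_cases i <;> simp
  linear_combination -hq'

theorem vec_eta (v : Fin 5 → ℤ) : ![v 0, v 1, v 2, v 3, v 4] = v := by
  ext i; fin_cases i <;> rfl

/-- Primitive isotropic vectors with nonzero leading coordinate form one orbit. -/
theorem orbitRel_basis_of_ne_zero (hN : Squarefree N) (m : ℕ) : ∀ v : Fin 5 → ℤ, (v 0).natAbs = m →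
    v 0 ≠ 0 → Primitive v → quad (N : ℤ) v = 0 → OrbitRel N v ![1, 0, 0, 0, 0] := by
  induction m using Nat.strong_induction_on with
  | _ m ih =>
    intro v hm h0 hv hq
    have hrec : (∃ w : Fin 5 → ℤ, OrbitRel N v w ∧ w 0 ≠ 0 ∧ (w 0).natAbs < (v 0).natAbs) →
        OrbitRel N v ![1, 0, 0, 0, 0] := by
      rintro ⟨w, hvw, hw0, hw⟩
      exact hvw.trans (ih _ (hm ▸ hw) w rfl hw0 (hvw.primitive hv) (by rw [hvw.quad_eq, hq]))
    by_cases h1 : v 0 ∣ v 1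
    swap
    · have h := exists_smaller_of_not_dvd_one (N := N) (x₁ := v 1) (x₂ := v 2) (x₃ := v 3)
        (x₄ := v 4) h0 h1
      rw [vec_eta] at h
      exact hrec h
    by_cases h3 : v 0 ∣ v 3
    swap
    · have h := exists_smaller_of_not_dvd_three (N := N) (x₁ := v 1) (x₂ := v 2) (x₃ := v 3)
        (x₄ := v 4) h0 h3
      rw [vec_eta] at h
      exact hrec h
    by_cases h4 : v 0 ∣ v 4
    swap
    · have h := exists_smaller_of_not_dvd_four (N := N) (x₂ := v 2) h0 h1 h3 h4
      rw [vec_eta] at h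
      exact hrec h
    -- No Euclidean step is available for the middle coordinate. Isotropy gives v₀² ∣ N v₂² instead,
    -- and squarefreeness of N finishes; primitivity then makes v₀ a unit.
    have h2 : v 0 ∣ v 2 := by
      refine dvd_of_sq_dvd_mul_sq (Int.squarefree_natCast.2 hN) ?_
      obtain ⟨k, hk⟩ := h1
      obtain ⟨l, hl⟩ := h3
      obtain ⟨j, hj⟩ := h4
      refine ⟨j + k * l, ?_⟩
      rw [quad, hk, hl, hj] at hq
      linear_combination -hq
    have hu := hv (v 0) (by
      intro i
      fin_cases i
      exacts [dvd_rfl, h1, h2, h3, h4])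
    rcases Int.isUnit_iff.1 hu with h | h
    · have := orbitRel_basis_of_one (N := N) (x₁ := v 1) (x₂ := v 2) (x₃ := v 3) (x₄ := v 4)
      rw [← h, vec_eta] at this
      simpa [h] using this hq
    -- The square of the Weyl element negates the four outer coordinates, which turns v₀ = -1 into
    -- 1.
    · have hneg : OrbitRel N v ![-v 0, -v 1, v 2, -v 3, -v 4] := by
        have h := (orbitRel_weylA (N := N) (v 0) (v 1) (v 2) (v 3) (v 4)).trans
          (orbitRel_weylA _ _ _ _ _)
        rwa [vec_eta] at h
      refine hneg.trans ?_
      have hq' := hneg.quad_eq.trans hq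
      rw [h, neg_neg] at hq' ⊢
      exact orbitRel_basis_of_one hq'

/-- Weyl elements bring any nonzero outer coordinate to the front. If all four vanish, isotropy
kills the middle one too, against primitivity. -/
theorem orbitRel_basis (hN : Squarefree N) {v : Fin 5 → ℤ} (hv : Primitive v)
    (hq : quad (N : ℤ) v = 0) : OrbitRel N v ![1, 0, 0, 0, 0] := by
  have hstep : ∀ w : Fin 5 → ℤ, OrbitRel N v w → w 0 ≠ 0 → OrbitRel N v ![1, 0, 0, 0, 0] :=
    fun w hw h0 => hw.trans (orbitRel_basis_of_ne_zero hN _ w rfl h0 (hw.primitive hv)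
      (by rw [hw.quad_eq, hq]))
  have hA := orbitRel_weylA (N := N) (v 0) (v 1) (v 2) (v 3) (v 4)
  have hB := orbitRel_weylB (N := N) (v 0) (v 1) (v 2) (v 3) (v 4)
  have hAB := hA.trans (orbitRel_weylB _ _ _ _ _)
  rw [vec_eta] at hA hB hAB
  by_cases h0 : v 0 = 0
  swap
  · exact hstep v (OrbitRel.refl v) h0
  by_cases h1 : v 1 = 0
  swap
  · exact hstep _ hA h1
  by_cases h3 : v 3 = 0
  swap
  · exact hstep _ hB h3
  by_cases h4 : v 4 = 0
  swap
  · exact hstep _ hAB (neg_ne_zero.2 h4)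
  have h2 : v 2 = 0 := by
    have : N ≠ 0 := hN.ne_zero
    simpa [quad, h0, h1, h3, h4, this] using hq
  exfalso
  refine not_isUnit_zero (hv 0 fun i => ?_)
  rw [zero_dvd_iff]
  fin_cases i
  exacts [h0, h1, h2, h3, h4]

/-- Parametrization of the primitive zeros of `x y = N z²` for squarefree `N`. -/
theorem exists_parametrization (hN : Squarefree N) {x z y : ℤ} (hv : Primitive ![0, x, z, y, 0])
    (h : x * y = N * z ^ 2) : ∃ d d' α β γ δ ε : ℤ, 0 < d ∧ d * d' = N ∧
      d * α * δ - d' * β * γ = 1 ∧ ε * ε = 1 ∧ x = ε * (d * α ^ 2) ∧ z = ε * (α * γ) ∧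
      y = ε * (d' * γ ^ 2) := by
  have hN0 : (N : ℤ) ≠ 0 := Int.natCast_ne_zero.2 hN.ne_zero
  -- A common divisor g of x and y satisfies g² ∣ N z², hence g ∣ z, and primitivity applies.
  have hxy : IsCoprime x y := by
    rw [← isRelPrime_iff_isCoprime]
    intro g hgx hgy
    refine hv g fun i => ?_
    have hgz : g ∣ z := by
      refine dvd_of_sq_dvd_mul_sq (Int.squarefree_natCast.2 hN) ?_
      rw [← h, pow_two]
      exact mul_dvd_mul hgx hgy
    fin_cases i
    exacts [dvd_zero g, hgx, hgz, hgy, dvd_zero g]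
  -- Coprimality of x and y makes dα and d'γ coprime, so a Bézout relation supplies the remaining
  -- entries β and δ.
  suffices H : ∃ d d' α γ ε : ℤ, 0 < d ∧ d * d' = N ∧ ε * ε = 1 ∧ x = ε * (d * α ^ 2) ∧
      z = ε * (α * γ) ∧ y = ε * (d' * γ ^ 2) by
    obtain ⟨d, d', α, γ, ε, hd, hdd, hε, hx, hz, hy⟩ := H
    have hc : IsCoprime (d * α) (d' * γ) := by
      refine hxy.mono ⟨ε * α, ?_⟩ ⟨ε * γ, ?_⟩
      · rw [hx]; ring
      · rw [hy]; ring
    obtain ⟨u, v, huv⟩ := hc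
    exact ⟨d, d', α, -v, γ, u, ε, hd, hdd, by linear_combination huv, hε, hx, hz, hy⟩
  -- The choice d = gcd(x, N) works: d' = N/d is prime to x₁ = x/d, so d' divides y, and the
  -- equation becomes x₁ y₁ = z² with coprime factors. Hence x₁ is a square up to sign.
  obtain ⟨x₁, hx₁⟩ : (Int.gcd x N : ℤ) ∣ x := Int.gcd_dvd_left ..
  obtain ⟨d', hd'⟩ : (Int.gcd x N : ℤ) ∣ N := Int.gcd_dvd_right ..
  have hd : 0 < (Int.gcd x N : ℤ) := Int.natCast_pos.2 (Int.gcd_pos_of_ne_zero_right _ hN0)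
  have hgcd : ∀ k : ℤ, k ∣ x → k ∣ N → k ∣ (Int.gcd x N : ℤ) := fun k h1 h2 => Int.dvd_coe_gcd h1 h2
  generalize (Int.gcd x N : ℤ) = d at hx₁ hd' hd hgcd
  have hd'0 : d' ≠ 0 := by
    rintro rfl
    exact hN0 (by simpa using hd')
  have hcop : IsCoprime d' x₁ := by
    rw [← isRelPrime_iff_isCoprime]
    intro k hk1 hk2
    have h1 : d * k ∣ d := hgcd _ (hx₁ ▸ mul_dvd_mul_left d hk2) (hd' ▸ mul_dvd_mul_left d hk1)
    obtain ⟨c, hc⟩ := h1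
    refine IsUnit.of_mul_eq_one c ?_
    have := mul_left_cancel₀ hd.ne' (by linarith : d * (k * c) = d * 1)
    exact this
  have h1 : x₁ * y = d' * z ^ 2 := by
    refine mul_left_cancel₀ hd.ne' ?_
    rw [← mul_assoc, ← hx₁, h, hd']; ring
  obtain ⟨y₁, rfl⟩ : d' ∣ y := hcop.dvd_of_dvd_mul_left ⟨z ^ 2, h1⟩
  have h2 : x₁ * y₁ = z ^ 2 := by
    refine mul_left_cancel₀ hd'0 ?_
    rw [← h1]; ring
  have hcop2 : IsCoprime x₁ y₁ := hxy.mono ⟨d, by rw [hx₁]; ring⟩ ⟨d', by ring⟩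
  obtain ⟨a, ha⟩ := Int.sq_of_gcd_eq_one (Int.isCoprime_iff_gcd_eq_one.1 hcop2) h2
  -- If x₁ = 0, then y₁ is a unit and itself serves as the sign.
  by_cases ha0 : a = 0
  · have hx0 : x₁ = 0 := by simpa [ha0] using ha
    subst hx0
    have hz : z = 0 := by simpa using h2.symm
    have hy1 : y₁ * y₁ = 1 := by
      rw [isCoprime_zero_left] at hcop2
      rcases Int.isUnit_iff.1 hcop2 with h | h <;> rw [h] <;> norm_num
    exact ⟨d, d', 0, 1, y₁, hd, hd'.symm, hy1, by simp [hx₁], by simp [hz], by ring⟩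
  have haz : a ∣ z := by
    rw [← Int.pow_dvd_pow_iff two_ne_zero, ← h2]
    rcases ha with ha | ha
    · exact ha ▸ dvd_mul_right _ _
    · exact ⟨-y₁, by rw [ha]; ring⟩
  obtain ⟨c, rfl⟩ := haz
  have ha2 : a ^ 2 ≠ 0 := pow_ne_zero _ ha0
  rcases ha with ha | ha
  · refine ⟨d, d', a, c, 1, hd, hd'.symm, by norm_num, by rw [hx₁, ha]; ring, by ring, ?_⟩
    have : y₁ = c ^ 2 := mul_left_cancel₀ ha2 (by rw [← ha, h2, ha]; ring)
    rw [this]; ring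
  · refine ⟨d, d', a, -c, -1, hd, hd'.symm, by norm_num, by rw [hx₁, ha]; ring, by ring, ?_⟩
    have : y₁ = -c ^ 2 := mul_left_cancel₀ ha2 (by linear_combination -h2 + y₁ * ha)
    rw [this]; ring

end Transitivity

/-! ### Integral similitudes and primitive images -/

section Similitudes

/-- `2 n` times the inverse of the Gram matrix. -/
def cogram {R : Type*} [CommRing R] (n : R) : Matrix (Fin 5) (Fin 5) R :=
  !![0, 0, 0, 0, 2 * n;
     0, 0, 0, 2 * n, 0;
     0, 0, -1, 0, 0;
     0, 2 * n, 0, 0, 0;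
     2 * n, 0, 0, 0, 0]

theorem cogram_mul_gram {R : Type*} [CommRing R] (n : R) :
    cogram n * gram n = (2 * n) • (1 : Matrix (Fin 5) (Fin 5) R) := by
  ext i j
  fin_cases i <;> fin_cases j <;> simp [cogram, gram, Matrix.mul_apply, Fin.sum_univ_succ]

theorem gram_mul_cogram {R : Type*} [CommRing R] (n : R) :
    gram n * cogram n = (2 * n) • (1 : Matrix (Fin 5) (Fin 5) R) := by
  ext i j
  fin_cases i <;> fin_cases j <;> simp [cogram, gram, Matrix.mul_apply, Fin.sum_univ_succ]

theorem gram_entry {R : Type*} [CommRing R] (n : R) (A : Matrix (Fin 5) (Fin 5) R)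
    (j k : Fin 5) : (Aᵀ * gram n * A) j k = A 0 j * A 4 k + A 1 j * A 3 k - 2 * n * A 2 j * A 2 k +
      A 3 j * A 1 k + A 4 j * A 0 k := by
  simp [Matrix.mul_apply, gram, Fin.sum_univ_succ]
  ring

theorem cogram_entry {R : Type*} [CommRing R] (n : R) (A : Matrix (Fin 5) (Fin 5) R)
    (j k : Fin 5) : (A * cogram n * Aᵀ) j k = 2 * n * (A j 0 * A k 4 + A j 1 * A k 3 +
      A j 3 * A k 1 + A j 4 * A k 0) - A j 2 * A k 2 := by
  simp [Matrix.mul_apply, cogram, Fin.sum_univ_succ]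
  ring

theorem mul_eq_smul_one_comm {R : Type*} [CommRing R] [IsDomain R]
    {A B : Matrix (Fin 5) (Fin 5) R} {c : R} (hc : c ≠ 0) (h : A * B = c • 1) : B * A = c • 1 := by
  have hdet : A.det ≠ 0 := by
    intro h0
    have := congrArg det h
    rw [det_mul, h0, zero_mul, det_smul, det_one, mul_one] at this
    exact pow_ne_zero _ hc this.symm
  have h1 : A * (B * A - c • 1) = 0 := by
    rw [Matrix.mul_sub, ← Matrix.mul_assoc, h, Matrix.smul_mul, Matrix.one_mul, Matrix.mul_smul,
      Matrix.mul_one, sub_self]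
  have h2 : A.det • (B * A - c • 1) = 0 := by
    have := congrArg (fun X => A.adjugate * X) h1
    simpa [← Matrix.mul_assoc, adjugate_mul] using this
  exact sub_eq_zero.1 ((smul_eq_zero.1 h2).resolve_left hdet)

/-- The defining equation relates columns. Multiplying by the dual Gram matrix and commuting the
factors of a scalar matrix gives the corresponding relations between rows. -/
theorem cogram_eq_of_gram_eq {R : Type*} [CommRing R] [IsDomain R] {n c : R} (hn : 2 * n ≠ 0)
    (hc : c ≠ 0) {M : Matrix (Fin 5) (Fin 5) R} (h : Mᵀ * gram n * M = c • gram n) :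
    M * cogram n * Mᵀ = c • cogram n := by
  have h1 : cogram n * Mᵀ * gram n * M = (c * (2 * n)) • 1 := by
    rw [Matrix.mul_assoc (cogram n), Matrix.mul_assoc (cogram n), h, Matrix.mul_smul,
      cogram_mul_gram, smul_smul]
  have h2 := mul_eq_smul_one_comm (mul_ne_zero hc hn) h1
  have h3 := congrArg (fun X => X * cogram n) h2
  have h4 : (2 * n) • (M * cogram n * Mᵀ) = (2 * n) • (c • cogram n) := by
    simp only [Matrix.mul_assoc, gram_mul_cogram, Matrix.mul_smul, Matrix.mul_one, Matrix.smul_mul,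
      Matrix.one_mul] at h3
    rw [Matrix.mul_assoc, h3, smul_smul, mul_comm]
  exact smul_right_injective _ hn h4

variable {N : ℕ}

theorem gram_mul {R : Type*} [CommRing R] {n c c' : R} {A B : Matrix (Fin 5) (Fin 5) R}
    (hA : Aᵀ * gram n * A = c • gram n) (hB : Bᵀ * gram n * B = c' • gram n) :
    (A * B)ᵀ * gram n * (A * B) = (c * c') • gram n := by
  calc (A * B)ᵀ * gram n * (A * B) = Bᵀ * (Aᵀ * gram n * A) * B := by
        rw [transpose_mul]; simp only [Matrix.mul_assoc]
    _ = _ := by rw [hA, Matrix.mul_smul, Matrix.smul_mul, hB, smul_smul]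

theorem gram_mul_mul {R : Type*} [CommRing R] {n c : R} {A M B : Matrix (Fin 5) (Fin 5) R}
    (hA : Aᵀ * gram n * A = gram n) (hM : Mᵀ * gram n * M = c • gram n)
    (hB : Bᵀ * gram n * B = gram n) :
    (A * M * B)ᵀ * gram n * (A * M * B) = c • gram n := by
  have h1 := gram_mul (c := 1) (by rw [one_smul]; exact hA) hM
  have h2 := gram_mul h1 (c' := 1) (by rw [one_smul]; exact hB)
  rwa [one_mul, mul_one] at h2

/-- A row with i ≠ 2 is isotropic for the dual form, so N (Mᵢ₂ / 2N)² = Mᵢ₀ Mᵢ₄ + Mᵢ₁ Mᵢ₃ is an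
integer, and Mᵢ₂ / 2N is integral by squarefreeness. -/
theorem exists_mid_eq (hN : Squarefree N) {a : ℤ} (ha : a ≠ 0)
    {M : Matrix (Fin 5) (Fin 5) ℤ} (hM : Mᵀ * gram (N : ℤ) * M = a ^ 2 • gram (N : ℤ))
    {i : Fin 5} (hi : i ≠ 2) :
    ∃ s, M i 2 = 2 * N * s ∧ M i 0 * M i 4 + M i 1 * M i 3 = N * s ^ 2 := by
  have hN0 : (N : ℤ) ≠ 0 := Int.natCast_ne_zero.2 hN.ne_zero
  have hrow := cogram_eq_of_gram_eq (mul_ne_zero two_ne_zero hN0) (pow_ne_zero 2 ha) hM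
  have hii := congrFun (congrFun hrow i) i
  have e : cogram (N : ℤ) i i = 0 := by
    fin_cases i <;> simp_all [cogram]
  rw [cogram_entry, Matrix.smul_apply, smul_eq_mul, e, mul_zero] at hii
  have hN0' : (N : ℚ) ≠ 0 := Nat.cast_ne_zero.2 hN.ne_zero
  obtain ⟨s, hs⟩ := mem_intSubring_of_mul_sq (Int.squarefree_natCast.2 hN)
    (q := (M i 2 : ℚ) / (2 * N)) ⟨M i 0 * M i 4 + M i 1 * M i 3, by
      have : (4 : ℚ) * N * (M i 0 * M i 4 + M i 1 * M i 3) = M i 2 ^ 2 := by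
        exact_mod_cast (by linear_combination hii :
          4 * (N : ℤ) * (M i 0 * M i 4 + M i 1 * M i 3) = M i 2 ^ 2)
      change ((M i 0 * M i 4 + M i 1 * M i 3 : ℤ) : ℚ) = _
      push_cast
      field_simp
      linear_combination this⟩
  have hs' : (s : ℚ) = M i 2 / (2 * N) := hs
  have hs2 : M i 2 = 2 * N * s := by
    have : (M i 2 : ℚ) = 2 * N * s := by rw [hs']; field_simp
    exact_mod_cast this
  refine ⟨s, hs2, ?_⟩
  rw [hs2] at hii
  refine mul_left_cancel₀ (mul_ne_zero four_ne_zero hN0) ?_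
  linear_combination hii

/-- The row relations control the entry in column 2. For i = 2 they read M₂₂² = 4N(…) + a² with both
terms divisible by p; the other rows use `exists_mid_eq`. This also covers primes dividing 2N. -/
theorem dvd_mid_row (hN : Squarefree N) {a p : ℤ} (ha : a ≠ 0) (hp : Prime p) (hpa : p ∣ a)
    {M : Matrix (Fin 5) (Fin 5) ℤ} (hM : Mᵀ * gram (N : ℤ) * M = a ^ 2 • gram (N : ℤ))
    {i : Fin 5} (h0 : p ∣ M i 0) (h1 : p ∣ M i 1) (h3 : p ∣ M i 3) (h4 : p ∣ M i 4) :
    p ∣ M i 2 := by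
  have hu : p ^ 2 ∣ M i 0 * M i 4 + M i 1 * M i 3 := by
    rw [pow_two]
    exact dvd_add (mul_dvd_mul h0 h4) (mul_dvd_mul h1 h3)
  by_cases hi : i = 2
  · subst hi
    have hN0 : (N : ℤ) ≠ 0 := Int.natCast_ne_zero.2 hN.ne_zero
    have hrow := cogram_eq_of_gram_eq (mul_ne_zero two_ne_zero hN0) (pow_ne_zero 2 ha) hM
    have hii := congrFun (congrFun hrow 2) 2
    have e : cogram (N : ℤ) 2 2 = -1 := rfl
    rw [cogram_entry, Matrix.smul_apply, smul_eq_mul, e] at hii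
    refine hp.dvd_of_dvd_pow (n := 2) ?_
    have : M 2 2 ^ 2 = 4 * N * (M 2 0 * M 2 4 + M 2 1 * M 2 3) + a * a := by
      linear_combination -hii
    rw [this]
    exact dvd_add (((Dvd.intro_left _ (pow_two p).symm).trans hu).mul_left _) (hpa.mul_left _)
  · obtain ⟨s, hs, hs'⟩ := exists_mid_eq hN ha hM hi
    rw [hs]
    exact (dvd_of_sq_dvd_mul_sq (Int.squarefree_natCast.2 hN)
      (hu.trans (dvd_of_eq hs'))).mul_left _

/-- Take for m the product of the primes dividing a that violate P, and for n the product of those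
satisfying P. Modulo each prime divisor of a ≠ 0, a combination with coefficients m and n then keeps
exactly one chosen term. -/
theorem exists_coprime_selecting (a : ℕ) (P Q : ℕ → Prop)
    (h : ∀ p, p.Prime → p ∣ a → P p ∨ Q p) : ∃ m n : ℕ, Nat.Coprime m n ∧
      ∀ p, p.Prime → p ∣ a → a ≠ 0 →
        (P p ∧ ¬ p ∣ m ∧ p ∣ n) ∨ (Q p ∧ p ∣ m ∧ ¬ p ∣ n) := by
  classical
  have hdvd : ∀ (s : Finset ℕ) (p : ℕ), p.Prime → (∀ q ∈ s, q.Prime) → p ∣ ∏ q ∈ s, q → p ∈ s := by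
    intro s p hp hs hd
    obtain ⟨q, hq, hpq⟩ := (Prime.dvd_finsetProd_iff hp.prime _).1 hd
    rwa [(Nat.prime_dvd_prime_iff_eq hp (hs q hq)).1 hpq]
  refine ⟨∏ q ∈ a.primeFactors with ¬ P q, q, ∏ q ∈ a.primeFactors with P q, q, ?_, ?_⟩
  · refine Nat.Coprime.prod_left fun q hq => Nat.Coprime.prod_right fun r hr => ?_
    rw [Finset.mem_filter, Nat.mem_primeFactors] at hq hr
    refine (Nat.coprime_primes hq.1.1 hr.1.1).2 ?_
    rintro rfl
    exact hq.2 hr.2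
  · intro p hp hpa ha
    have hpf : p ∈ a.primeFactors := Nat.mem_primeFactors.2 ⟨hp, hpa, ha⟩
    by_cases hP : P p
    · refine Or.inl ⟨hP, fun hd => ?_, Finset.dvd_prod_of_mem _ (Finset.mem_filter.2 ⟨hpf, hP⟩)⟩
      exact (Finset.mem_filter.1 (hdvd _ p hp (fun q hq =>
        Nat.prime_of_mem_primeFactors (Finset.mem_filter.1 hq).1) hd)).2 hP
    · refine Or.inr ⟨(h p hp hpa).resolve_left hP,
        Finset.dvd_prod_of_mem _ (Finset.mem_filter.2 ⟨hpf, hP⟩), fun hd => ?_⟩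
      exact hP (Finset.mem_filter.1 (hdvd _ p hp (fun q hq =>
        Nat.prime_of_mem_primeFactors (Finset.mem_filter.1 hq).1) hd)).2

theorem primitive_of_forall_prime {v : Fin 5 → ℤ}
    (h : ∀ p : ℕ, p.Prime → ¬ ∀ i, (p : ℤ) ∣ v i) : Primitive v := by
  intro k hk
  by_contra hu
  have h1 : k.natAbs ≠ 1 := fun h1 => hu (Int.isUnit_iff_natAbs_eq.2 h1)
  obtain ⟨p, hp, hpk⟩ := Nat.exists_prime_and_dvd h1
  exact h p hp fun i => (Int.natCast_dvd.2 hpk).trans (hk i)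

/-- Only primes dividing the multiplier need a hypothesis. For any other prime, Mᵀ S M = a² S
recovers the outer coordinates of v from M v. -/
theorem primitive_mulVec {a : ℕ} {M : Matrix (Fin 5) (Fin 5) ℤ}
    (hM : Mᵀ * gram (N : ℤ) * M = (a : ℤ) ^ 2 • gram (N : ℤ)) {v : Fin 5 → ℤ}
    (hv : ∀ k : ℤ, k ∣ v 0 → k ∣ v 1 → k ∣ v 3 → k ∣ v 4 → IsUnit k)
    (h : ∀ p : ℕ, p.Prime → p ∣ a → ¬ ∀ i, (p : ℤ) ∣ (M *ᵥ v) i) : Primitive (M *ᵥ v) := by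
  refine primitive_of_forall_prime fun p hp hd => ?_
  have hp' : Prime (p : ℤ) := Nat.prime_iff_prime_int.1 hp
  by_cases hpa : p ∣ a
  · exact h p hp hpa hd
  have h1 : ∀ i, (p : ℤ) ∣ (a : ℤ) ^ 2 * (gram (N : ℤ) *ᵥ v) i := by
    intro i
    have e : (Mᵀ * gram (N : ℤ)) *ᵥ (M *ᵥ v) = (a : ℤ) ^ 2 • (gram (N : ℤ) *ᵥ v) := by
      rw [mulVec_mulVec, hM, smul_mulVec]
    have := dvd_mulVec hd (Mᵀ * gram (N : ℤ)) i
    rwa [e, Pi.smul_apply, smul_eq_mul] at this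
  have h2 : ∀ i, (p : ℤ) ∣ (gram (N : ℤ) *ᵥ v) i := fun i =>
    (hp'.dvd_or_dvd (h1 i)).resolve_left fun h3 =>
      hpa (Int.natCast_dvd_natCast.1 (hp'.dvd_of_dvd_pow h3))
  have e0 : (gram (N : ℤ) *ᵥ v) 0 = v 4 := by
    simp [gram, mulVec, dotProduct, Fin.sum_univ_succ]
  have e1 : (gram (N : ℤ) *ᵥ v) 1 = v 3 := by
    simp [gram, mulVec, dotProduct, Fin.sum_univ_succ]
  have e3 : (gram (N : ℤ) *ᵥ v) 3 = v 1 := by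
    simp [gram, mulVec, dotProduct, Fin.sum_univ_succ]
  have e4 : (gram (N : ℤ) *ᵥ v) 4 = v 0 := by
    simp [gram, mulVec, dotProduct, Fin.sum_univ_succ]
  exact hp'.not_isUnit (hv p (e4 ▸ h2 4) (e3 ▸ h2 3) (e1 ▸ h2 1) (e0 ▸ h2 0))

theorem isUnit_of_dvd_coprime {k m n : ℤ} (h : IsCoprime m n) (hm : k ∣ m) (hn : k ∣ n) :
    IsUnit k := h.isUnit_of_dvd' hm hn

/-- A similitude that is nonzero modulo all primes dividing its multiplier maps some primitive
isotropic vector to a primitive vector. -/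
theorem exists_primitive_mulVec (hN : Squarefree N) {a : ℕ} (ha : a ≠ 0)
    {M : Matrix (Fin 5) (Fin 5) ℤ} (hM : Mᵀ * gram (N : ℤ) * M = (a : ℤ) ^ 2 • gram (N : ℤ))
    (hprim : ∀ p : ℕ, p.Prime → p ∣ a → ¬ ∀ i j, (p : ℤ) ∣ M i j) :
    ∃ v, Primitive v ∧ quad (N : ℤ) v = 0 ∧ Primitive (M *ᵥ v) := by
  have ha' : (a : ℤ) ≠ 0 := Int.natCast_ne_zero.2 ha
  -- The vectors (mr, ms, 0, -nr, ns) are isotropic for all parameters. The pair (m, n) is chosen so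
  -- that, modulo each prime divisor of a, the image is not identically 0 as a linear form in (r,
  -- s); then (r, s) is chosen so that the image itself is nonzero.
  obtain ⟨m, n, hmn, h1⟩ := exists_coprime_selecting a
    (fun p => ¬ ((∀ i, (p : ℤ) ∣ M i 0) ∧ ∀ i, (p : ℤ) ∣ M i 1))
    (fun p => ¬ ((∀ i, (p : ℤ) ∣ M i 3) ∧ ∀ i, (p : ℤ) ∣ M i 4)) (by
      intro p hp hpa
      by_contra! hc
      refine hprim p hp hpa fun i j => ?_
      fin_cases j
      · exact hc.1.1 i
      · exact hc.1.2 i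
      · exact dvd_mid_row hN ha' (Nat.prime_iff_prime_int.1 hp) (Int.natCast_dvd_natCast.2 hpa) hM
          (hc.1.1 i) (hc.1.2 i) (hc.2.1 i) (hc.2.2 i)
      · exact hc.2.1 i
      · exact hc.2.2 i)
  obtain ⟨r, s, hrs, h2⟩ := exists_coprime_selecting a
    (fun p => ¬ ∀ i, (p : ℤ) ∣ m * M i 0 - n * M i 3)
    (fun p => ¬ ∀ i, (p : ℤ) ∣ m * M i 1 + n * M i 4) (by
      intro p hp hpa
      have hp' : Prime (p : ℤ) := Nat.prime_iff_prime_int.1 hp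
      by_contra! hc
      rcases h1 p hp hpa ha with ⟨hP, hm, hn⟩ | ⟨hQ, hm, hn⟩
      · have hm' : ¬ (p : ℤ) ∣ m := fun h => hm (Int.natCast_dvd_natCast.1 h)
        have hn' : (p : ℤ) ∣ n := Int.natCast_dvd_natCast.2 hn
        refine hP ⟨fun i => ?_, fun i => ?_⟩
        · exact (hp'.dvd_or_dvd ((dvd_sub_left (hn'.mul_right _)).1 (hc.1 i))).resolve_left hm'
        · exact (hp'.dvd_or_dvd ((dvd_add_left (hn'.mul_right _)).1 (hc.2 i))).resolve_left hm'
      · have hn' : ¬ (p : ℤ) ∣ n := fun h => hn (Int.natCast_dvd_natCast.1 h)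
        have hm' : (p : ℤ) ∣ m := Int.natCast_dvd_natCast.2 hm
        refine hQ ⟨fun i => ?_, fun i => ?_⟩
        · exact (hp'.dvd_or_dvd ((dvd_sub_right (hm'.mul_right _)).1 (hc.1 i))).resolve_left hn'
        · exact (hp'.dvd_or_dvd ((dvd_add_right (hm'.mul_right _)).1 (hc.2 i))).resolve_left hn')
  have hmn' : IsCoprime (m : ℤ) n := Nat.isCoprime_iff_coprime.2 hmn
  have hrs' : IsCoprime (r : ℤ) s := Nat.isCoprime_iff_coprime.2 hrs
  have hv : ∀ k : ℤ, k ∣ (m : ℤ) * r → k ∣ (m : ℤ) * s → k ∣ -((n : ℤ) * r) → k ∣ (n : ℤ) * s →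
      IsUnit k := by
    obtain ⟨x, y, hxy⟩ := hrs'
    intro k k1 k2 k3 k4
    refine isUnit_of_dvd_coprime hmn' ?_ ?_
    · have : (m : ℤ) = x * (m * r) + y * (m * s) := by linear_combination -(m : ℤ) * hxy
      rw [this]
      exact dvd_add (k1.mul_left _) (k2.mul_left _)
    · have : (n : ℤ) = x * (n * r) + y * (n * s) := by linear_combination -(n : ℤ) * hxy
      rw [this]
      exact dvd_add (((dvd_neg).1 k3).mul_left _) (k4.mul_left _)
  have hMv : ∀ i, (M *ᵥ ![(m : ℤ) * r, (m : ℤ) * s, 0, -((n : ℤ) * r), (n : ℤ) * s]) i =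
      r * (m * M i 0 - n * M i 3) + s * (m * M i 1 + n * M i 4) := by
    intro i
    rw [mulVec, dotProduct, Fin.sum_univ_five]
    simp
    ring
  refine ⟨![(m : ℤ) * r, (m : ℤ) * s, 0, -((n : ℤ) * r), (n : ℤ) * s],
    fun k hk => hv k (hk 0) (hk 1) (hk 3) (hk 4), ?_,
    primitive_mulVec hM (fun k h0 h1 h3 h4 => hv k h0 h1 h3 h4) ?_⟩
  · simp [quad]; ring
  · intro p hp hpa hd
    have hp' : Prime (p : ℤ) := Nat.prime_iff_prime_int.1 hp
    simp only [hMv] at hd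
    rcases h2 p hp hpa ha with ⟨hP, hm, hn⟩ | ⟨hQ, hm, hn⟩
    · have hm' : ¬ (p : ℤ) ∣ r := fun h => hm (Int.natCast_dvd_natCast.1 h)
      have hn' : (p : ℤ) ∣ s := Int.natCast_dvd_natCast.2 hn
      exact hP fun i =>
        (hp'.dvd_or_dvd ((dvd_add_left (hn'.mul_right _)).1 (hd i))).resolve_left hm'
    · have hn' : ¬ (p : ℤ) ∣ s := fun h => hn (Int.natCast_dvd_natCast.1 h)
      have hm' : (p : ℤ) ∣ r := Int.natCast_dvd_natCast.2 hm
      exact hQ fun i =>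
        (hp'.dvd_or_dvd ((dvd_add_right (hm'.mul_right _)).1 (hd i))).resolve_left hn'

/-- The ternary analogue of `exists_primitive_mulVec`. -/
theorem exists_atkinLehner_mulVec (hN : Squarefree N) {b : ℕ} (hb : b ≠ 0)
    {M : Matrix (Fin 5) (Fin 5) ℤ} (hM : Mᵀ * gram (N : ℤ) * M = (b : ℤ) ^ 2 • gram (N : ℤ))
    (hprim : ∀ p : ℕ, p.Prime → p ∣ b → ¬ ∀ i j, (p : ℤ) ∣ M i j)
    (h0 : ∀ i, (b : ℤ) ∣ M i 0) (h4 : ∀ i, (b : ℤ) ∣ M i 4) :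
    ∃ d d' α β γ δ : ℤ, 0 < d ∧ d * d' = N ∧ d * α * δ - d' * β * γ = 1 ∧
      Primitive (M *ᵥ ![0, d * α ^ 2, α * γ, d' * γ ^ 2, 0]) := by
  have hb' : (b : ℤ) ≠ 0 := Int.natCast_ne_zero.2 hb
  obtain ⟨m, n, hmn, h1⟩ := exists_coprime_selecting b
    (fun p => ¬ ∀ i, (p : ℤ) ∣ M i 1) (fun p => ¬ ∀ i, (p : ℤ) ∣ M i 3) (by
      intro p hp hpb
      by_contra! hc
      have hpb' : (p : ℤ) ∣ b := Int.natCast_dvd_natCast.2 hpb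
      refine hprim p hp hpb fun i j => ?_
      fin_cases j
      · exact hpb'.trans (h0 i)
      · exact hc.1 i
      · exact dvd_mid_row hN hb' (Nat.prime_iff_prime_int.1 hp) hpb' hM
          (hpb'.trans (h0 i)) (hc.1 i) (hc.2 i) (hpb'.trans (h4 i))
      · exact hc.2 i
      · exact hpb'.trans (h4 i))
  -- With d = gcd(N, m) and N squarefree, dm and d'n are coprime. So (d m², mn, d' n²) is a
  -- primitive isotropic vector, and Bézout completes it to an Atkin–Lehner matrix.
  obtain ⟨d', hd'⟩ : Nat.gcd N m ∣ N := Nat.gcd_dvd_left ..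
  obtain ⟨m', hm'⟩ : Nat.gcd N m ∣ m := Nat.gcd_dvd_right ..
  have hd : 0 < Nat.gcd N m := Nat.gcd_pos_of_pos_left _ (Nat.pos_of_ne_zero hN.ne_zero)
  have hgcd : ∀ k, k ∣ N → k ∣ m → k ∣ Nat.gcd N m := fun k => Nat.dvd_gcd
  generalize Nat.gcd N m = d at hd' hm' hd hgcd
  have hdd : Nat.Coprime d d' := by
    rw [hd'] at hN
    exact Nat.coprime_of_squarefree_mul hN
  have hmd' : Nat.Coprime m d' := by
    refine Nat.Coprime.symm (Nat.coprime_of_dvd fun p hp hpd hpm => ?_)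
    have h2 : p ∣ d := hgcd p (hd' ▸ hpd.mul_left d) hpm
    exact hp.one_lt.ne' (Nat.dvd_one.1 (hdd ▸ Nat.dvd_gcd h2 hpd))
  have hdn : Nat.Coprime d n := Nat.Coprime.coprime_dvd_left ⟨m', hm'⟩ hmn
  have hcop : Nat.Coprime (d * m) (d' * n) :=
    Nat.Coprime.mul_left (Nat.Coprime.mul_right hdd hdn) (Nat.Coprime.mul_right hmd' hmn)
  obtain ⟨u, v, huv⟩ := Nat.isCoprime_iff_coprime.2 hcop
  push_cast at huv
  refine ⟨d, d', m, -v, n, u, Int.natCast_pos.2 hd, by exact_mod_cast hd'.symm,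
    by linear_combination huv, primitive_mulVec hM ?_ ?_⟩
  · intro k _ k1 k3 _
    have : IsCoprime ((d : ℤ) * m * m) (d' * n * n) := by
      have c0 : IsCoprime ((d : ℤ) * m) (d' * n) := ⟨u, v, huv⟩
      have c1 := c0.mul_left (c0.of_isCoprime_of_dvd_left (Dvd.intro_left _ rfl) :
        IsCoprime (m : ℤ) (d' * n))
      exact c1.mul_right (c1.of_isCoprime_of_dvd_right (Dvd.intro_left _ rfl))
    refine isUnit_of_dvd_coprime this ?_ ?_
    · convert k1 using 1
      simp; ring
    · convert k3 using 1
      simp; ring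
  · intro p hp hpb hpd
    have hp' : Prime (p : ℤ) := Nat.prime_iff_prime_int.1 hp
    have hMv : ∀ i, (M *ᵥ ![0, (d : ℤ) * m ^ 2, m * n, d' * n ^ 2, 0]) i =
        d * m ^ 2 * M i 1 + m * n * M i 2 + d' * n ^ 2 * M i 3 := by
      intro i
      rw [mulVec, dotProduct, Fin.sum_univ_five]
      simp
      ring
    simp only [hMv] at hpd
    have hnd : ∀ x y : ℕ, ¬ p ∣ x → ¬ p ∣ y → ¬ (p : ℤ) ∣ x * y ^ 2 := by
      intro x y hx hy h
      rcases hp'.dvd_or_dvd h with h | h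
      · exact hx (Int.natCast_dvd_natCast.1 h)
      · exact hy (Int.natCast_dvd_natCast.1 (hp'.dvd_of_dvd_pow h))
    -- Modulo p only one of the terms d m² Mᵢ₁ and d' n² Mᵢ₃ survives, with a coefficient prime to
    -- p.
    rcases h1 p hp hpb hb with ⟨hP, hm, hn⟩ | ⟨hQ, hm, hn⟩
    · have hpn : (p : ℤ) ∣ n := Int.natCast_dvd_natCast.2 hn
      have hpd' : ¬ p ∣ d := fun h => hm (hm' ▸ h.mul_right m')
      refine hP fun i => ?_
      have e := hpd i
      rw [add_assoc] at e
      have e2 := (dvd_add_left (dvd_add ((hpn.mul_left _).mul_right _)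
        (((hpn.pow two_ne_zero).mul_left _).mul_right _))).1 e
      exact (hp'.dvd_or_dvd e2).resolve_left (hnd d m hpd' hm)
    · have hpm : (p : ℤ) ∣ m := Int.natCast_dvd_natCast.2 hm
      have hpd' : ¬ p ∣ d' := fun h =>
        hp.one_lt.ne' (Nat.dvd_one.1 (hmd' ▸ Nat.dvd_gcd hm h))
      refine hQ fun i => ?_
      have e2 := (dvd_add_right (dvd_add (((hpm.pow two_ne_zero).mul_left _).mul_right _)
        ((hpm.mul_right _).mul_right _))).1 (hpd i)
      exact (hp'.dvd_or_dvd e2).resolve_left (hnd d' n hpd' hn)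

end Similitudes

/-! ### Reduction to diagonal form -/

section Classification

/-- An integral matrix viewed as a rational matrix. -/
abbrev toQ (A : Matrix (Fin 5) (Fin 5) ℤ) : Matrix (Fin 5) (Fin 5) ℚ := A.map (Int.cast : ℤ → ℚ)

theorem toQ_mul (A B : Matrix (Fin 5) (Fin 5) ℤ) : toQ (A * B) = toQ A * toQ B :=
  Matrix.map_mul (f := Int.castRingHom ℚ)

theorem toQ_one : toQ 1 = 1 := Matrix.map_one _ Int.cast_zero Int.cast_one

theorem toQ_mulVec (A : Matrix (Fin 5) (Fin 5) ℤ) (v : Fin 5 → ℤ) :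
    (fun i => ((A *ᵥ v) i : ℚ)) = toQ A *ᵥ fun i => (v i : ℚ) := by
  ext i
  simp [mulVec, dotProduct]

theorem toQ_injective : Function.Injective toQ := Matrix.map_injective Int.cast_injective

theorem toQ_gram (n : ℤ) : toQ (gram n) = gram (n : ℚ) := gram_map (Int.castRingHom ℚ) n

variable {N : ℕ}

theorem gram_toQ {A : Matrix (Fin 5) (Fin 5) ℤ} {c : ℤ}
    (h : Aᵀ * gram (N : ℤ) * A = c • gram (N : ℤ)) :
    (toQ A)ᵀ * gram (N : ℚ) * toQ A = (c : ℚ) • gram (N : ℚ) := by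
  have e : gram (N : ℚ) = toQ (gram (N : ℤ)) := by rw [toQ_gram, Int.cast_natCast]
  rw [e, show (toQ A)ᵀ = toQ Aᵀ from rfl, ← toQ_mul, ← toQ_mul, h]
  ext i j
  change ((c * gram (N : ℤ) i j : ℤ) : ℚ) = c * ((gram (N : ℤ) i j : ℤ) : ℚ)
  push_cast
  rfl

theorem gram_of_toQ {A : Matrix (Fin 5) (Fin 5) ℤ} {c : ℤ}
    (h : (toQ A)ᵀ * gram (N : ℚ) * toQ A = (c : ℚ) • gram (N : ℚ)) :
    Aᵀ * gram (N : ℤ) * A = c • gram (N : ℤ) := by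
  have e : gram (N : ℚ) = toQ (gram (N : ℤ)) := by rw [toQ_gram, Int.cast_natCast]
  rw [e, show (toQ A)ᵀ = toQ Aᵀ from rfl, ← toQ_mul, ← toQ_mul] at h
  apply toQ_injective
  rw [h]
  ext i j
  change c * ((gram (N : ℤ) i j : ℤ) : ℚ) = ((c * gram (N : ℤ) i j : ℤ) : ℚ)
  push_cast
  rfl

theorem IsGamma.gram_toQ {A : Matrix (Fin 5) (Fin 5) ℤ} (hA : IsGamma N A) :
    (toQ A)ᵀ * gram (N : ℚ) * toQ A = gram (N : ℚ) := by
  have := HeckeSO.gram_toQ (c := 1) (by rw [one_smul]; exact hA.gram_eq)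
  simpa using this

theorem IsGamma.det_toQ {A : Matrix (Fin 5) (Fin 5) ℤ} (hA : IsGamma N A) : (toQ A).det = 1 := by
  obtain ⟨a, -, rfl⟩ := hA
  have h : ((a.1.det : ℤ) : ℚ) = (toQ a.1).det := RingHom.map_det (Int.castRingHom ℚ) a.1
  rw [← h, a.2, Int.cast_one]

/-- Minimality of the denominator: a prime dividing it and every entry of the cleared matrix could
be cancelled. -/
theorem exists_matDen_smul_eq (g : Matrix (Fin 5) (Fin 5) ℚ) :
    ∃ M, (matDen g : ℚ) • g = toQ M ∧
      ∀ p : ℕ, p.Prime → p ∣ matDen g → ¬ ∀ i j, (p : ℤ) ∣ M i j := by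
  have h := fun i j => matDen_mul_mem g i j
  choose M hM using h
  have hM' : ∀ i j, (M i j : ℚ) = matDen g * g i j := hM
  refine ⟨Matrix.of M, ?_, ?_⟩
  · ext i j
    exact (hM' i j).symm
  · rintro p hp ⟨c, hc⟩ hdvd
    have hc0 : 0 < c := by
      refine Nat.pos_of_ne_zero fun h0 => (matDen_pos g).ne' ?_
      rw [hc, h0, mul_zero]
    have h2 : matDen g ∣ c := by
      rw [matDen_dvd_iff]
      intro i j
      obtain ⟨z, hz⟩ := hdvd i j
      refine ⟨z, ?_⟩
      have hz' : (M i j : ℚ) = p * z := by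
        have : M i j = p * z := hz
        rw [this]; push_cast; rfl
      rw [hM' i j, hc] at hz'
      have hp0 : (p : ℚ) ≠ 0 := Nat.cast_ne_zero.2 hp.ne_zero
      change (z : ℚ) = _
      refine mul_left_cancel₀ hp0 ?_
      rw [← hz']; push_cast; ring
    have h3 := Nat.le_of_dvd hc0 h2
    rw [hc] at h3
    have := hp.two_le
    nlinarith

/-- A primitive isotropic vector with primitive image can be moved to the first basis vector on both
sides. This fixes the first column, and unipotent column operations then clear the first row. -/
theorem exists_first_basis (hN : Squarefree N) {a : ℕ} (ha : a ≠ 0)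
    {M : Matrix (Fin 5) (Fin 5) ℤ} (hM : Mᵀ * gram (N : ℤ) * M = (a : ℤ) ^ 2 • gram (N : ℤ))
    (hprim : ∀ p : ℕ, p.Prime → p ∣ a → ¬ ∀ i j, (p : ℤ) ∣ M i j) :
    ∃ A B, IsGamma N A ∧ IsGamma N B ∧ (∀ i, (A * M * B) i 0 = (1 : Matrix (Fin 5) (Fin 5) ℤ) i 0) ∧
      ∀ j, (A * M * B) 0 j = (1 : Matrix (Fin 5) (Fin 5) ℤ) 0 j := by
  obtain ⟨v, hv, hqv, hMv⟩ := exists_primitive_mulVec hN ha hM hprim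
  have hqM : quad (N : ℤ) (M *ᵥ v) = 0 := by
    have := two_mul_quad_mulVec hM v
    rw [hqv] at this
    linarith
  -- Here `orbitRel_basis` applies both to the image of v and to v itself.
  obtain ⟨A, hA, hA'⟩ := orbitRel_basis hN hMv hqM
  obtain ⟨B, hB, hB'⟩ := (orbitRel_basis hN hv hqv).symm
  set M₁ := A * M * B with hM₁
  have hM₁s : M₁ᵀ * gram (N : ℤ) * M₁ = (a : ℤ) ^ 2 • gram (N : ℤ) :=
    gram_mul_mul hA.gram_eq hM hB.gram_eq
  have hcol : ∀ i, M₁ i 0 = (1 : Matrix (Fin 5) (Fin 5) ℤ) i 0 := by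
    intro i
    have h1 : M₁ *ᵥ ![1, 0, 0, 0, 0] = ![1, 0, 0, 0, 0] := by
      rw [hM₁, ← mulVec_mulVec, hB', ← mulVec_mulVec, hA']
    have h2 := congrFun h1 i
    rw [mulVec, dotProduct, Fin.sum_univ_five] at h2
    simp at h2
    rw [h2]
    fin_cases i <;> simp [one_apply]
  obtain ⟨s, hs, hs'⟩ := exists_mid_eq hN (Int.natCast_ne_zero.2 ha) hM₁s
    (i := 0) (by decide)
  have h00 : M₁ 0 0 = 1 := hcol 0
  rw [h00, one_mul] at hs'
  -- The last factor needs the middle entry to be 2N s. Clearing it also clears the final entry,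
  -- since the row is isotropic for the dual form.
  set U := unipA (-M₁ 0 1) * unipB (-M₁ 0 3) * unipC (N : ℤ) (-s) with hU
  refine ⟨A, B * U, hA, hB.mul (((isGamma_unipA _).mul (isGamma_unipB _)).mul (isGamma_unipC _)),
    ?_, ?_⟩
  · intro i
    rw [← Matrix.mul_assoc, ← hM₁, ← hcol i]
    simp [hU, Matrix.mul_apply, Fin.sum_univ_succ, unipA, unipB, unipC]
  · intro j
    have e : A * M * (B * U) = M₁ * unipA (-M₁ 0 1) * unipB (-M₁ 0 3) * unipC (N : ℤ) (-s) := by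
      simp only [hM₁, hU, Matrix.mul_assoc]
    rw [e]
    have e1 : ∀ k, (M₁ * unipA (-M₁ 0 1)) 0 k =
        (![1, 0, M₁ 0 2, M₁ 0 3, M₁ 0 4 + M₁ 0 1 * M₁ 0 3] : Fin 5 → ℤ) k := by
      intro k
      rw [Matrix.mul_apply, Fin.sum_univ_five]
      fin_cases k <;> simp [unipA, h00] <;> ring
    have e2 : ∀ k, (M₁ * unipA (-M₁ 0 1) * unipB (-M₁ 0 3)) 0 k =
        (![1, 0, 2 * N * s, 0, N * s ^ 2] : Fin 5 → ℤ) k := by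
      intro k
      rw [Matrix.mul_apply, Fin.sum_univ_five]
      simp only [e1]
      fin_cases k <;> simp [unipB, hs, hs']
    rw [Matrix.mul_apply, Fin.sum_univ_five]
    simp only [e2]
    fin_cases j <;> simp [unipC, one_apply]
    ring

/-- The torus element `diag(1/c, 1, 1, 1, c)`. -/
def torusMat (c : ℚ) : Matrix (Fin 5) (Fin 5) ℚ := diagonal ![c⁻¹, 1, 1, 1, c]

theorem torusMat_commute_atkinLehner (c : ℚ) (d d' α β γ δ : ℤ) :
    toQ (atkinLehner d d' α β γ δ) * torusMat c = torusMat c * toQ (atkinLehner d d' α β γ δ) := by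
  ext i j
  rw [torusMat, mul_diagonal, diagonal_mul]
  fin_cases i <;> fin_cases j <;> simp [atkinLehner]

theorem commute_of_inv {A B : Matrix (Fin 5) (Fin 5) ℤ} {D : Matrix (Fin 5) (Fin 5) ℚ}
    (hAB : A * B = 1) (hBA : B * A = 1) (h : toQ A * D = D * toQ A) : toQ B * D = D * toQ B := by
  calc toQ B * D = toQ B * D * (toQ A * toQ B) := by rw [← toQ_mul, hAB, toQ_one, Matrix.mul_one]
    _ = toQ B * (D * toQ A) * toQ B := by simp only [Matrix.mul_assoc]
    _ = (toQ B * toQ A) * D * toQ B := by rw [← h]; simp only [Matrix.mul_assoc]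
    _ = D * toQ B := by rw [← toQ_mul, hBA, toQ_one, Matrix.one_mul]

/-- The Gram relations make h upper triangular, with h₂₃ as its only free unipotent parameter. Since
N h₂₃² = h₁₃ / c is integral, so is h₂₃, and an integral unipotent element removes it. -/
theorem exists_diagonal_of_flag (hN : Squarefree N) {h : Matrix (Fin 5) (Fin 5) ℚ}
    (hg : hᵀ * gram (N : ℚ) * h = gram (N : ℚ)) (hdet : h.det = 1) {c : ℚ} (hc : c ≠ 0)
    (h0 : ∀ i, h i 0 = (1 : Matrix (Fin 5) (Fin 5) ℚ) i 0)
    (h4 : ∀ i, h i 4 = (1 : Matrix (Fin 5) (Fin 5) ℚ) i 4)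
    (h1 : ∀ i, h i 1 = c * (1 : Matrix (Fin 5) (Fin 5) ℚ) i 1)
    (hint : h 1 3 * c⁻¹ ∈ intSubring) :
    ∃ t : ℤ, h * toQ (atkinLehner 1 (N : ℤ) 1 t 0 1) = diagonal ![1, c, 1, c⁻¹, 1] := by
  have ent : ∀ j k, h 0 j * h 4 k + h 1 j * h 3 k - 2 * N * h 2 j * h 2 k + h 3 j * h 1 k +
      h 4 j * h 0 k = gram (N : ℚ) j k := fun j k => by rw [← gram_entry, hg]
  have a00 : h 0 0 = 1 := h0 0
  have a10 : h 1 0 = 0 := h0 1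
  have a20 : h 2 0 = 0 := h0 2
  have a30 : h 3 0 = 0 := h0 3
  have a40 : h 4 0 = 0 := h0 4
  have a04 : h 0 4 = 0 := h4 0
  have a14 : h 1 4 = 0 := h4 1
  have a24 : h 2 4 = 0 := h4 2
  have a34 : h 3 4 = 0 := h4 3
  have a44 : h 4 4 = 1 := h4 4
  have a01 : h 0 1 = 0 := by rw [h1]; simp
  have a11 : h 1 1 = c := by rw [h1]; simp
  have a21 : h 2 1 = 0 := by rw [h1]; simp
  have a31 : h 3 1 = 0 := by rw [h1]; simp
  have a41 : h 4 1 = 0 := by rw [h1]; simp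
  have a42 : h 4 2 = 0 := by simpa [a00, a10, a20, a30, a40, gram] using ent 0 2
  have a43 : h 4 3 = 0 := by simpa [a00, a10, a20, a30, a40, gram] using ent 0 3
  have a02 : h 0 2 = 0 := by simpa [a04, a14, a24, a34, a44, gram] using ent 4 2
  have a03 : h 0 3 = 0 := by simpa [a04, a14, a24, a34, a44, gram] using ent 4 3
  have a32 : h 3 2 = 0 := by simpa [a01, a11, a21, a31, a41, gram, hc] using ent 1 2
  have a33 : h 3 3 = c⁻¹ := by
    have : c * h 3 3 = 1 := by simpa [a01, a11, a21, a31, a41, gram] using ent 1 3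
    exact eq_inv_of_mul_eq_one_right this
  -- The Gram relation alone gives ±1; the determinant fixes the sign.
  have a22 : h 2 2 = 1 := by
    have htri : h.det = ∏ i, h i i := by
      refine det_of_isUpperTriangular fun i j hij => ?_
      fin_cases i <;> fin_cases j <;> first | exact absurd hij (by decide) | assumption
    rw [hdet, Fin.prod_univ_five, a00, a11, a33, a44] at htri
    field_simp at htri
    exact htri.symm
  have e23 : h 1 2 * c⁻¹ = 2 * N * h 2 3 := by
    have := ent 2 3
    rw [a02, a32, a33, a22, a42] at this
    have g23 : gram (N : ℚ) 2 3 = 0 := rfl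
    rw [g23] at this
    linarith
  have e33 : h 1 3 * c⁻¹ = N * h 2 3 ^ 2 := by
    have := ent 3 3
    rw [a03, a33, a43] at this
    have g33 : gram (N : ℚ) 3 3 = 0 := rfl
    rw [g33] at this
    linarith
  obtain ⟨t, ht⟩ := mem_intSubring_of_mul_sq (Int.squarefree_natCast.2 hN) (q := h 2 3) (by
    rw [e33] at hint
    simpa using hint)
  have ht' : (t : ℚ) = h 2 3 := ht
  have a12 : h 1 2 = 2 * N * t * c := by
    rw [ht', ← e23]; field_simp
  have a13 : h 1 3 = N * t ^ 2 * c := by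
    rw [ht', ← e33]; field_simp
  refine ⟨-t, ?_⟩
  ext i j
  rw [Matrix.mul_apply, Fin.sum_univ_five]
  fin_cases i <;> fin_cases j <;>
    simp [atkinLehner, a00, a01, a02, a03, a04, a10, a11, a12, a13, a14, a20, a21, a22, ← ht', a24,
      a30, a31, a32, a33, a34, a40, a41, a42, a43, a44] <;> ring

theorem mulVec_single_col {R : Type*} [CommRing R] (A : Matrix (Fin 5) (Fin 5) R) (j i : Fin 5) :
    (A *ᵥ Pi.single j 1) i = A i j := by
  rw [mulVec_single_one]; rfl

/-- The classification of double cosets for the ternary part of the form. -/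
theorem exists_ternary_diagonal (hN : Squarefree N) {h : Matrix (Fin 5) (Fin 5) ℚ}
    (hg : hᵀ * gram (N : ℚ) * h = gram (N : ℚ)) (hdet : h.det = 1)
    (h0 : h *ᵥ Pi.single 0 1 = Pi.single 0 1) (h4 : h *ᵥ Pi.single 4 1 = Pi.single 4 1) :
    ∃ A B, IsGamma N A ∧ IsGamma N B ∧ (∀ c, toQ A * torusMat c = torusMat c * toQ A) ∧
      (∀ c, toQ B * torusMat c = torusMat c * toQ B) ∧ ∃ ε : ℤ, ε * ε = 1 ∧
      toQ A * h * toQ B = diagonal ![1, ε * (matDen h : ℚ)⁻¹, 1, ε * (matDen h : ℚ), 1] := by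
  set b := matDen h with hb
  have hb0 : b ≠ 0 := (matDen_pos h).ne'
  have hbQ : (b : ℚ) ≠ 0 := Nat.cast_ne_zero.2 hb0
  obtain ⟨M, hM, hprim⟩ := exists_matDen_smul_eq h
  rw [← hb] at hM hprim
  have hMs : Mᵀ * gram (N : ℤ) * M = (b : ℤ) ^ 2 • gram (N : ℤ) := by
    refine gram_of_toQ ?_
    rw [← hM, transpose_smul, Matrix.smul_mul, Matrix.smul_mul, Matrix.mul_smul, smul_smul, hg]
    push_cast
    rw [pow_two]
  have hMe : ∀ i j, (M i j : ℚ) = b * h i j := fun i j =>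
    (congrFun (congrFun hM i) j).symm
  have c0 : ∀ i, h i 0 = (1 : Matrix (Fin 5) (Fin 5) ℚ) i 0 := fun i => by
    rw [← mulVec_single_col h, h0, one_apply, Pi.single_apply]
  have c4 : ∀ i, h i 4 = (1 : Matrix (Fin 5) (Fin 5) ℚ) i 4 := fun i => by
    rw [← mulVec_single_col h, h4, one_apply, Pi.single_apply]
  have ent : ∀ j k, h 0 j * h 4 k + h 1 j * h 3 k - 2 * N * h 2 j * h 2 k + h 3 j * h 1 k +
      h 4 j * h 0 k = gram (N : ℚ) j k := fun j k => by rw [← gram_entry, hg]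
  have r4 : ∀ k, h 4 k = gram (N : ℚ) 0 k := fun k => by
    rw [← ent 0 k]; simp [c0]
  have r0 : ∀ k, h 0 k = gram (N : ℚ) 4 k := fun k => by
    rw [← ent 4 k]; simp [c4]
  have hcol : ∀ j, (∀ i, h i j = (1 : Matrix (Fin 5) (Fin 5) ℚ) i j) → ∀ i, (b : ℤ) ∣ M i j := by
    intro j hj i
    by_cases hij : i = j
    · refine ⟨1, ?_⟩
      have := hMe i j
      rw [hj, hij, one_apply_eq] at this
      rw [hij]
      exact_mod_cast this
    · have := hMe i j
      rw [hj, one_apply_ne hij, mul_zero, Int.cast_eq_zero] at this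
      rw [this]
      exact dvd_zero _
  -- The matrix W sends e₁ to a primitive isotropic v in the ternary part whose image under M = b h
  -- is again primitive. A second Atkin–Lehner matrix V sends e₁ to ±M v, so V⁻¹ h W scales e₁ by
  -- ±1/b.
  obtain ⟨d, d', α, β, γ, δ, hd, hdd, hdet2, hprimv⟩ :=
    exists_atkinLehner_mulVec hN hb0 hMs hprim (hcol 0 c0) (hcol 4 c4)
  set W := atkinLehner d d' α β γ δ with hW
  have hWγ : IsGamma N W := isGamma_atkinLehner hd hdd hdet2
  set v : Fin 5 → ℤ := ![0, d * α ^ 2, α * γ, d' * γ ^ 2, 0] with hv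
  have hWv : W *ᵥ Pi.single 1 1 = v := by
    ext i
    rw [mulVec_single_col]
    fin_cases i <;> simp [hW, hv, atkinLehner]
  have hM0 : ∀ k, (M 0 k : ℚ) = b * gram (N : ℚ) 4 k := fun k => by rw [hMe, r0]
  have hM4 : ∀ k, (M 4 k : ℚ) = b * gram (N : ℚ) 0 k := fun k => by rw [hMe, r4]
  have hw0 : (M *ᵥ v) 0 = 0 := by
    have m1 : M 0 1 = 0 := by simpa [gram] using hM0 1
    have m2 : M 0 2 = 0 := by simpa [gram] using hM0 2
    have m3 : M 0 3 = 0 := by simpa [gram] using hM0 3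
    rw [mulVec, dotProduct, Fin.sum_univ_five, m1, m2, m3]
    simp [hv]
  have hw4 : (M *ᵥ v) 4 = 0 := by
    have m1 : M 4 1 = 0 := by simpa [gram] using hM4 1
    have m2 : M 4 2 = 0 := by simpa [gram] using hM4 2
    have m3 : M 4 3 = 0 := by simpa [gram] using hM4 3
    rw [mulVec, dotProduct, Fin.sum_univ_five, m1, m2, m3]
    simp [hv]
  have hqv : quad (N : ℤ) v = 0 := by
    rw [← hdd]; simp [quad, hv]; ring
  have hqw : quad (N : ℤ) (M *ᵥ v) = 0 := by
    have := two_mul_quad_mulVec hMs v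
    rw [hqv] at this
    linarith
  have hwvec : M *ᵥ v = ![0, (M *ᵥ v) 1, (M *ᵥ v) 2, (M *ᵥ v) 3, 0] := by
    conv_lhs => rw [← vec_eta (M *ᵥ v), hw0, hw4]
  rw [hwvec] at hprimv
  obtain ⟨e, e', α₁, β₁, γ₁, δ₁, ε, he, hee, hdet3, hε, hx, hz, hy⟩ :=
    exists_parametrization hN hprimv (by
      rw [quad, hw0, hw4] at hqw
      linarith)
  set V := atkinLehner e e' α₁ β₁ γ₁ δ₁ with hV
  have hVγ : IsGamma N V := isGamma_atkinLehner he hee hdet3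
  have hVv : V *ᵥ Pi.single 1 1 = ε • (M *ᵥ v) := by
    ext i
    rw [mulVec_single_col, hwvec]
    fin_cases i
    · simp [hV, atkinLehner]
    · simp [hV, atkinLehner, hx, ← mul_assoc, hε]
    · simp [hV, atkinLehner, hz, ← mul_assoc, hε]
    · simp [hV, atkinLehner, hy, ← mul_assoc, hε]
    · simp [hV, atkinLehner]
  obtain ⟨V', hV'γ, hVV', hV'V⟩ := hVγ.exists_inv
  have hMv : V' *ᵥ (M *ᵥ v) = ε • Pi.single 1 1 := by
    have h1 : M *ᵥ v = ε • (V *ᵥ Pi.single 1 1) := by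
      rw [hVv, smul_smul, hε, one_smul]
    rw [h1, mulVec_smul, mulVec_mulVec, hV'V, one_mulVec]
  set h₂ := toQ V' * h * toQ W with hh₂
  have hg₂ : h₂ᵀ * gram (N : ℚ) * h₂ = gram (N : ℚ) := by
    have := gram_mul_mul (c := 1) hV'γ.gram_toQ (by rw [one_smul]; exact hg) hWγ.gram_toQ
    rwa [one_smul] at this
  have hdet₂ : h₂.det = 1 := by
    rw [hh₂, det_mul, det_mul, hV'γ.det_toQ, hWγ.det_toQ, hdet]; norm_num
  have hbh₂ : (b : ℚ) • h₂ = toQ (V' * M * W) := by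
    rw [toQ_mul, toQ_mul, ← hM, hh₂]; simp
  have hh₂e : ∀ i j, h₂ i j = (b : ℚ)⁻¹ * ((V' * M * W) i j : ℤ) := fun i j => by
    have := congrFun (congrFun hbh₂ i) j
    change (b : ℚ) * h₂ i j = ((V' * M * W) i j : ℚ) at this
    rw [← this]; field_simp
  have hk1 : ∀ i, h₂ i 1 = (ε * (b : ℚ)⁻¹) * (1 : Matrix (Fin 5) (Fin 5) ℚ) i 1 := by
    intro i
    rw [hh₂e, ← mulVec_single_col (V' * M * W), ← mulVec_mulVec, hWv, ← mulVec_mulVec, hMv]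
    fin_cases i <;> simp [mul_comm, one_apply]
  have fix : ∀ k : Fin 5, (∀ c c' p q r s : ℤ, ∀ i, atkinLehner c c' p q r s i k =
      (1 : Matrix (Fin 5) (Fin 5) ℤ) i k) → (h *ᵥ Pi.single k 1 = Pi.single k 1) →
      ∀ i, h₂ i k = (1 : Matrix (Fin 5) (Fin 5) ℚ) i k := by
    intro k hk hhk i
    have single_cast : (fun i => (((Pi.single k 1 : Fin 5 → ℤ) i : ℤ) : ℚ)) = Pi.single k 1 := by
      ext i
      by_cases hik : i = k
      · subst hik; simp
      · simp [hik]
    have hWk : W *ᵥ Pi.single k 1 = Pi.single k 1 := by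
      ext i
      rw [mulVec_single_col, hW, hk, one_apply, Pi.single_apply]
    have hVk : V *ᵥ Pi.single k 1 = Pi.single k 1 := by
      ext i
      rw [mulVec_single_col, hV, hk, one_apply, Pi.single_apply]
    have hV'k : V' *ᵥ Pi.single k 1 = Pi.single k 1 := by
      conv_lhs => rw [← hVk]
      rw [mulVec_mulVec, hV'V, one_mulVec]
    have q1 := toQ_mulVec W (Pi.single k 1)
    have q2 := toQ_mulVec V' (Pi.single k 1)
    rw [hWk, single_cast] at q1
    rw [hV'k, single_cast] at q2
    rw [← mulVec_single_col h₂, hh₂, ← mulVec_mulVec, ← q1, ← mulVec_mulVec, hhk, ← q2,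
      one_apply, Pi.single_apply]
  have hk0 := fix 0 (by intro c c' p q r s i; fin_cases i <;> simp [atkinLehner, one_apply]) h0
  have hk4 := fix 4 (by intro c c' p q r s i; fin_cases i <;> simp [atkinLehner, one_apply]) h4
  have hεQ : (ε : ℚ) * ε = 1 := by exact_mod_cast hε
  have hε0 : (ε : ℚ) ≠ 0 := left_ne_zero_of_mul_eq_one hεQ
  have hεinv : (ε : ℚ)⁻¹ = ε := inv_eq_of_mul_eq_one_left hεQ
  -- With c = ε/b the integrality condition asks for ε times an entry of the integral matrix b h₂.
  obtain ⟨t, ht⟩ := exists_diagonal_of_flag hN hg₂ hdet₂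
    (mul_ne_zero hε0 (inv_ne_zero hbQ)) hk0 hk4 hk1 ⟨ε * (V' * M * W) 1 3, by
      rw [hh₂e 1 3, mul_inv, inv_inv, hεinv]
      change ((ε * (V' * M * W) 1 3 : ℤ) : ℚ) = _
      push_cast
      field_simp⟩
  refine ⟨V', W * atkinLehner 1 (N : ℤ) 1 t 0 1, hV'γ,
    hWγ.mul (isGamma_atkinLehner one_pos (one_mul _) (by ring)),
    fun c => commute_of_inv hVV' hV'V (torusMat_commute_atkinLehner c ..), fun c => ?_, ε, hε, ?_⟩
  · rw [toQ_mul, Matrix.mul_assoc, torusMat_commute_atkinLehner, ← Matrix.mul_assoc,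
      torusMat_commute_atkinLehner, Matrix.mul_assoc]
  · rw [toQ_mul, ← Matrix.mul_assoc, ← hh₂, ht, mul_inv, inv_inv, hεinv]

end Classification

/-! ### Orientation of a positive definite plane -/

section Sign

variable {N : ℕ}

/-- The determinant of the compression of a real matrix to a positive definite plane. -/
def planeDet (M : Matrix (Fin 5) (Fin 5) ℝ) : ℝ :=
  (M 0 0 + M 0 4 + (M 4 0 + M 4 4)) * (M 1 1 + M 1 3 + (M 3 1 + M 3 3)) -
    (M 0 1 + M 0 3 + (M 4 1 + M 4 3)) * (M 1 0 + M 1 4 + (M 3 0 + M 3 4))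

/-- The plane spanned by e₀ + e₄ and e₁ + e₃ is positive definite. If the compression were singular,
some nonzero vector of the plane would be mapped to one with x₄ = -x₀ and x₃ = -x₁, where the form
is at most 0. -/
theorem planeDet_ne_zero {M : Matrix (Fin 5) (Fin 5) ℝ}
    (h : Mᵀ * gram (N : ℝ) * M = gram (N : ℝ)) : planeDet M ≠ 0 := by
  intro h0
  let P : Matrix (Fin 2) (Fin 2) ℝ := !![M 0 0 + M 0 4 + (M 4 0 + M 4 4),
    M 0 1 + M 0 3 + (M 4 1 + M 4 3);
    M 1 0 + M 1 4 + (M 3 0 + M 3 4), M 1 1 + M 1 3 + (M 3 1 + M 3 3)]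
  have hP : P.det = 0 := by
    rw [det_fin_two_of]; exact h0
  obtain ⟨v, hv, hPv⟩ := Matrix.exists_mulVec_eq_zero_iff.2 hP
  set x := M *ᵥ ![v 0, v 1, 0, v 1, v 0] with hx
  have hq := two_mul_quad_mulVec (c := 1) (by rw [one_smul]; exact h) ![v 0, v 1, 0, v 1, v 0]
  rw [← hx] at hq
  have hxi : ∀ i, x i = (M i 0 + M i 4) * v 0 + (M i 1 + M i 3) * v 1 := by
    intro i
    rw [hx, mulVec, dotProduct, Fin.sum_univ_five]
    simp
    ring
  have e1 : x 0 + x 4 = 0 := by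
    have := congrFun hPv 0
    simp [P, mulVec, dotProduct] at this
    rw [hxi, hxi]; linarith
  have e2 : x 1 + x 3 = 0 := by
    have := congrFun hPv 1
    simp [P, mulVec, dotProduct] at this
    rw [hxi, hxi]; linarith
  have hN : (0 : ℝ) ≤ N := Nat.cast_nonneg N
  have e3 : x 4 = - x 0 := by linarith
  have e4 : x 3 = - x 1 := by linarith
  have hq' : -(x 0 ^ 2 + x 1 ^ 2 + N * x 2 ^ 2) = v 0 ^ 2 + v 1 ^ 2 := by
    simp only [quad, e3, e4] at hq
    simp at hq
    linarith
  have hpos : 0 ≤ x 0 ^ 2 + x 1 ^ 2 + N * x 2 ^ 2 := by positivity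
  apply hv
  have h1 : v 0 ^ 2 = 0 := by nlinarith [sq_nonneg (v 0), sq_nonneg (v 1)]
  have h2 : v 1 ^ 2 = 0 := by nlinarith [sq_nonneg (v 0), sq_nonneg (v 1)]
  ext i
  fin_cases i
  · exact pow_eq_zero_iff two_ne_zero |>.1 h1
  · exact pow_eq_zero_iff two_ne_zero |>.1 h2

/-- A continuous function without zeros keeps its sign on the connected component, and its value at
the identity is 4. -/
theorem planeDet_pos {g : SpecialLinearGroup (Fin 5) ℝ} (hg : g ∈ SO0Real N) :
    0 < planeDet g.1 := by
  obtain ⟨s, hs, rfl⟩ := hg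
  have hcont : Continuous fun s : SOReal N => planeDet s.1.1 := by
    have hval : Continuous fun s : SOReal N => s.1.1 :=
      continuous_subtype_val.comp continuous_subtype_val
    have he : ∀ i j, Continuous fun s : SOReal N => s.1.1 i j := fun i j => hval.matrix_elem i j
    unfold planeDet
    fun_prop
  have hpre : IsPreconnected ((fun s : SOReal N => planeDet s.1.1) ''
      connectedComponent (1 : SOReal N)) :=
    isPreconnected_connectedComponent.image _ hcont.continuousOn
  have hone : planeDet (1 : SOReal N).1.1 = 4 := by
    change planeDet (1 : Matrix (Fin 5) (Fin 5) ℝ) = 4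
    simp [planeDet]
    norm_num
  by_contra hneg
  have hmem : (0 : ℝ) ∈ (fun s : SOReal N => planeDet s.1.1) ''
      connectedComponent (1 : SOReal N) := by
    refine hpre.ordConnected.out ⟨s, hs, rfl⟩ ⟨1, mem_connectedComponent, rfl⟩ ⟨not_lt.1 hneg, ?_⟩
    change 0 ≤ planeDet (1 : SOReal N).1.1
    rw [hone]; norm_num
  obtain ⟨u, -, hu⟩ := hmem
  exact planeDet_ne_zero (N := N) u.2 hu

end Sign

/-! ### Normal forms of double cosets -/

section DoubleCosets

variable {N : ℕ}

theorem IsGamma.exists_mem_GammaHat {A : Matrix (Fin 5) (Fin 5) ℤ} (hA : IsGamma N A) :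
    ∃ u ∈ GammaHat N, u.1 = toQ A := by
  obtain ⟨a, ha, rfl⟩ := hA
  refine ⟨SpecialLinearGroup.map (Int.castRingHom ℚ) a, ⟨?_, a, rfl⟩, rfl⟩
  change SpecialLinearGroup.map (algebraMap ℚ ℝ) _ ∈ SO0Real N
  have e : SpecialLinearGroup.map (algebraMap ℚ ℝ) (SpecialLinearGroup.map (Int.castRingHom ℚ) a) =
      SpecialLinearGroup.map (Int.castRingHom ℝ) a := by
    refine Subtype.ext ?_
    ext i j
    change (((a.1 i j : ℤ) : ℚ) : ℝ) = ((a.1 i j : ℤ) : ℝ)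
    push_cast
    rfl
  rw [e]
  exact ha

theorem mem_intSubring_of_mem_GammaHat {u : SpecialLinearGroup (Fin 5) ℚ} (hu : u ∈ GammaHat N)
    (i j : Fin 5) : u.1 i j ∈ intSubring := by
  obtain ⟨-, a, rfl⟩ := hu
  exact ⟨a.1 i j, rfl⟩

theorem mem_GammaHat_of_integral {g : SpecialLinearGroup (Fin 5) ℚ} (hg : g ∈ GHat N)
    (h : ∀ i j, g.1 i j ∈ intSubring) : g ∈ GammaHat N := by
  choose M hM using h
  have hM' : toQ (Matrix.of M) = g.1 := by
    ext i j
    exact hM i j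
  refine ⟨hg, ⟨Matrix.of M, ?_⟩, Subtype.ext hM'⟩
  have h2 : (((Matrix.of M).det : ℤ) : ℚ) = (toQ (Matrix.of M)).det :=
    RingHom.map_det (Int.castRingHom ℚ) (Matrix.of M)
  rw [hM', g.2] at h2
  exact_mod_cast h2

theorem gram_of_mem_GHat {g : SpecialLinearGroup (Fin 5) ℚ} (hg : g ∈ GHat N) :
    g.1ᵀ * gram (N : ℚ) * g.1 = gram (N : ℚ) := by
  have h := gram_eq_of_mem_SO0Real (g := SpecialLinearGroup.map (algebraMap ℚ ℝ) g) hg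
  have e : gram (N : ℝ) = (gram (N : ℚ)).map (algebraMap ℚ ℝ) := by
    rw [gram_map]; simp
  generalize hA : g.1 = A
  have h' : (A.map (algebraMap ℚ ℝ))ᵀ * gram (N : ℝ) * A.map (algebraMap ℚ ℝ) =
      gram (N : ℝ) := by
    rw [← hA]; exact h
  rw [e, ← transpose_map, ← Matrix.map_mul, ← Matrix.map_mul] at h'
  exact Matrix.map_injective (algebraMap ℚ ℝ).injective h'

theorem matDen_mul_dvd_of_left {u : SpecialLinearGroup (Fin 5) ℚ} (hu : u ∈ GammaHat N)
    (g : Matrix (Fin 5) (Fin 5) ℚ) : matDen (u.1 * g) ∣ matDen g ∧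
      matDen (minors (u.1 * g)) ∣ matDen (minors g) := by
  have h1 := matDen_mul_dvd u.1 g
  have h2 := matDen_minors_mul_dvd u.1 g
  rw [matDen_eq_one (mem_intSubring_of_mem_GammaHat hu), one_mul] at h1
  rw [matDen_minors_eq_one (mem_intSubring_of_mem_GammaHat hu), one_mul] at h2
  exact ⟨h1, h2⟩

theorem matDen_mul_dvd_of_right {u : SpecialLinearGroup (Fin 5) ℚ} (hu : u ∈ GammaHat N)
    (g : Matrix (Fin 5) (Fin 5) ℚ) : matDen (g * u.1) ∣ matDen g ∧
      matDen (minors (g * u.1)) ∣ matDen (minors g) := by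
  have h1 := matDen_mul_dvd g u.1
  have h2 := matDen_minors_mul_dvd g u.1
  rw [matDen_eq_one (mem_intSubring_of_mem_GammaHat hu), mul_one] at h1
  rw [matDen_minors_eq_one (mem_intSubring_of_mem_GammaHat hu), mul_one] at h2
  exact ⟨h1, h2⟩

theorem gram_torusMat {c : ℚ} (hc : c ≠ 0) (n : ℚ) :
    (torusMat c)ᵀ * gram n * torusMat c = gram n := by
  ext i j
  rw [torusMat, diagonal_transpose, mul_diagonal, diagonal_mul]
  fin_cases i <;> fin_cases j <;> simp [gram, hc]

theorem det_torusMat {c : ℚ} (hc : c ≠ 0) : (torusMat c).det = 1 := by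
  rw [torusMat, det_diagonal]
  simp [Fin.prod_univ_succ, hc]

theorem torusMat_inv_mul {c : ℚ} (hc : c ≠ 0) : torusMat c⁻¹ * torusMat c = 1 := by
  rw [torusMat, torusMat, diagonal_mul_diagonal, ← diagonal_one]
  congr 1
  ext i
  fin_cases i <;> simp [hc]

/-- Every element of `SO₀(Ŝ_N; ℚ)` is equivalent to some `diag(1/a, 1/b, 1, b, a)`. -/
theorem exists_diagMat (hN : Squarefree N) {g : SpecialLinearGroup (Fin 5) ℚ} (hg : g ∈ GHat N) :
    ∃ u ∈ GammaHat N, ∃ v ∈ GammaHat N, ∃ a b : ℕ, 0 < a ∧ b ∣ a ∧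
      (u * g * v).1 = diagMat a b := by
  have hN0 : (N : ℚ) ≠ 0 := Nat.cast_ne_zero.2 hN.ne_zero
  set a := matDen g.1 with ha
  have ha0 : 0 < a := matDen_pos _
  have haQ : (a : ℚ) ≠ 0 := Nat.cast_ne_zero.2 ha0.ne'
  obtain ⟨M, hM, hprim⟩ := exists_matDen_smul_eq g.1
  rw [← ha] at hM hprim
  have hgg := gram_of_mem_GHat hg
  have hMs : Mᵀ * gram (N : ℤ) * M = (a : ℤ) ^ 2 • gram (N : ℤ) := by
    refine gram_of_toQ ?_
    rw [← hM, transpose_smul, Matrix.smul_mul, Matrix.smul_mul, Matrix.mul_smul, smul_smul, hgg]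
    push_cast
    rw [pow_two]
  obtain ⟨A, B, hA, hB, hcol, hrow⟩ := exists_first_basis hN ha0.ne' hMs hprim
  set k := toQ A * g.1 * toQ B with hk
  have hak : (a : ℚ) • k = toQ (A * M * B) := by
    rw [toQ_mul, toQ_mul, ← hM, hk]; simp
  have hke : ∀ i j, k i j = (a : ℚ)⁻¹ * ((A * M * B) i j : ℤ) := fun i j => by
    have := congrFun (congrFun hak i) j
    change (a : ℚ) * k i j = ((A * M * B) i j : ℚ) at this
    rw [← this]; field_simp
  have hkg : kᵀ * gram (N : ℚ) * k = gram (N : ℚ) := by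
    have := gram_mul_mul (c := 1) hA.gram_toQ (by rw [one_smul]; exact hgg) hB.gram_toQ
    rwa [one_smul] at this
  have one_cast : ∀ i j : Fin 5, (((1 : Matrix (Fin 5) (Fin 5) ℤ) i j : ℤ) : ℚ) =
      (1 : Matrix (Fin 5) (Fin 5) ℚ) i j := by
    intro i j
    rw [one_apply, one_apply]
    split_ifs <;> simp
  have k0 : ∀ i, k i 0 = (a : ℚ)⁻¹ * (1 : Matrix (Fin 5) (Fin 5) ℚ) i 0 := fun i => by
    rw [hke, hcol, one_cast]
  have kr0 : ∀ j, k 0 j = (a : ℚ)⁻¹ * (1 : Matrix (Fin 5) (Fin 5) ℚ) 0 j := fun j => by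
    rw [hke, hrow, one_cast]
  -- The last column is forced by the dual relations with row 0, which is a⁻¹ e₀.
  have k4 : ∀ i, k i 4 = a * (1 : Matrix (Fin 5) (Fin 5) ℚ) i 4 := by
    intro i
    have hc := cogram_eq_of_gram_eq (c := 1) (mul_ne_zero two_ne_zero hN0) one_ne_zero
      (by rw [one_smul]; exact hkg)
    have h0i := congrFun (congrFun hc 0) i
    rw [cogram_entry, one_smul] at h0i
    simp only [kr0] at h0i
    have h2 : (2 * N : ℚ) * ((a : ℚ)⁻¹ * k i 4) = cogram (N : ℚ) 0 i := by
      simpa [one_apply] using h0i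
    have h3 : cogram (N : ℚ) 0 i = 2 * N * (1 : Matrix (Fin 5) (Fin 5) ℚ) i 4 := by
      fin_cases i <;> simp [cogram, one_apply]
    rw [h3] at h2
    have h4 := mul_left_cancel₀ (mul_ne_zero two_ne_zero hN0) h2
    rw [← h4]; field_simp
  -- Stripping off the outer torus leaves an isometry fixing e₀ and e₄, that is, one of the ternary
  -- form. The integral matrix used later on its right commutes with the torus, so the torus can be
  -- restored at the end.
  set h := k * torusMat (a : ℚ)⁻¹ with hh
  have hent : ∀ i j, h i j = k i j * (![(a : ℚ), 1, 1, 1, (a : ℚ)⁻¹] : Fin 5 → ℚ) j := by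
    intro i j
    rw [hh, torusMat, mul_diagonal, inv_inv]
  have hkh : h * torusMat a = k := by
    rw [hh, Matrix.mul_assoc, torusMat_inv_mul haQ, Matrix.mul_one]
  have hhg : hᵀ * gram (N : ℚ) * h = gram (N : ℚ) := by
    have h1 := gram_torusMat (inv_ne_zero haQ) (N : ℚ)
    calc hᵀ * gram (N : ℚ) * h
        = (torusMat (a : ℚ)⁻¹)ᵀ * (kᵀ * gram (N : ℚ) * k) * torusMat (a : ℚ)⁻¹ := by
          rw [hh, transpose_mul]; simp only [Matrix.mul_assoc]
      _ = gram (N : ℚ) := by rw [hkg, h1]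
  have hhdet : h.det = 1 := by
    rw [hh, det_mul, det_torusMat (inv_ne_zero haQ), hk, det_mul, det_mul, hA.det_toQ, hB.det_toQ,
      g.2]
    norm_num
  have h0 : ∀ i, h i 0 = (1 : Matrix (Fin 5) (Fin 5) ℚ) i 0 := fun i => by
    rw [hent, k0]
    simp
    field_simp
  have h4 : ∀ i, h i 4 = (1 : Matrix (Fin 5) (Fin 5) ℚ) i 4 := fun i => by
    rw [hent, k4]
    simp
    field_simp
  have single_eq : ∀ j, (∀ i, h i j = (1 : Matrix (Fin 5) (Fin 5) ℚ) i j) →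
      h *ᵥ Pi.single j 1 = Pi.single j 1 := by
    intro j hj
    ext i
    rw [mulVec_single_col, hj, one_apply, Pi.single_apply]
  obtain ⟨A', B', hA', hB', -, hcB, ε, hε, hdiag⟩ :=
    exists_ternary_diagonal hN hhg hhdet (single_eq 0 h0) (single_eq 4 h4)
  set b := matDen h with hb
  have hb0 : 0 < b := matDen_pos _
  -- The columns of h other than the first and last are those of k, whose denominators divide a.
  have hba : b ∣ a := by
    rw [hb, matDen_dvd_iff]
    intro i j
    by_cases hj0 : j = 0
    · rw [hj0, h0, ← one_cast]
      exact ⟨a * (1 : Matrix (Fin 5) (Fin 5) ℤ) i 0, by simp⟩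
    by_cases hj4 : j = 4
    · rw [hj4, h4, ← one_cast]
      exact ⟨a * (1 : Matrix (Fin 5) (Fin 5) ℤ) i 4, by simp⟩
    · refine ⟨(A * M * B) i j, ?_⟩
      rw [hent, hke]
      have : (![(a : ℚ), 1, 1, 1, (a : ℚ)⁻¹] : Fin 5 → ℚ) j = 1 := by
        fin_cases j <;> simp_all
      rw [this]
      change (((A * M * B) i j : ℤ) : ℚ) = _
      field_simp
  obtain ⟨u, hu, hu'⟩ := (hA'.mul hA).exists_mem_GammaHat
  obtain ⟨v, hv, hv'⟩ := (hB.mul hB').exists_mem_GammaHat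
  have hfinal : (u * g * v).1 =
      diagonal ![(a : ℚ)⁻¹, ε * (b : ℚ)⁻¹, 1, ε * (b : ℚ), a] := by
    change u.1 * g.1 * v.1 = _
    rw [hu', hv', toQ_mul, toQ_mul]
    calc toQ A' * toQ A * g.1 * (toQ B * toQ B') = toQ A' * k * toQ B' := by
          rw [hk]; simp only [Matrix.mul_assoc]
      _ = toQ A' * h * toQ B' * torusMat a := by
          rw [← hkh, ← Matrix.mul_assoc, Matrix.mul_assoc, ← hcB, ← Matrix.mul_assoc]
      _ = _ := by
          rw [hdiag, torusMat, diagonal_mul_diagonal]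
          congr 1
          ext i
          fin_cases i <;> simp
  -- On the diagonal form `planeDet` equals (1/a + a) · ε (1/b + b), so its positivity decides the
  -- sign.
  have hε1 : (ε : ℚ) = 1 := by
    have hmem : u * g * v ∈ GHat N := (GHat N).mul_mem ((GHat N).mul_mem hu.1 hg) hv.1
    have hpos := planeDet_pos (N := N) hmem
    have hpd : planeDet (SpecialLinearGroup.map (algebraMap ℚ ℝ) (u * g * v)).1 =
        ((a : ℝ)⁻¹ + a) * (ε * ((b : ℝ)⁻¹ + b)) := by
      have : (SpecialLinearGroup.map (algebraMap ℚ ℝ) (u * g * v)).1 =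
          (diagonal ![(a : ℚ)⁻¹, ε * (b : ℚ)⁻¹, 1, ε * (b : ℚ), a]).map (algebraMap ℚ ℝ) := by
        rw [← hfinal]; rfl
      rw [this]
      simp [planeDet]
      exact Or.inl (by ring)
    rw [hpd] at hpos
    have haR : (0 : ℝ) < a := Nat.cast_pos.2 ha0
    have hbR : (0 : ℝ) < b := Nat.cast_pos.2 hb0
    have h1 : (0 : ℝ) < ε := by
      have h2 := (mul_pos_iff_of_pos_left (by positivity)).1 hpos
      exact (mul_pos_iff_of_pos_right (by positivity)).1 h2
    have h3 : 0 < ε := Int.cast_pos.1 h1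
    have h4 : ε = 1 := by nlinarith
    rw [h4, Int.cast_one]
  refine ⟨u, hu, v, hv, a, b, ha0, hba, ?_⟩
  rw [hfinal, hε1, one_mul, one_mul]
  rfl

/-- Multiplication by integral invertible matrices preserves both denominators, so they can be read
off from the diagonal form. -/
theorem exists_normal_form (hN : Squarefree N) {g : SpecialLinearGroup (Fin 5) ℚ}
    (hg : g ∈ GHat N) : ∃ u ∈ GammaHat N, ∃ v ∈ GammaHat N, ∃ a b : ℕ, 0 < a ∧ b ∣ a ∧
      (u * g * v).1 = diagMat a b ∧ matDen g.1 = a ∧ matDen (minors g.1) = a * b := by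
  obtain ⟨u, hu, v, hv, a, b, ha, hba, h⟩ := exists_diagMat hN hg
  have e : g.1 = u⁻¹.1 * (diagMat a b * v⁻¹.1) := by
    rw [← h]
    change _ = (u⁻¹ * (u * g * v * v⁻¹)).1
    rw [show u⁻¹ * (u * g * v * v⁻¹) = g by group]
  have h1 := matDen_mul_dvd_of_left ((GammaHat N).inv_mem hu) (diagMat a b * v⁻¹.1)
  have h2 := matDen_mul_dvd_of_right ((GammaHat N).inv_mem hv) (diagMat a b)
  have h3 := matDen_mul_dvd_of_right hv (u.1 * g.1)
  have h4 := matDen_mul_dvd_of_left hu g.1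
  have e2 : diagMat a b = u.1 * g.1 * v.1 := h.symm
  rw [← e] at h1
  rw [← e2] at h3
  refine ⟨u, hu, v, hv, a, b, ha, hba, h, ?_, ?_⟩
  · rw [← matDen_diagMat ha hba]
    exact Nat.dvd_antisymm (h1.1.trans h2.1) (h3.1.trans h4.1)
  · rw [← matDen_minors_diagMat ha hba]
    exact Nat.dvd_antisymm (h1.2.trans h2.2) (h3.2.trans h4.2)

end DoubleCosets

/-! ### Multiplicity one of the leading double coset -/

section Extremal

variable {N : ℕ}

theorem primitive_of_sum_eq_one {v c : Fin 5 → ℤ} (h : ∑ i, c i * v i = 1) : Primitive v :=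
  fun _ hk => isUnit_of_dvd_one (h ▸ Finset.dvd_sum fun i _ => (hk i).mul_left _)

/-- An element of the Borel subgroup whose first two rows are integral is integral. -/
theorem mem_GammaHat_of_flag (hN : Squarefree N) {n : SpecialLinearGroup (Fin 5) ℚ}
    (hn : n ∈ GHat N) (h0 : ∀ i, n.1 i 0 = (1 : Matrix (Fin 5) (Fin 5) ℚ) i 0) {ε : ℤ}
    (hε : ε * ε = 1) (h11 : n.1 1 1 = ε) (h21 : n.1 2 1 = 0) (h31 : n.1 3 1 = 0)
    (hr0 : ∀ j, n.1 0 j ∈ intSubring) (hr1 : ∀ j, n.1 1 j ∈ intSubring) : n ∈ GammaHat N := by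
  have hN' : Squarefree (N : ℤ) := Int.squarefree_natCast.2 hN
  have hg := gram_of_mem_GHat hn
  refine mem_GammaHat_of_integral hn ?_
  generalize n.1 = A at *
  have hgram : ∀ j k, A 0 j * A 4 k + A 1 j * A 3 k - 2 * N * A 2 j * A 2 k +
      A 3 j * A 1 k + A 4 j * A 0 k = gram (N : ℚ) j k := fun j k => by rw [← gram_entry, hg]
  have hεQ : (ε : ℚ) * ε = 1 := by exact_mod_cast hε
  have h4 : ∀ k, A 4 k = gram (N : ℚ) 0 k := fun k => by
    have := hgram 0 k
    simpa [h0] using this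
  have h41 : A 4 1 = 0 := by rw [h4]; simp [gram]
  have h42 : A 4 2 = 0 := by rw [h4]; simp [gram]
  have h43 : A 4 3 = 0 := by rw [h4]; simp [gram]
  have h44 : A 4 4 = 1 := by rw [h4]; simp [gram]
  -- Rows 4 and 3 are solved from the Gram relations with columns 0 and 1. Row 2 is then integral
  -- because the diagonal Gram relations express N A₂ⱼ² through integral entries.
  have h3 : ∀ k, A 3 k = ε * (gram (N : ℚ) 1 k - A 0 1 * A 4 k) := fun k => by
    have := hgram 1 k
    rw [h11, h21, h31, h41] at this
    linear_combination ε * this - A 3 k * hεQ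
  have h32 : A 3 2 = 0 := by rw [h3, h42]; simp [gram]
  have h33 : A 3 3 = ε := by rw [h3, h43]; simp [gram]
  have h34 : A 3 4 = -(ε * A 0 1) := by rw [h3, h44]; simp [gram]
  have hε' := intCast_mem_intSubring ε
  have i34 : A 3 4 ∈ intSubring := by
    rw [h34]; exact neg_mem (mul_mem hε' (hr0 1))
  have hg22 : gram (N : ℚ) 2 2 = -2 * N := by simp [gram]
  have hg33 : gram (N : ℚ) 3 3 = 0 := by simp [gram]
  have hg44 : gram (N : ℚ) 4 4 = 0 := by simp [gram]
  have i22 : A 2 2 ∈ intSubring := by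
    refine mem_intSubring_of_mul_sq hN' ?_
    have := hgram 2 2
    rw [h42, h32, hg22] at this
    have e : ((N : ℤ) : ℚ) * A 2 2 ^ 2 = (N : ℤ) := by push_cast; linear_combination -this / 2
    rw [e]; exact intCast_mem_intSubring _
  have i23 : A 2 3 ∈ intSubring := by
    refine mem_intSubring_of_mul_sq hN' ?_
    have := hgram 3 3
    rw [h43, h33, hg33] at this
    have e : ((N : ℤ) : ℚ) * A 2 3 ^ 2 = ε * A 1 3 := by push_cast; linear_combination -this / 2
    rw [e]; exact mul_mem hε' (hr1 3)
  have i24 : A 2 4 ∈ intSubring := by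
    refine mem_intSubring_of_mul_sq hN' ?_
    have := hgram 4 4
    rw [h44, hg44] at this
    have e : ((N : ℤ) : ℚ) * A 2 4 ^ 2 = A 0 4 + A 1 4 * A 3 4 := by
      push_cast; linear_combination -this / 2
    rw [e]; exact add_mem (hr0 4) (mul_mem (hr1 4) i34)
  intro i j
  fin_cases i
  · exact hr0 j
  · exact hr1 j
  · fin_cases j
    · simp [h0]
    · simp [h21]
    · exact i22
    · exact i23
    · exact i24
  · fin_cases j
    · simp [h0]
    · simp [h31]
    · simp [h32]
    · simp [h33, hε']
    · exact i34
  · fin_cases j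
    · simp [h0]
    · simp [h41]
    · simp [h42]
    · simp [h43]
    · simp [h44]

/-- The corner of g h attains the extremal denominator aa'. Clearing denominators turns its
expansion into a Bézout relation for the integral vector a' h e₀, which is therefore primitive; it
is isotropic, hence in the orbit of e₀. -/
theorem exists_reduce_first_column (hN : Squarefree N) {g h : Matrix (Fin 5) (Fin 5) ℚ}
    (hh : hᵀ * gram (N : ℚ) * h = gram (N : ℚ)) {a a' : ℕ} (ha : 0 < a) (ha' : 0 < a')
    (hg1 : matDen g ∣ a) (hh1 : matDen h ∣ a') (hgh : (g * h) 0 0 = (a * a' : ℚ)⁻¹) :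
    ∃ u ∈ GammaHat N, ∀ i, (u.1 * h) i 0 = (a' : ℚ)⁻¹ * (1 : Matrix (Fin 5) (Fin 5) ℚ) i 0 := by
  have haQ : (a : ℚ) ≠ 0 := Nat.cast_ne_zero.2 ha.ne'
  have haQ' : (a' : ℚ) ≠ 0 := Nat.cast_ne_zero.2 ha'.ne'
  choose c hc using fun j => matDen_dvd_iff.1 hg1 0 j
  choose W hW using fun j => matDen_dvd_iff.1 hh1 j 0
  have hc : ∀ j, (c j : ℚ) = a * g 0 j := hc
  have hW : ∀ j, (W j : ℚ) = a' * h j 0 := hW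
  have hprim : Primitive W := by
    refine primitive_of_sum_eq_one (c := c) ?_
    rify
    have : ((∑ i, c i * W i : ℤ) : ℚ) = a * a' * (g * h) 0 0 := by
      push_cast
      rw [Matrix.mul_apply, Finset.mul_sum]
      exact Finset.sum_congr rfl fun i _ => by rw [hc, hW]; ring
    rw [hgh, mul_inv_cancel₀ (mul_ne_zero haQ haQ')] at this
    exact_mod_cast this
  have hq : quad (N : ℤ) W = 0 := by
    have := congrFun (congrFun hh 0) 0
    rw [gram_entry] at this
    have e : ((quad (N : ℤ) W : ℤ) : ℚ) = 0 := by
      simp only [quad]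
      push_cast
      rw [hW, hW, hW, hW, hW]
      have hz : gram (N : ℚ) 0 0 = 0 := by simp [gram]
      rw [hz] at this
      linear_combination (a' : ℚ) ^ 2 / 2 * this
    exact_mod_cast e
  obtain ⟨A, hA, hAW⟩ := orbitRel_basis hN hprim hq
  obtain ⟨u, hu, hu'⟩ := hA.exists_mem_GammaHat
  refine ⟨u, hu, fun i => ?_⟩
  have h1 : ((A *ᵥ W) i : ℚ) = a' * (u.1 * h) i 0 := by
    rw [hu', mulVec, dotProduct, Matrix.mul_apply, Finset.mul_sum]
    push_cast
    refine Finset.sum_congr rfl fun j _ => ?_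
    rw [hW]
    change (A i j : ℚ) * _ = _ * ((A i j : ℚ) * _)
    ring
  rw [hAW] at h1
  rw [eq_inv_mul_iff_mul_eq₀ haQ', ← h1]
  fin_cases i <;> simp [one_apply]

/-- Once the first columns are multiples of e₀, minors involving row 0 and column 0 bound the
denominators of the other rows by b and b'. The extremal entry (1, 1) of g h then gives a Bézout
relation showing that rows 1 to 3 of b' h e₁ form a primitive vector, and `exists_parametrization`
moves it to ±e₁. -/
theorem exists_reduce_second_column (hN : Squarefree N) {g h : Matrix (Fin 5) (Fin 5) ℚ}
    (hh : hᵀ * gram (N : ℚ) * h = gram (N : ℚ)) {a a' b b' : ℕ} (ha : 0 < a) (ha' : 0 < a')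
    (hb : 0 < b) (hb' : 0 < b')
    (hg1 : matDen (minors g) ∣ a * b) (hh1 : matDen (minors h) ∣ a' * b')
    (hg0 : ∀ i, g i 0 = (a : ℚ)⁻¹ * (1 : Matrix (Fin 5) (Fin 5) ℚ) i 0)
    (hh0 : ∀ i, h i 0 = (a' : ℚ)⁻¹ * (1 : Matrix (Fin 5) (Fin 5) ℚ) i 0)
    (hgh : (g * h) 1 1 = (b * b' : ℚ)⁻¹) :
    ∃ v ∈ GammaHat N, ∃ ε : ℤ, ε * ε = 1 ∧
      h *ᵥ Pi.single 0 1 = v.1 *ᵥ ((a' : ℚ)⁻¹ • Pi.single 0 1) ∧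
      h *ᵥ Pi.single 1 1 = v.1 *ᵥ (h 0 1 • Pi.single 0 1 + (ε * (b' : ℚ)⁻¹) • Pi.single 1 1) := by
  have haQ : (a : ℚ) ≠ 0 := Nat.cast_ne_zero.2 ha.ne'
  have haQ' : (a' : ℚ) ≠ 0 := Nat.cast_ne_zero.2 ha'.ne'
  have hbQ : (b : ℚ) ≠ 0 := Nat.cast_ne_zero.2 hb.ne'
  have hbQ' : (b' : ℚ) ≠ 0 := Nat.cast_ne_zero.2 hb'.ne'
  have h41 : h 4 1 = 0 := by
    have := congrFun (congrFun hh 0) 1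
    rw [gram_entry] at this
    simpa [hh0, haQ', gram] using this
  have hint : ∀ {M : Matrix (Fin 5) (Fin 5) ℚ} {a b : ℕ}, (a : ℚ) ≠ 0 →
      matDen (minors M) ∣ a * b →
      (∀ i, M i 0 = (a : ℚ)⁻¹ * (1 : Matrix (Fin 5) (Fin 5) ℚ) i 0) → ∀ i j, i ≠ 0 →
      (b : ℚ) * M i j ∈ intSubring := by
    intro M a b ha hM hM0 i j hi
    have := matDen_dvd_iff.1 hM (0, i) (0, j)
    rw [minors_apply, hM0, hM0, one_apply_eq, one_apply_ne hi] at this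
    convert this using 1
    push_cast
    field_simp
    ring
  have ch : ∀ j, ∃ y : ℤ, j ≠ 0 → (y : ℚ) = b' * h j 1 := fun j => by
    by_cases hj : j = 0
    · exact ⟨0, fun h => absurd hj h⟩
    · obtain ⟨y, hy⟩ := hint haQ' hh1 hh0 j 1 hj
      exact ⟨y, fun _ => hy⟩
  choose y hy using ch
  choose c hc using fun j => hint haQ hg1 hg0 1 j (by decide)
  have hc : ∀ j, (c j : ℚ) = b * g 1 j := hc
  have hsum : (c 1 * y 1 + c 2 * y 2 + c 3 * y 3 : ℤ) = 1 := by
    have e : ((c 1 * y 1 + c 2 * y 2 + c 3 * y 3 : ℤ) : ℚ) = b * b' * (g * h) 1 1 := by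
      push_cast
      rw [hc, hc, hc, hy 1 (by decide), hy 2 (by decide), hy 3 (by decide), Matrix.mul_apply]
      simp only [Fin.sum_univ_succ, hg0]
      simp [h41]
      ring
    rw [hgh, mul_inv_cancel₀ (mul_ne_zero hbQ hbQ')] at e
    exact_mod_cast e
  have hprim : Primitive ![0, y 1, y 2, y 3, 0] := by
    refine primitive_of_sum_eq_one (c := c) ?_
    rw [← hsum]
    simp [Fin.sum_univ_succ]
    ring
  have hq : y 1 * y 3 = N * y 2 ^ 2 := by
    have := congrFun (congrFun hh 1) 1
    rw [gram_entry, h41, show gram (N : ℚ) 1 1 = 0 by simp [gram]] at this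
    have e : (y 1 * y 3 : ℚ) = N * y 2 ^ 2 := by
      rw [hy 1 (by decide), hy 2 (by decide), hy 3 (by decide)]
      linear_combination (b' : ℚ) ^ 2 / 2 * this
    exact_mod_cast e
  obtain ⟨d, d', α, β, γ, δ, ε, hd, hdN, hdet, hε, e1, e2, e3⟩ := exists_parametrization hN hprim hq
  obtain ⟨v, hv, hv'⟩ := (isGamma_atkinLehner hd hdN hdet).exists_mem_GammaHat
  have hcol : ∀ i, i ≠ 0 → h i 1 = (b' : ℚ)⁻¹ * y i := fun i hi => by
    rw [hy i hi]; field_simp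
  refine ⟨v, hv, ε, hε, ?_, ?_⟩
  · rw [hv', mulVec_smul]
    ext i
    rw [mulVec_single_col, hh0, Pi.smul_apply, mulVec_single_col, smul_eq_mul]
    fin_cases i <;> simp [toQ, atkinLehner, one_apply]
  · rw [hv', mulVec_add, mulVec_smul, mulVec_smul]
    ext i
    rw [mulVec_single_col, Pi.add_apply, Pi.smul_apply, Pi.smul_apply, mulVec_single_col,
      mulVec_single_col, smul_eq_mul, smul_eq_mul]
    fin_cases i
    · simp [toQ, atkinLehner]
    · change h 1 1 = _
      rw [hcol 1 (by decide), e1]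
      simp [toQ, atkinLehner]
      ring
    · change h 2 1 = _
      rw [hcol 2 (by decide), e2]
      simp [toQ, atkinLehner]
      ring
    · change h 3 1 = _
      rw [hcol 3 (by decide), e3]
      simp [toQ, atkinLehner]
      ring
    · change h 4 1 = _
      rw [h41]
      simp [toQ, atkinLehner]

/-- In the product of the double cosets of `t` and `t'`, the coset of `t t'` arises only once. -/
theorem mul_inv_mem_GammaHat (hN : Squarefree N) {t t' h : SpecialLinearGroup (Fin 5) ℚ}
    (ht' : t' ∈ GHat N) (hh : h ∈ GHat N) {a b a' b' : ℕ} (ha : 0 < a) (hb : 0 < b)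
    (ha' : 0 < a') (hb' : 0 < b') (eqt : t.1 = diagMat a b) (eqt' : t'.1 = diagMat a' b')
    (h1 : matDen h.1 ∣ a') (h2 : matDen (minors h.1) ∣ a' * b')
    (h3 : matDen (t * t' * h⁻¹).1 ∣ a) (h4 : matDen (minors (t * t' * h⁻¹).1) ∣ a * b) :
    t' * h⁻¹ ∈ GammaHat N := by
  have haQ : (a : ℚ) ≠ 0 := Nat.cast_ne_zero.2 ha.ne'
  have haQ' : (a' : ℚ) ≠ 0 := Nat.cast_ne_zero.2 ha'.ne'
  have hbQ : (b : ℚ) ≠ 0 := Nat.cast_ne_zero.2 hb.ne'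
  have hbQ' : (b' : ℚ) ≠ 0 := Nat.cast_ne_zero.2 hb'.ne'
  have hprod : ∀ k : SpecialLinearGroup (Fin 5) ℚ, (t * t' * k⁻¹).1 * k.1 =
      diagonal ![(a * a' : ℚ)⁻¹, (b * b' : ℚ)⁻¹, 1, b * b', a * a'] := by
    intro k
    change (t * t' * k⁻¹ * k).1 = _
    rw [inv_mul_cancel_right]
    change t.1 * t'.1 = _
    rw [eqt, eqt', diagMat, diagMat, diagonal_mul_diagonal]
    congr 1
    ext i
    fin_cases i <;> simp [mul_comm]
  -- Replacing h by u h, and below by v⁻¹ u h, stays in the same right coset and only multiplies the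
  -- left factor by integral matrices, so the denominator bounds persist.
  obtain ⟨u, hu, hu0⟩ := exists_reduce_first_column hN (gram_of_mem_GHat hh) ha ha' h3 h1
    (by rw [hprod]; simp)
  have hk := (GHat N).mul_mem hu.1 hh
  have hk2 := (matDen_mul_dvd_of_left hu h.1).2.trans h2
  have hg1 := (matDen_mul_dvd_of_right ((GammaHat N).inv_mem hu) (t * t' * h⁻¹).1).1.trans h3
  have hg2 := (matDen_mul_dvd_of_right ((GammaHat N).inv_mem hu) (t * t' * h⁻¹).1).2.trans h4
  have eg : t * t' * h⁻¹ * u⁻¹ = t * t' * (u * h)⁻¹ := by group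
  change matDen (t * t' * h⁻¹ * u⁻¹).1 ∣ a at hg1
  change matDen (minors (t * t' * h⁻¹ * u⁻¹).1) ∣ a * b at hg2
  change ∀ i, (u * h).1 i 0 = _ at hu0
  change matDen (minors (u * h).1) ∣ a' * b' at hk2
  rw [eg] at hg1 hg2
  suffices hs : t' * (u * h)⁻¹ ∈ GammaHat N by
    have := (GammaHat N).mul_mem hs hu
    rwa [show t' * (u * h)⁻¹ * u = t' * h⁻¹ by group] at this
  generalize u * h = k at *
  clear eg
  have hg0 : ∀ i, (t * t' * k⁻¹).1 i 0 = (a : ℚ)⁻¹ * (1 : Matrix (Fin 5) (Fin 5) ℚ) i 0 := by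
    intro i
    have := congrFun (congrFun (hprod k) i) 0
    rw [Matrix.mul_apply] at this
    have hs : ∑ j, (t * t' * k⁻¹).1 i j * k.1 j 0 = (t * t' * k⁻¹).1 i 0 * (a' : ℚ)⁻¹ := by
      rw [Finset.sum_eq_single 0]
      · rw [hu0, one_apply_eq, mul_one]
      · intro j _ hj
        rw [hu0, one_apply_ne hj, mul_zero, mul_zero]
      · simp
    rw [hs, ← eq_mul_inv_iff_mul_eq₀ (inv_ne_zero haQ'), inv_inv] at this
    rw [this]
    fin_cases i <;> simp [one_apply]
    field_simp
  obtain ⟨v, hv, ε, hε, hv0, hv1⟩ := exists_reduce_second_column hN (gram_of_mem_GHat hk) ha ha' hb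
    hb' hg2 hk2 hg0 hu0 (by rw [hprod]; simp)
  have hg1' := (matDen_mul_dvd_of_right hv (t * t' * k⁻¹).1).1.trans hg1
  have hg2' := (matDen_mul_dvd_of_right hv (t * t' * k⁻¹).1).2.trans hg2
  have eg : t * t' * k⁻¹ * v = t * (t' * (v⁻¹ * k)⁻¹) := by group
  change matDen (t * t' * k⁻¹ * v).1 ∣ a at hg1'
  change matDen (minors (t * t' * k⁻¹ * v).1) ∣ a * b at hg2'
  rw [eg] at hg1' hg2'
  suffices hs : t' * (v⁻¹ * k)⁻¹ ∈ GammaHat N by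
    have := (GammaHat N).mul_mem hs ((GammaHat N).inv_mem hv)
    rwa [show t' * (v⁻¹ * k)⁻¹ * v⁻¹ = t' * k⁻¹ by group] at this
  have hcancel : ∀ x y : Fin 5 → ℚ, k.1 *ᵥ x = v.1 *ᵥ y → (v⁻¹ * k).1 *ᵥ x = y := by
    intro x y hxy
    change (v⁻¹.1 * k.1) *ᵥ x = y
    rw [← mulVec_mulVec, hxy, mulVec_mulVec]
    change (v⁻¹ * v).1 *ᵥ y = y
    rw [inv_mul_cancel]
    exact one_mulVec y
  have hm0 := hcancel _ _ hv0
  have hm1 := hcancel _ _ hv1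
  have hnm : (v⁻¹ * k) ∈ GHat N := (GHat N).mul_mem ((GHat N).inv_mem hv.1) hk
  generalize v⁻¹ * k = m at *
  -- By construction n fixes e₀ and sends e₁ to ±e₁ plus a multiple of e₀. The left factor is now t
  -- n, so its denominator bounds are conditions on the first two rows of n.
  set n := t' * m⁻¹ with hn
  have hn_mem : n ∈ GHat N := (GHat N).mul_mem ht' ((GHat N).inv_mem hnm)
  have hnt : n.1 * m.1 = diagMat a' b' := by
    rw [← eqt']
    change (t' * m⁻¹ * m).1 = _
    rw [inv_mul_cancel_right]
  have hεQ : (ε : ℚ) * ε = 1 := by exact_mod_cast hε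
  have hc0 : ∀ i, n.1 i 0 = (1 : Matrix (Fin 5) (Fin 5) ℚ) i 0 := fun i => by
    have h := congrFun (congrArg (n.1 *ᵥ ·) hm0) i
    simp only [mulVec_mulVec, hnt, mulVec_smul, Pi.smul_apply, mulVec_single_col, smul_eq_mul] at h
    rw [eq_inv_mul_iff_mul_eq₀ haQ'] at h
    rw [← h]
    fin_cases i <;> simp [one_apply, diagMat, haQ']
  have hc1 : ∀ i, n.1 i 0 * k.1 0 1 + n.1 i 1 * (ε * (b' : ℚ)⁻¹) = diagMat a' b' i 1 := fun i => by
    have h := congrFun (congrArg (n.1 *ᵥ ·) hm1) i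
    simp only [mulVec_mulVec, hnt, mulVec_smul, mulVec_add, Pi.smul_apply, Pi.add_apply,
      mulVec_single_col, smul_eq_mul] at h
    rw [h]; ring
  have hrow : ∀ i j, (t * n).1 i j = (![(a : ℚ)⁻¹, (b : ℚ)⁻¹, 1, b, a] : Fin 5 → ℚ) i * n.1 i j := by
    intro i j
    change (t.1 * n.1) i j = _
    rw [eqt, diagMat, diagonal_mul]
  have hz : ∀ i, i ≠ 0 → i ≠ 1 → n.1 i 1 = 0 := by
    intro i hi0 hi1
    have := hc1 i
    rw [hc0, one_apply_ne hi0, diagMat, diagonal_apply_ne _ hi1] at this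
    have hε0 : (ε : ℚ) ≠ 0 := fun h => by simp [h] at hεQ
    simpa [hε0, hbQ'] using this
  refine mem_GammaHat_of_flag hN hn_mem hc0 hε ?_ (hz 2 (by decide) (by decide))
    (hz 3 (by decide) (by decide)) (fun j => ?_) (fun j => ?_)
  · have := hc1 1
    rw [hc0, one_apply_ne (by decide), diagMat, diagonal_apply_eq] at this
    simp only [zero_mul, zero_add, cons_val_one, cons_val_zero] at this
    rw [← mul_assoc, mul_eq_right₀ (inv_ne_zero hbQ')] at this
    linear_combination ε * this - n.1 1 1 * hεQ
  -- Row 0 of t n is a⁻¹ times row 0 of n.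
  · have := matDen_dvd_iff.1 hg1' 0 j
    rw [hrow] at this
    simpa [haQ] using this
  -- Since the first column of n is e₀, this minor of t n is (ab)⁻¹ n₁ⱼ.
  · have := matDen_dvd_iff.1 hg2' (0, 1) (0, j)
    rw [minors_apply, hrow, hrow, hrow, hrow, hc0, hc0] at this
    convert this using 1
    simp
    field_simp

end Extremal

/-! ### The degree on the orthogonal groups -/

section HeckeAlgebras

variable {N : ℕ}

theorem isGamma_weyl : IsGamma N !![0, 0, 0, 0, -1; 0, 0, 0, -1, 0; 0, 0, 1, 0, 0; 0, -1, 0, 0, 0;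
    -1, 0, 0, 0, 0] := by
  have h := (((isGamma_unipB (N := N) 1).mul (isGamma_unipB' (-1))).mul (isGamma_unipB 1)).mul
    (((isGamma_unipA (N := N) 1).mul (isGamma_unipA' (-1))).mul (isGamma_unipA 1))
  convert h using 1
  ext i j
  fin_cases i <;> fin_cases j <;>
    simp [unipA, unipA', unipB, unipB', Matrix.mul_apply, Fin.sum_univ_succ]

theorem diagMat_mul_diagMat (a b a' b' : ℕ) :
    diagMat a b * diagMat a' b' = diagMat (a * a' : ℕ) (b * b' : ℕ) := by
  rw [diagMat, diagMat, diagMat, diagonal_mul_diagonal]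
  congr 1
  ext i
  fin_cases i <;> simp [mul_comm]

/-- The integral Weyl element reverses the order of the diagonal entries, which inverts diag(1/a,
1/b, 1, b, a). -/
theorem exists_conj_eq_inv {t : SpecialLinearGroup (Fin 5) ℚ} {a b : ℕ} (ha : 0 < a) (hb : 0 < b)
    (ht : t.1 = diagMat a b) : ∃ w ∈ GammaHat N, w * t * w⁻¹ = t⁻¹ := by
  obtain ⟨w, hw, hw'⟩ := (isGamma_weyl (N := N)).exists_mem_GammaHat
  refine ⟨w, hw, ?_⟩
  have haQ : (a : ℚ) ≠ 0 := Nat.cast_ne_zero.2 ha.ne'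
  have hbQ : (b : ℚ) ≠ 0 := Nat.cast_ne_zero.2 hb.ne'
  have h : t * (w * t) = w := by
    refine Subtype.ext ?_
    change t.1 * (w.1 * t.1) = w.1
    rw [ht, diagMat]
    ext i j
    rw [diagonal_mul, mul_diagonal, hw']
    fin_cases i <;> fin_cases j <;> simp [toQ, haQ, hbQ]
  rw [mul_inv_eq_iff_eq_mul, eq_inv_mul_iff_mul_eq]
  exact h

variable {H : Subgroup (SpecialLinearGroup (Fin 5) ℚ)}

theorem exists_normal_form_subgroup (hN : Squarefree N) (hΓ : GammaHat N ≤ H) (hH : H ≤ GHat N)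
    (g : H) : ∃ u ∈ (GammaHat N).subgroupOf H, ∃ v ∈ (GammaHat N).subgroupOf H, ∃ a b : ℕ,
      0 < a ∧ b ∣ a ∧ (u * g * v).1.1 = diagMat a b ∧ matDen g.1.1 = a ∧
      matDen (minors g.1.1) = a * b := by
  obtain ⟨u, hu, v, hv, a, b, h⟩ := exists_normal_form hN (hH g.2)
  exact ⟨⟨u, hΓ hu⟩, hu, ⟨v, hΓ hv⟩, hv, a, b, h⟩

theorem matDeg_diagMat {a b : ℕ} (ha : 0 < a) (hab : b ∣ a) {g : Matrix (Fin 5) (Fin 5) ℚ}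
    (h1 : matDen g = a) (h2 : matDen (minors g) = a * b) : matDeg (diagMat a b) = matDeg g := by
  rw [matDeg_eq_iff, matDen_diagMat ha hab, matDen_minors_diagMat ha hab]
  exact ⟨h1.symm, h2.symm⟩

theorem isDegree_matDeg (hN : Squarefree N) (hΓ : GammaHat N ≤ H) (hH : H ≤ GHat N) :
    IsDegree ((GammaHat N).subgroupOf H) fun g : H => matDeg g.1.1 where
  deg_of_mem u hu := matDeg_eq_one (mem_intSubring_of_mem_GammaHat hu)
  deg_mul_le g h := matDeg_mul_le g.1.1 h.1.1
  mem_doubleCoset g h hgh := by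
    obtain ⟨u, hu, v, hv, a, b, ha, hba, ht, h1, h2⟩ := exists_normal_form_subgroup hN hΓ hH g
    obtain ⟨u', hu', v', hv', a', b', ha', hba', ht', h1', h2'⟩ :=
      exists_normal_form_subgroup hN hΓ hH h
    obtain ⟨e1, e2⟩ := matDeg_eq_iff.1 hgh
    obtain rfl : a' = a := by rw [← h1, ← h1', e1]
    obtain rfl : b' = b := Nat.eq_of_mul_eq_mul_left ha' (by rw [← h2, ← h2', e2])
    have e : u * g * v = u' * h * v' := Subtype.ext (Subtype.ext (ht.trans ht'.symm))
    refine DoubleCoset.mem_doubleCoset.2 ⟨u'⁻¹ * u, mul_mem (inv_mem hu') hu, v * v'⁻¹,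
      mul_mem hv (inv_mem hv'), ?_⟩
    rw [show u'⁻¹ * u * g * (v * v'⁻¹) = u'⁻¹ * (u * g * v) * v'⁻¹ by group, e]
    group
  exists_leading g h := by
    obtain ⟨u, hu, v, hv, a, b, ha, hba, ht, h1, h2⟩ := exists_normal_form_subgroup hN hΓ hH g
    obtain ⟨u', hu', v', hv', a', b', ha', hba', ht', h1', h2'⟩ :=
      exists_normal_form_subgroup hN hΓ hH h
    generalize u * g * v = t at *
    generalize u' * h * v' = t' at *
    have hb := Nat.pos_of_dvd_of_pos hba ha
    have hb' := Nat.pos_of_dvd_of_pos hba' ha'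
    -- The product of the two normal forms is again in normal form, with parameters aa' and bb', so
    -- its degree is the product of the degrees.
    refine ⟨t * t', t', ?_, ?_, ?_, fun d hd hk => ?_⟩
    · change matDeg (t.1.1 * t'.1.1) = _
      rw [ht, ht', diagMat_mul_diagMat, matDeg_eq_mul_iff, matDen_diagMat (Nat.mul_pos ha ha')
        (mul_dvd_mul hba hba'), matDen_minors_diagMat (Nat.mul_pos ha ha') (mul_dvd_mul hba hba'),
        h1, h2, h1', h2']
      exact ⟨rfl, by ring⟩
    · rw [ht', matDeg_diagMat ha' hba' h1' h2']
    · rw [mul_inv_cancel_right, ht, matDeg_diagMat ha hba h1 h2]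
    · obtain ⟨e1, e2⟩ := matDeg_eq_iff.1 hd
      obtain ⟨e3, e4⟩ := matDeg_eq_iff.1 hk
      rw [coset_eq_iff]
      exact mul_inv_mem_GammaHat hN (hH t'.2) (hH d.2) ha hb ha' hb' ht ht' (e1.trans h1').dvd
        (e2.trans h2').dvd (e3.trans h1).dvd (e4.trans h2).dvd

theorem inv_mem_doubleCoset (hN : Squarefree N) (hΓ : GammaHat N ≤ H) (hH : H ≤ GHat N) (g : H) :
    g⁻¹ ∈ DoubleCoset.doubleCoset g ((GammaHat N).subgroupOf H : Set H)
      ((GammaHat N).subgroupOf H : Set H) := by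
  obtain ⟨u, hu, v, hv, a, b, ha, hba, ht, -, -⟩ := exists_normal_form_subgroup hN hΓ hH g
  obtain ⟨w, hw, hwt⟩ := exists_conj_eq_inv (N := N) ha (Nat.pos_of_dvd_of_pos hba ha) ht
  set w' : H := ⟨w, hΓ hw⟩
  have hw' : w' ∈ (GammaHat N).subgroupOf H := hw
  have e : w' * (u * g * v) * w'⁻¹ = (u * g * v)⁻¹ := Subtype.ext hwt
  refine DoubleCoset.mem_doubleCoset.2 ⟨v * w' * u, mul_mem (mul_mem hv hw') hu, v * w'⁻¹ * u,
    mul_mem (mul_mem hv (inv_mem hw')) hu, ?_⟩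
  rw [show v * w' * u * g * (v * w'⁻¹ * u) = v * (w' * (u * g * v) * w'⁻¹) * u by group, e]
  group

theorem GammaHat_le_GHatPrimary (N p : ℕ) : GammaHat N ≤ GHatPrimary N p := by
  rintro _ ⟨hg, a, rfl⟩
  refine ⟨hg, 0, a.1, ?_⟩
  rw [pow_zero, inv_one, one_smul]
  rfl

theorem d1_eq_diagMat {p : ℕ} (hp : p.Prime) : (d1 N p hp).1.1 = diagMat p (1 : ℕ) := by
  have hp0 : (p : ℚ) ≠ 0 := Nat.cast_ne_zero.2 hp.ne_zero
  change (p : ℚ)⁻¹ • diagonal ![1, (p : ℚ), p, p, (p : ℚ) ^ 2] = _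
  rw [diagMat, ← diagonal_smul]
  congr 1
  ext i
  fin_cases i <;> simp [hp0]
  field_simp

theorem d2_eq_diagMat {p : ℕ} (hp : p.Prime) : (d2 N p hp).1.1 = diagMat p p := by
  have hp0 : (p : ℚ) ≠ 0 := Nat.cast_ne_zero.2 hp.ne_zero
  change (p : ℚ)⁻¹ • diagonal ![1, 1, (p : ℚ), (p : ℚ) ^ 2, (p : ℚ) ^ 2] = _
  rw [diagMat, ← diagonal_smul]
  congr 1
  ext i
  fin_cases i <;> simp [hp0] <;> field_simp

theorem matDeg_eq_toLex {g : Matrix (Fin 5) (Fin 5) ℚ} {x y : ℕ+} (h1 : matDen g = x)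
    (h2 : matDen (minors g) = y) : matDeg g = toLex (x, y) :=
  congrArg toLex (Prod.ext (PNat.eq h1) (PNat.eq h2))

theorem matDeg_d1_pow_mul_d2_pow {p : ℕ} (hp : p.Prime) {P : ℕ+} (hP : (P : ℕ) = p) (i j : ℕ) :
    matDeg (d1 N p hp).1.1 ^ i * matDeg (d2 N p hp).1.1 ^ j =
      toLex (P ^ (i + j), P ^ (i + 2 * j)) := by
  have h1 : matDeg (d1 N p hp).1.1 = toLex (P, P) := by
    rw [d1_eq_diagMat]
    refine matDeg_eq_toLex ((matDen_diagMat hp.pos (one_dvd p)).trans hP.symm) ?_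
    rw [matDen_minors_diagMat hp.pos (one_dvd p), mul_one, hP]
  have h2 : matDeg (d2 N p hp).1.1 = toLex (P, P ^ 2) := by
    rw [d2_eq_diagMat]
    refine matDeg_eq_toLex ((matDen_diagMat hp.pos dvd_rfl).trans hP.symm) ?_
    rw [matDen_minors_diagMat hp.pos dvd_rfl, PNat.pow_coe, pow_two, hP]
  rw [h1, h2, ← toLex_pow, ← toLex_pow, ← toLex_mul, Prod.pow_mk, Prod.pow_mk, Prod.mk_mul_mk,
    ← pow_mul, ← pow_add, ← pow_add]

theorem matDen_dvd_of_mem_GHatPrimary {p : ℕ} (hp : p.Prime)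
    {g : SpecialLinearGroup (Fin 5) ℚ} (hg : g ∈ GHatPrimary N p) : ∃ r, matDen g.1 ∣ p ^ r := by
  obtain ⟨-, r, M, hM⟩ := hg
  have hp0 : (p : ℚ) ≠ 0 := Nat.cast_ne_zero.2 hp.ne_zero
  refine ⟨r, matDen_dvd_iff.2 fun i j => ⟨M i j, ?_⟩⟩
  rw [hM]
  change (M i j : ℚ) = ((p ^ r : ℕ) : ℚ) * (((p : ℚ) ^ r)⁻¹ * (M i j : ℚ))
  push_cast
  field_simp

end HeckeAlgebras

end HeckeSO

theorem theorem3 (N : ℕ) (hN : Squarefree N) :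
    (∀ (p : ℕ) (hp : p.Prime),
      ∃ φ : MvPolynomial (Fin 2) ℤ ≃+* HeckeSO.HeckePrimary N p,
        φ (MvPolynomial.X 0) = HeckeSO.T1 N p hp ∧
        φ (MvPolynomial.X 1) = HeckeSO.T2 N p hp) ∧
    NoZeroDivisors (HeckeSO.HeckeFull N) := by
  open HeckeSO in
  refine ⟨fun p hp => ?_, (isDegree_matDeg hN inf_le_left le_rfl).noZeroDivisors⟩
  have hΓ := GammaHat_le_GHatPrimary N p
  have hH := GHatPrimary_le N p
  obtain ⟨P, hP⟩ : ∃ P : ℕ+, (P : ℕ) = p := ⟨⟨p, hp.pos⟩, rfl⟩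
  have hdeg := isDegree_matDeg hN hΓ hH
  have hU := isHeckePair_of_le hH
  refine hdeg.exists_mvPolynomial_ringEquiv (T := ![T1 N p hp, T2 N p hp])
    (t := ![d1 N p hp, d2 N p hp])
    (heckeAlgebra_mul_comm fun g => inv_mem_doubleCoset hN hΓ hH g) ?_ ?_ ?_
  · intro i
    fin_cases i
    · exact hdeg.hasLeading_doubleCosetElement hU (d1 N p hp)
    · exact hdeg.hasLeading_doubleCosetElement hU (d2 N p hp)
  · intro g
    obtain ⟨u, hu, v, hv, a, b, ha, hba, -, h1, h2⟩ := exists_normal_form hN (hH g.2)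
    obtain ⟨r, hr⟩ := matDen_dvd_of_mem_GHatPrimary hp g.2
    rw [h1] at hr
    obtain ⟨i, -, rfl⟩ := (Nat.dvd_prime_pow hp).1 hr
    obtain ⟨j, hj, rfl⟩ := (Nat.dvd_prime_pow hp).1 hba
    -- The degree of a = pⁱ, b = pʲ is (pⁱ, pⁱ⁺ʲ). As j ≤ i, it is (p, p) to the power i - j times
    -- (p, p²) to the power j.
    refine ⟨i - j, j, Eq.trans ?_ (matDeg_d1_pow_mul_d2_pow hp hP (i - j) j).symm⟩
    refine matDeg_eq_toLex ?_ ?_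
    · rw [h1, PNat.pow_coe, Nat.sub_add_cancel hj, hP]
    · rw [h2, PNat.pow_coe, ← pow_add, hP, show i - j + 2 * j = i + j by omega]
  · intro i j i' j' h
    -- The exponents i + j and i + 2j of the two components determine i and j.
    have h := (matDeg_d1_pow_mul_d2_pow hp hP i j).symm.trans
      (h.trans (matDeg_d1_pow_mul_d2_pow hp hP i' j'))
    obtain ⟨h1, h2⟩ := Prod.mk.inj (toLex.injective h)
    have h3 := congrArg PNat.val h1
    have h4 := congrArg PNat.val h2
    rw [PNat.pow_coe, PNat.pow_coe, hP] at h3 h4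
    have h5 := Nat.pow_right_injective hp.two_le h3
    have h6 := Nat.pow_right_injective hp.two_le h4
    omega
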